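/- Setting. Let $K:\mathbb R\to\mathbb R$ be even, continuous, $C^2$ on $\mathbb R\setminus\{0\}$, with $K,K',K''$ bounded (the derivatives on $\mathbb R\setminus\{0\}$) and $K'\in L^1(\mathbb R)$. Let $W:[0,\infty)\to[0,\infty)$ be differentiable on $(0,\infty)$ and let $\phi(r)=rW'(r)-W(r)$ be a $C^1$ strictly increasing function on $[0,\infty)$ with $\phi(0)=0$, such that for some $c_0>0$ one has $\phi'(r)r\le c_0\phi(r)$ and $\phi(r)\le\max\{r,c_0W(r)\}$, and for some $c_1,c_2>0$ and $\hat\rho<1<\bar\rho$ ($\hat\rho>0$) one has $\phi(r)\le c_1r$ for $r\le\hat\rho$ and $\phi(r)\ge c_2r$ for $r\ge\bar\rho$. Let $L>0$, $\mathbb T_L=\mathbb R/L\mathbb Z$; on $\mathbb T_L$ the kernel is $z\mapsto K(|z|)$ with $|z|=\mathrm{dist}(z,L\mathbb Z)$, that is, $K$ and $K'$ are evaluated at the representative of $z$ in $[-L/2,L/2)$, and $(K'*\rho)(x)=\int_{\mathbb T_L}K'(x-y)\rho(y)\,dy$. Let $\rho_{0,L}\in L^\infty(\mathbb T_L)$ with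 $c_L=\int_{\mathbb T_L}\rho_{0,L}\le1$. For $N\ge1$ set $x_0=-L/2$ and $x_k=\sup\{x\in[-L/2,L/2]:\int_{x_{k-1}}^x\rho_{0,L}<c_L/N\}$ for $k\ge 1$. The $N$ particles $x_0(t),\dots,x_{N-1}(t)$ on $\mathbb T_L$ (with $x_{k+N}=x_k$ on $\mathbb T_L$, that is, $x_{k+N}=x_k+L$ in $\mathbb R$) solve $$\dot x_k=-\frac{c_L}{N}\sum_{j\ne k}K'(x_k-x_j)-\frac N{c_L}\bigl[\phi(\rho_k)-\phi(\rho_{k-1})\bigr],\qquad \rho_k=\frac{c_L}{N(x_{k+1}-x_k)},\qquad x_k(0)=x_k,$$ and are well defined on $[0,T]$ if $x_0(t)<\dots<x_{N-1}(t)<x_0(t)+L$ for all $t\in[0,T]$. (Solutions are absolutely continuous and satisfy the equation for a.e. $t$; the kernel on $\mathbb T_L$ has one-sided derivatives $\pm K'(L/2)$ at the point antipodal to $0$, and when $x_k-x_j=L/2$ in $\mathbb T_L$ the term $K'(x_k-x_j)$ may be any number between $-K'(L/2)$ and $K'(L/2)$.) The deterministic particle approximation is $\rho^N_L(t,x)=\sum_{k=0}^{N-1}\rho_k(t)\chi_{[x_k(t),x_{k+1}(t))}(x)$.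 Theorem. Assume in addition that $\rho_{0,L}\ge\varepsilon_L>0$ a.e. on $\mathbb T_L$. Then for every $T>0$ there is $\bar N$ such that for all $N\ge\bar N$ the particles starting from $\rho_{0,L}$ exist and are well defined on $[0,T]$, and for any choice of them the approximations $\{\rho^N_L\}_{N\ge\bar N}$ converge, up to subsequences (every subsequence has a further convergent one), strongly in $L^1([0,T]\times\mathbb T_L)$. The limit $\rho_L$ is nonnegative, bounded, satisfies $\int_{\mathbb T_L}\rho_L(t,x)\,dx=c_L$ for a.e. $t\in[0,T]$ (so it is a probability density if $c_L=1$), and is a weak solution of $\partial_t\rho=\partial_x\bigl(\rho\,\partial_x(K*\rho)+\partial_x\phi(\rho)\bigr)$ on $\mathbb T_L$, that is, for all $\varphi\in C_c^\infty((0,T)\times\mathbb T_L)$ $$\int_0^T\!\!\int_{\mathbb T_L}\rho_L\,\partial_t\varphi-\rho_L\,(K'*\rho_L)\,\partial_x\varphi+\phi(\rho_L)\,\partial_{xx}\varphi\;dx\,dt=0.$$ -/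

import Mathlib

open MeasureTheory Filter Topology
open scoped ContDiff ENNReal

noncomputable section

namespace ParticleScheme

/-- Standing assumptions on the interaction kernel `K`: it is even, continuous on `ℝ` and `C²` away
from the origin, `K`, `K'`, `K''` are bounded (the derivatives away from the origin), and `K'` is
integrable. -/
structure IsKernel (K : ℝ → ℝ) : Prop where
  even : ∀ z, K z = K |z|
  continuous : Continuous K
  contDiffOn : ContDiffOn ℝ 2 K {0}ᶜ
  bounded : ∃ M, ∀ z, |K z| ≤ M
  bounded_deriv : ∃ M, ∀ z, z ≠ 0 → |deriv K z| ≤ M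
  bounded_deriv2 : ∃ M, ∀ z, z ≠ 0 → |deriv (deriv K) z| ≤ M
  integrable_deriv : Integrable (deriv K)

/-- Standing assumptions on the energy density `W` and the diffusion `φ(r) = r W'(r) - W(r)`, both
functions on `[0, ∞)` (their values at negative numbers play no role). At `r = 0` the first term
of `r W'(r) - W(r)` vanishes. -/
structure IsDiffusion (W φ : ℝ → ℝ) : Prop where
  differentiableOn : DifferentiableOn ℝ W (Set.Ioi 0)
  eq : ∀ r, 0 ≤ r → φ r = r * deriv W r - W r
  contDiffOn : ContDiffOn ℝ 1 φ (Set.Ici 0)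
  nonneg : ∀ r, 0 ≤ r → 0 ≤ W r
  zero : φ 0 = 0
  strictMonoOn : StrictMonoOn φ (Set.Ici 0)
  growth : ∃ c₀ > 0, (∀ r, 0 < r → deriv φ r * r ≤ c₀ * φ r) ∧
    (∀ r, 0 ≤ r → φ r ≤ max r (c₀ * W r))
  small : ∃ c₁ > 0, ∃ r₁, 0 < r₁ ∧ r₁ < 1 ∧ ∀ r, 0 ≤ r → r ≤ r₁ → φ r ≤ c₁ * r
  large : ∃ c₂ > 0, ∃ r₂, 1 < r₂ ∧ ∀ r, r₂ ≤ r → c₂ * r ≤ φ r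

/-- The representative in `[-L/2, L/2)` of the class of `z` in `ℝ / Lℤ`. -/
def rep (L z : ℝ) : ℝ := z - L * round (z / L)

/-- The derivative at `z` of the kernel `K` on the torus `ℝ / Lℤ`, i.e. of the `L`-periodic function
`z ↦ K (rep L z) = K (dist z Lℤ)`, as a set. It is the singleton `{K' (rep L z)}`, except at the
points `z ∈ L/2 + Lℤ` antipodal to the origin. There the periodic function has the left derivative
`K' (L/2)` and the right derivative `-K' (L/2)`, and the set is the segment between these
(which is `{0}` if `K' (L/2) = 0`). -/
def slopes (K : ℝ → ℝ) (L z : ℝ) : Set ℝ :=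
  {s | (rep L z ≠ -(L / 2) ∧ s = deriv K (rep L z)) ∨
    (rep L z = -(L / 2) ∧ s ∈ Set.uIcc (deriv K (L / 2)) (-deriv K (L / 2)))}

/-- The convolution `(K' ∗ r)(x)` on the torus, for an `L`-periodic function `r`. -/
def conv (K : ℝ → ℝ) (L : ℝ) (r : ℝ → ℝ) (x : ℝ) : ℝ :=
  ∫ y in (-(L / 2))..(L / 2), deriv K (rep L (x - y)) * r y

/-- The mass of an `L`-periodic function over one period. -/
def mass (L : ℝ) (r : ℝ → ℝ) : ℝ := ∫ y in (-(L / 2))..(L / 2), r y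

/-- The initial positions `x₀ = -L/2` and `xₖ = sup {x : ∫_{xₖ₋₁}^x ρ₀ < c / N}`, where `c` is the
mass of `ρ₀` and the torus is identified with `[-L/2, L/2]`. -/
def initialPos (L : ℝ) (ρ₀ : ℝ → ℝ) (N : ℕ) : ℕ → ℝ
  | 0 => -(L / 2)
  | k + 1 => sSup {x | x ∈ Set.Icc (-(L / 2)) (L / 2) ∧
      ∫ y in (initialPos L ρ₀ N k)..x, ρ₀ y < mass L ρ₀ / N}

/-- The value `ρₖ = c / (N (xₖ₊₁ - xₖ))` of the discrete density, for particles at `x`. -/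
def cellDensity (c : ℝ) (N : ℕ) (x : ℤ → ℝ) (k : ℤ) : ℝ := c / (N * (x (k + 1) - x k))

/-- `x` describes the `N` particles on the torus `ℝ / Lℤ`, starting from `ρ₀`, on the time interval
`[0, T]`. The positions are lifted to `ℝ` and the indices to `ℤ`: `x (k + N) t = x k t + L` is the
same particle as `x k t`, and the particles other than the `k`-th are those with index
`k + 1, …, k + N - 1`. The ordering of the particles on the torus is preserved on `[0, T]`, and
`xₖ' = -(c / N) ∑_{j ≠ k} K' (xₖ - xⱼ) - (N / c) (φ (ρₖ) - φ (ρₖ₋₁))`.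
As the kernel on the torus may fail to be differentiable at antipodal points, a solution is an
absolutely continuous curve for which the equation holds at almost every time, where
`K' (xₖ - xⱼ)` stands for some element of `slopes K L (xₖ - xⱼ)`. -/
structure IsParticles (K φ : ℝ → ℝ) (L : ℝ) (ρ₀ : ℝ → ℝ) (T : ℝ) (N : ℕ) (x : ℤ → ℝ → ℝ) :
    Prop where
  lift : ∀ t ∈ Set.Icc 0 T, ∀ k : ℤ, x (k + N) t = x k t + L
  ordered : ∀ t ∈ Set.Icc 0 T, ∀ k : ℤ, x k t < x (k + 1) t
  initial : ∀ k : ℕ, k < N → x k 0 = initialPos L ρ₀ N k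
  absolutelyContinuous : ∀ k, AbsolutelyContinuousOnInterval (x k) 0 T
  ode : ∀ᵐ t, t ∈ Set.Ioo 0 T → ∀ k : ℤ, ∃ s : ℤ → ℝ,
    (∀ j ∈ Finset.Ioo k (k + N), s j ∈ slopes K L (x k t - x j t)) ∧
    HasDerivAt (x k)
      (-(mass L ρ₀ / N) * ∑ j ∈ Finset.Ioo k (k + N), s j
        - N / mass L ρ₀ * (φ (cellDensity (mass L ρ₀) N (fun i => x i t) k)
            - φ (cellDensity (mass L ρ₀) N (fun i => x i t) (k - 1)))) t

/-- The piecewise constant density `∑_{k < N} ρₖ χ_{[xₖ, xₖ₊₁)}` on the torus, as an `L`-periodic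
function on `ℝ`, for particles at `x` and total mass `c`. -/
def density (L c : ℝ) (N : ℕ) (x : ℤ → ℝ) (y : ℝ) : ℝ :=
  ∑ k ∈ Finset.range N, Set.indicator {z | ∃ m : ℤ, z + m * L ∈ Set.Ico (x k) (x (k + 1))}
    (fun _ => cellDensity c N x k) y

/-- Test functions in `C_c^∞((0, T) × ℝ/Lℤ)`, as functions that are `L`-periodic in space. -/
structure IsTest (L T : ℝ) (ψ : ℝ → ℝ → ℝ) : Prop where
  smooth : ContDiff ℝ ∞ (Function.uncurry ψ)
  periodic : ∀ t, Function.Periodic (ψ t) L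
  support : ∃ a b, 0 < a ∧ b < T ∧ ∀ t, t ∉ Set.Icc a b → ∀ x, ψ t x = 0

/-- `ρ` is a weak solution of `∂ₜρ = ∂ₓ(ρ ∂ₓ(K ∗ ρ) + ∂ₓ φ(ρ))` on `(0, T) × ℝ/Lℤ`. -/
def IsWeakSolution (K φ : ℝ → ℝ) (L T : ℝ) (ρ : ℝ → ℝ → ℝ) : Prop :=
  ∀ ψ, IsTest L T ψ →
    ∫ t in (0 : ℝ)..T, ∫ x in (-(L / 2))..(L / 2),
      (ρ t x * deriv (fun s => ψ s x) t
        - ρ t x * conv K L (ρ t) x * deriv (ψ t) x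
        + φ (ρ t x) * deriv (deriv (ψ t)) x) = 0

end ParticleScheme

end

namespace ParticleScheme

/-! ### The kernel on the torus -/

/-! The scheme is a perturbed gradient flow, and everything rests on one energy estimate. The energy
`d * W (m / d)` of a cell has derivative `-φ (m / d)` in its length `d`, so summation by parts turns
the production of ∑ (xₖ₊₁ - xₖ) W(ρₖ) into ∑ xₖ' (φ(ρₖ) - φ(ρₖ₋₁)). The interaction velocity is
bounded by cM and is absorbed by completing the square. Hence D = N ∑ (φ(ρₖ) - φ(ρₖ₋₁))² is bounded
in L¹(0, T) uniformly in N (`IsParticles.integral_dissipation_le`), and by Cauchy–Schwarz √D bounds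
the total variation of φ(ρᴺ(t)).

Upper bound: some cell has density at most c/L, so φ(ρᴺ) ≤ φ(c/L) + √D, and the linear growth of φ
at infinity makes max ρᴺ integrable in time. At a shortest cell the diffusion pushes the end points
apart, while their interaction velocities differ by at most (cM + 6Mρₖ) times the length: K' is
Lipschitz except for jumps at 0 and L/2, and these affect only a bounded number of particles.
Gronwall's argument for minus the logarithm of the shortest length yields a bound R independent of N
(`exists_apriori_bounds`).

Existence: the vector field, truncated at short cells, is bounded but discontinuous at antipodal
pairs. Ultrafilter limits of Euler polygons solve the corresponding inclusion
(`exists_generalized_solution`), and the bound R shows that the truncation is never active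
(`exists_particles`).

Compactness: the distribution functions are R-Lipschitz in space, and their oscillation in time is
controlled by the mean displacement of the particles, hence by D. Arzelà–Ascoli makes a subsequence
uniformly Cauchy. This upgrades to L¹ through |a - b| ≤ δ + κ (φ(a) - φ(b))(a - b): integrated by
parts, the product is at most the uniform distance of the distribution functions times √D + √D'
(`integral_abs_density_sub_le`).

Limit equation: when (c/N) ∑ ψ(t, xₖ) is differentiated in time, the quadrature errors and the
replacement of the drift by the convolution cost O(1/N), and the diffusion term is exact
(`IsConfig.abs_consistency_le`). Dominated convergence gives the weak formulation. -/

theorem rep_add_period {L : ℝ} (hL : 0 < L) (z : ℝ) : rep L (z + L) = rep L z := by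
  unfold rep
  have : (z + L) / L = z / L + 1 := by field_simp
  rw [this, round_add_one]
  push_cast
  ring

theorem rep_sub_period {L : ℝ} (hL : 0 < L) (z : ℝ) : rep L (z - L) = rep L z := by
  rw [← rep_add_period hL (z - L), sub_add_cancel]

theorem rep_eq_self {L z : ℝ} (hL : 0 < L) (h₁ : -(L / 2) ≤ z) (h₂ : z < L / 2) :
    rep L z = z := by
  have : round (z / L) = 0 := by
    rw [round_eq, Int.floor_eq_zero_iff]
    constructor
    · have : -(1 / 2) ≤ z / L := by rw [le_div_iff₀ hL]; linarith
      linarith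
    · have : z / L < 1 / 2 := by rw [div_lt_iff₀ hL]; linarith
      linarith
  simp [rep, this]

theorem rep_eq_add {L z : ℝ} (hL : 0 < L) (h₁ : -L < z) (h₂ : z < -(L / 2)) :
    rep L z = z + L := by
  rw [← rep_add_period hL, rep_eq_self hL (by linarith) (by linarith)]

theorem measurable_rep (L : ℝ) : Measurable (rep L) := by
  unfold rep
  have : Measurable (fun z : ℝ => round (z / L)) := by
    simp only [round_eq]
    exact Int.measurable_floor.comp (by fun_prop)
  fun_prop

/-- `M` bounds the derivative of `K`, and is a Lipschitz constant for it on either side of `0`. -/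
structure KernelBound (K : ℝ → ℝ) (M : ℝ) : Prop where
  pos : 0 < M
  abs_deriv_le : ∀ z, |deriv K z| ≤ M
  lipschitz_neg : ∀ a b, a < 0 → b < 0 → |deriv K a - deriv K b| ≤ M * |a - b|
  lipschitz_pos : ∀ a b, 0 < a → 0 < b → |deriv K a - deriv K b| ≤ M * |a - b|
  odd : ∀ z, deriv K (-z) = -deriv K z

theorem IsKernel.exists_bound {K : ℝ → ℝ} (hK : IsKernel K) : ∃ M, KernelBound K M := by
  obtain ⟨M₁, h₁⟩ := hK.bounded_deriv
  obtain ⟨M₂, h₂⟩ := hK.bounded_deriv2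
  have hodd : ∀ z, deriv K (-z) = -deriv K z := by
    intro z
    have : K = fun z => K (-z) := by
      funext w; rw [hK.even w, hK.even (-w), abs_neg]
    conv_rhs => rw [this, deriv_comp_neg]
    simp
  -- Oddness settles the origin whether or not `K` is differentiable there, so the bound on K'
  -- extends to all of ℝ.
  have h0 : deriv K 0 = 0 := by
    have := hodd 0
    simp only [neg_zero] at this
    linarith
  have hd : ∀ z : ℝ, z ≠ 0 → DifferentiableAt ℝ (deriv K) z := by
    intro z hz
    have hopen : IsOpen ({0}ᶜ : Set ℝ) := isOpen_compl_singleton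
    have : ContDiffOn ℝ 1 (deriv K) {0}ᶜ :=
      hK.contDiffOn.deriv_of_isOpen hopen (by norm_num)
    exact (this.differentiableOn (by norm_num)).differentiableAt (hopen.mem_nhds hz)
  refine ⟨|M₁| + |M₂| + 1, by positivity, ?_, ?_, ?_, hodd⟩
  · intro z
    by_cases hz : z = 0
    · rw [hz, h0]; simp only [abs_zero]; positivity
    · have := h₁ z hz
      have := le_abs_self M₁
      have := abs_nonneg M₂
      linarith
  · intro a b ha hb
    have := (convex_Iio (0 : ℝ)).norm_image_sub_le_of_norm_deriv_le
      (f := deriv K) (C := |M₁| + |M₂| + 1) (fun x hx => hd x (ne_of_lt hx))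
      (fun x hx => by
        have := h₂ x (ne_of_lt hx)
        have := le_abs_self M₂
        have := abs_nonneg M₁
        rw [Real.norm_eq_abs]; linarith) hb ha
    simpa [Real.norm_eq_abs] using this
  · intro a b ha hb
    have := (convex_Ioi (0 : ℝ)).norm_image_sub_le_of_norm_deriv_le
      (f := deriv K) (C := |M₁| + |M₂| + 1) (fun x hx => hd x (ne_of_gt hx))
      (fun x hx => by
        have := h₂ x (ne_of_gt hx)
        have := le_abs_self M₂
        have := abs_nonneg M₁
        rw [Real.norm_eq_abs]; linarith) hb ha
    simpa [Real.norm_eq_abs] using this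

variable {K : ℝ → ℝ} {L M : ℝ}

theorem KernelBound.abs_slopes_le (hM : KernelBound K M) {z s : ℝ} (hs : s ∈ slopes K L z) :
    |s| ≤ M := by
  rcases hs with ⟨_, rfl⟩ | ⟨_, hs⟩
  · exact hM.abs_deriv_le _
  · have h := abs_le.1 (hM.abs_deriv_le (L / 2))
    rw [Set.mem_uIcc] at hs
    rw [abs_le]
    rcases hs with hs | hs <;> constructor <;> linarith [hs.1, hs.2, h.1, h.2]

/-- At antipodal points `rep` picks -L/2, and the value there is an end point of the segment. This
makes the single-valued kernel of `conv` and of `truncatedField` comparable with arbitrary slopes.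
-/
theorem KernelBound.deriv_mem_slopes (hM : KernelBound K M) (z : ℝ) :
    deriv K (rep L z) ∈ slopes K L z := by
  by_cases h : rep L z = -(L / 2)
  · refine Or.inr ⟨h, ?_⟩
    rw [h, hM.odd]
    exact Set.right_mem_uIcc
  · exact Or.inl ⟨h, rfl⟩

theorem slopes_eq_of_lt {z s : ℝ} (hL : 0 < L) (h₁ : -L < z) (h₂ : z < -(L / 2))
    (hs : s ∈ slopes K L z) : s = deriv K (z + L) := by
  have h := rep_eq_add hL h₁ h₂
  rcases hs with ⟨_, rfl⟩ | ⟨h', _⟩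
  · rw [h]
  · rw [h] at h'; linarith

theorem slopes_eq_of_gt {z s : ℝ} (hL : 0 < L) (h₁ : -(L / 2) < z) (h₂ : z < 0)
    (hs : s ∈ slopes K L z) : s = deriv K z := by
  have h := rep_eq_self hL h₁.le (by linarith)
  rcases hs with ⟨_, rfl⟩ | ⟨h', _⟩
  · rw [h]
  · rw [h] at h'; linarith

/-- On `(-L, 0)`, the slopes of the kernel vary at a bounded rate away from `-L / 2`. -/
theorem KernelBound.slopes_sub_le (hM : KernelBound K M) (hL : 0 < L) {a b s s' : ℝ}
    (ha : -L < a) (hab : a ≤ b) (hb : b < 0) (h : ¬ (a ≤ -(L / 2) ∧ -(L / 2) ≤ b))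
    (hs : s ∈ slopes K L a) (hs' : s' ∈ slopes K L b) : |s - s'| ≤ M * (b - a) := by
  have hba : |a - b| = b - a := by rw [abs_sub_comm, abs_of_nonneg (by linarith)]
  by_cases h₁ : a ≤ -(L / 2)
  · have h₂ : b < -(L / 2) := by
      by_contra h₂
      exact h ⟨h₁, not_lt.1 h₂⟩
    rw [slopes_eq_of_lt hL ha (by linarith) hs, slopes_eq_of_lt hL (by linarith) h₂ hs', ← hba]
    simpa using hM.lipschitz_pos (a + L) (b + L) (by linarith) (by linarith)
  · rw [not_le] at h₁
    rw [slopes_eq_of_gt hL h₁ (by linarith) hs, slopes_eq_of_gt hL (by linarith) hb hs', ← hba]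
    exact hM.lipschitz_neg a b (by linarith) hb

theorem KernelBound.slopes_sub_le_two (hM : KernelBound K M) {a b s s' : ℝ}
    (hs : s ∈ slopes K L a) (hs' : s' ∈ slopes K L b) : |s - s'| ≤ 2 * M := by
  have h₁ := abs_le.1 (hM.abs_slopes_le hs)
  have h₂ := abs_le.1 (hM.abs_slopes_le hs')
  rw [abs_le]
  constructor <;> linarith [h₁.1, h₁.2, h₂.1, h₂.2]

/-! ### Ordered configurations on the torus -/

/-- Positions of `N` ordered particles on `ℝ / Lℤ`, lifted to `ℝ`. -/
structure IsConfig (L : ℝ) (N : ℕ) (y : ℤ → ℝ) : Prop where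
  lift : ∀ k, y (k + N) = y k + L
  ordered : ∀ k, y k < y (k + 1)

/-- Used to count the particles across which the kernel jumps at the antipodal point. -/
theorem card_le_two_of_le_add_one {S : Finset ℤ} (h : ∀ a ∈ S, ∀ b ∈ S, b ≤ a + 1) :
    S.card ≤ 2 := by
  rcases S.eq_empty_or_nonempty with rfl | hS
  · simp
  · have : S ⊆ Finset.Icc (S.min' hS) (S.min' hS + 1) := by
      intro b hb
      rw [Finset.mem_Icc]
      exact ⟨Finset.min'_le _ _ hb, h _ (Finset.min'_mem _ _) _ hb⟩
    have h' := Finset.card_le_card this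
    rw [Int.card_Icc] at h'
    have : (S.min' hS + 1 + 1 - S.min' hS).toNat = 2 := by
      have : S.min' hS + 1 + 1 - S.min' hS = 2 := by ring
      rw [this]; rfl
    omega

theorem sum_range_shift {g : ℤ → ℝ} {N : ℕ} (hg : ∀ k, g (k + N) = g k) :
    ∑ k ∈ Finset.range N, g (k + 1) = ∑ k ∈ Finset.range N, g k := by
  have h₁ := Finset.sum_range_succ (fun k : ℕ => g k) N
  have h₂ := Finset.sum_range_succ' (fun k : ℕ => g k) N
  have h₃ := hg 0
  simp only [zero_add] at h₃
  push_cast at h₂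
  linarith

theorem sum_range_shift_neg {g : ℤ → ℝ} {N : ℕ} (hg : ∀ k, g (k + N) = g k) :
    ∑ k ∈ Finset.range N, g (k - 1) = ∑ k ∈ Finset.range N, g k := by
  rw [← sum_range_shift (g := fun k => g (k - 1)) (N := N)]
  · simp
  · intro k
    rw [← hg (k - 1)]
    congr 1; ring

namespace IsConfig

variable {L c : ℝ} {N : ℕ} {y : ℤ → ℝ}

theorem strictMono (h : IsConfig L N y) : StrictMono y :=
  strictMono_int_of_lt_succ h.ordered

theorem pos (h : IsConfig L N y) (hL : 0 < L) : 0 < N := by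
  rcases Nat.eq_zero_or_pos N with rfl | h'
  · have := h.lift 0
    simp at this
    linarith
  · exact h'

theorem lift_mul (h : IsConfig L N y) (k m : ℤ) : y (k + m * N) = y k + m * L := by
  induction m with
  | zero => simp
  | succ n ih =>
    have := h.lift (k + n * N)
    rw [show k + ((n : ℤ) + 1) * N = k + n * N + N by ring, this, ih]
    push_cast; ring
  | pred n ih =>
    have := h.lift (k + (-(n : ℤ) - 1) * N)
    rw [show k + (-(n : ℤ) - 1) * N + N = k + (-(n : ℤ)) * N by ring, ih] at this
    push_cast at this ⊢
    linarith

theorem exists_cell (h : IsConfig L N y) (hL : 0 < L) (z : ℝ) :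
    ∃ j, y j ≤ z ∧ z < y (j + 1) := by
  set m := ⌊(z - y 0) / L⌋ with hm
  have h₁ : y (m * N) ≤ z := by
    have := h.lift_mul 0 m
    rw [zero_add] at this
    rw [this]
    have := Int.floor_le ((z - y 0) / L)
    rw [le_div_iff₀ hL] at this
    rw [hm]; linarith
  have h₂ : z < y ((m + 1) * N) := by
    have := h.lift_mul 0 (m + 1)
    rw [zero_add] at this
    rw [this]
    have := Int.lt_floor_add_one ((z - y 0) / L)
    rw [div_lt_iff₀ hL] at this
    rw [hm]; push_cast; linarith
  obtain ⟨j, hj, hj'⟩ := Int.exists_greatest_of_bdd (P := fun j => y j ≤ z)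
    ⟨(m + 1) * N, fun j hj => by
      by_contra hlt
      have := h.strictMono (not_le.1 hlt)
      linarith⟩ ⟨m * N, h₁⟩
  refine ⟨j, hj, ?_⟩
  by_contra hlt
  have := hj' (j + 1) (not_lt.1 hlt)
  omega

theorem cell_unique (h : IsConfig L N y) {z : ℝ} {i j : ℤ} (hi : y i ≤ z) (hi' : z < y (i + 1))
    (hj : y j ≤ z) (hj' : z < y (j + 1)) : i = j := by
  have h₁ : i < j + 1 := h.strictMono.lt_iff_lt.1 (by linarith)
  have h₂ : j < i + 1 := h.strictMono.lt_iff_lt.1 (by linarith)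
  omega

theorem gap_add (h : IsConfig L N y) (k : ℤ) : y (k + N + 1) - y (k + N) = y (k + 1) - y k := by
  have h₁ := h.lift k
  have h₂ := h.lift (k + 1)
  rw [show k + 1 + (N : ℤ) = k + N + 1 by ring] at h₂
  rw [h₁, h₂]; ring

theorem cellDensity_add (h : IsConfig L N y) (k : ℤ) :
    cellDensity c N y (k + N) = cellDensity c N y k := by
  simp only [cellDensity, h.gap_add]

theorem cellDensity_add_mul (h : IsConfig L N y) (k m : ℤ) :
    cellDensity c N y (k + m * N) = cellDensity c N y k := by
  have h₂ := h.lift_mul (k + 1) m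
  rw [show k + 1 + m * (N : ℤ) = k + m * N + 1 by ring] at h₂
  simp only [cellDensity, h₂, h.lift_mul]
  congr 2; ring

theorem cellDensity_pos (h : IsConfig L N y) (hL : 0 < L) (hc : 0 < c) (k : ℤ) :
    0 < cellDensity c N y k := by
  have := h.ordered k
  have hN : (0 : ℝ) < N := by exact_mod_cast h.pos hL
  exact div_pos hc (mul_pos hN (by linarith))

theorem cellDensity_mul_gap (h : IsConfig L N y) (hL : 0 < L) (k : ℤ) :
    cellDensity c N y k * (y (k + 1) - y k) = c / N := by
  have h₁ := h.ordered k
  have hN : (0 : ℝ) < N := by exact_mod_cast h.pos hL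
  have : y (k + 1) - y k ≠ 0 := by linarith
  rw [cellDensity]
  field_simp

/-- Only the indicator of the residue of `j` modulo `N` is nonzero at `z`: a translate of `z` by
periods lies in exactly one cell. -/
theorem density_eq (h : IsConfig L N y) (hL : 0 < L) {z : ℝ} {j : ℤ} (hj : y j ≤ z)
    (hj' : z < y (j + 1)) : density L c N y z = cellDensity c N y j := by
  have hN : (0 : ℤ) < N := by exact_mod_cast h.pos hL
  have hr₀ : 0 ≤ j % N := Int.emod_nonneg _ hN.ne'
  have hr₁ : j % N < N := Int.emod_lt_of_pos _ hN
  have hcast : (((j % N).toNat : ℕ) : ℤ) = j % N := Int.toNat_of_nonneg hr₀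
  unfold density
  rw [Finset.sum_eq_single (j % N).toNat]
  · rw [Set.indicator_of_mem]
    · rw [hcast, ← h.cellDensity_add_mul (j % N) (j / N), Int.emod_add_ediv_mul]
    · refine ⟨-(j / N), ?_⟩
      have e₁ := h.lift_mul j (-(j / N))
      have e₂ := h.lift_mul (j + 1) (-(j / N))
      have e₃ : j + -(j / N) * N = j % N := by
        have := Int.emod_add_ediv_mul j N
        linarith
      rw [show j + 1 + -(j / N) * (N : ℤ) = j + -(j / N) * N + 1 by ring] at e₂
      rw [e₃] at e₁ e₂
      rw [hcast, e₁, e₂]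
      constructor <;> linarith
  · intro k hk hne
    rw [Set.indicator_of_notMem]
    rintro ⟨m, hm₁, hm₂⟩
    apply hne
    have e₁ := h.lift_mul j m
    have e₂ := h.lift_mul (j + 1) m
    rw [show j + 1 + m * (N : ℤ) = j + m * N + 1 by ring] at e₂
    have := h.cell_unique hm₁ hm₂ (j := j + m * N) (by linarith) (by linarith)
    have hk' : ((k : ℤ) % N) = k :=
      Int.emod_eq_of_lt (by omega) (by exact_mod_cast Finset.mem_range.1 hk)
    rw [this, Int.add_mul_emod_self_right] at hk'
    omega
  · intro hk
    exfalso
    apply hk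
    rw [Finset.mem_range]
    omega

theorem density_periodic (h : IsConfig L N y) (hL : 0 < L) :
    Function.Periodic (density L c N y) L := by
  intro z
  obtain ⟨j, hj, hj'⟩ := h.exists_cell hL z
  have e₂ := h.lift (j + 1)
  rw [show j + 1 + (N : ℤ) = j + N + 1 by ring] at e₂
  rw [h.density_eq hL hj hj', h.density_eq hL (j := j + N), h.cellDensity_add]
  · rw [h.lift]; linarith
  · rw [e₂]; linarith

theorem density_nonneg (h : IsConfig L N y) (hL : 0 < L) (hc : 0 < c) (z : ℝ) :
    0 ≤ density L c N y z := by
  obtain ⟨j, hj, hj'⟩ := h.exists_cell hL z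
  rw [h.density_eq hL hj hj']
  exact (h.cellDensity_pos hL hc j).le

theorem density_le (h : IsConfig L N y) (hL : 0 < L) {R : ℝ}
    (hR : ∀ k, cellDensity c N y k ≤ R) (z : ℝ) : density L c N y z ≤ R := by
  obtain ⟨j, hj, hj'⟩ := h.exists_cell hL z
  rw [h.density_eq hL hj hj']
  exact hR j

theorem integral_cell (h : IsConfig L N y) (hL : 0 < L) (G : ℝ → ℝ → ℝ) (k : ℤ) :
    ∫ z in (y k)..(y (k + 1)), G (density L c N y z) z
      = ∫ z in (y k)..(y (k + 1)), G (cellDensity c N y k) z := by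
  rw [intervalIntegral.integral_of_le (h.ordered k).le,
    intervalIntegral.integral_of_le (h.ordered k).le, integral_Ioc_eq_integral_Ioo,
    integral_Ioc_eq_integral_Ioo]
  refine setIntegral_congr_fun measurableSet_Ioo fun z hz => ?_
  simp only [h.density_eq hL hz.1.le hz.2]

theorem integral_span (y : ℤ → ℝ) {f : ℝ → ℝ}
    (hf : ∀ a b, IntervalIntegrable f volume a b) (k : ℤ) (n : ℕ) :
    ∫ z in (y k)..(y (k + n)), f z
      = ∑ i ∈ Finset.range n, ∫ z in (y (k + i))..(y (k + i + 1)), f z := by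
  have := intervalIntegral.sum_integral_adjacent_intervals (μ := volume) (f := f)
    (a := fun i : ℕ => y (k + i)) (n := n) (fun i _ => hf _ _)
  simp only [Nat.cast_zero, add_zero, Nat.cast_add, Nat.cast_one, ← add_assoc] at this
  exact this.symm

/-- By periodicity the window may be moved to [y₀, y₀ + L], which is a union of whole cells. -/
theorem integral_period (h : IsConfig L N y) {f : ℝ → ℝ}
    (hper : Function.Periodic f L)
    (hf : ∀ a b, IntervalIntegrable f volume a b) :
    ∫ z in (-(L / 2))..(L / 2), f z
      = ∑ i ∈ Finset.range N, ∫ z in (y i)..(y (i + 1)), f z := by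
  have h₁ := hper.intervalIntegral_add_eq (-(L / 2)) (y 0)
  have h₂ := integral_span y hf 0 N
  simp only [zero_add] at h₂
  have h₃ := h.lift 0
  rw [zero_add] at h₃
  rw [← h₂, h₃, ← h₁]
  congr 1; ring

theorem sum_gap (h : IsConfig L N y) :
    ∑ k ∈ Finset.range N, (y (k + 1) - y k) = L := by
  have h₁ := Finset.sum_range_sub (fun k : ℕ => y k) N
  have h₃ := h.lift 0
  rw [zero_add] at h₃
  push_cast at h₁
  rw [h₁, h₃]; simp

/-- Every index has a representative in `{0, …, N - 1}`. -/
theorem forall_of_range (h : IsConfig L N y) (hL : 0 < L) {p : ℤ → Prop}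
    (hp : ∀ k m : ℤ, p k → p (k + m * N)) (hr : ∀ k ∈ Finset.range N, p (k : ℤ)) (k : ℤ) : p k := by
  have hN : (0 : ℤ) < N := by exact_mod_cast h.pos hL
  have hr₀ : 0 ≤ k % N := Int.emod_nonneg _ hN.ne'
  have hr₁ : k % N < N := Int.emod_lt_of_pos _ hN
  have := hp (k % N) (k / N) (by
    have := hr (k % N).toNat (by rw [Finset.mem_range]; omega)
    rwa [Int.toNat_of_nonneg hr₀] at this)
  rwa [Int.emod_add_ediv_mul] at this

/-- Otherwise all cells would be shorter than L/N and could not fill the circle. This cell anchors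
the pointwise bound on φ(ρ) by its variation. -/
theorem exists_cellDensity_le (h : IsConfig L N y) (hL : 0 < L) (hc : 0 < c) :
    ∃ k ∈ Finset.range N, cellDensity c N y k ≤ c / L := by
  have hN : 0 < N := h.pos hL
  have hN' : (0 : ℝ) < N := by exact_mod_cast hN
  by_contra hcon
  push Not at hcon
  have hlt : ∀ k ∈ Finset.range N, y (k + 1) - y k < L / N := by
    intro k hk
    have h₁ := hcon k hk
    have h₂ := h.ordered k
    rw [cellDensity, div_lt_div_iff_of_pos_left hc hL (mul_pos hN' (by linarith))] at h₁
    rw [lt_div_iff₀ hN']; linarith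
  have := Finset.sum_lt_sum_of_nonempty (Finset.nonempty_range_iff.2 hN.ne') hlt
  rw [h.sum_gap] at this
  simp only [Finset.sum_const, Finset.card_range, nsmul_eq_mul] at this
  rw [mul_div_cancel₀ _ hN'.ne'] at this
  exact lt_irrefl _ this

/-- The differences of positions that occur in the interaction lie in `(-L, 0)`. -/
theorem sub_mem_Ioo (h : IsConfig L N y) {k j : ℤ} (hj : j ∈ Finset.Ioo k (k + N)) :
    -L < y k - y j ∧ y k - y j < 0 := by
  rw [Finset.mem_Ioo] at hj
  have h₁ := h.strictMono hj.1
  have h₂ := h.strictMono hj.2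
  rw [h.lift] at h₂
  constructor <;> linarith

end IsConfig

theorem measurable_density (L c : ℝ) (N : ℕ) {x : ℤ → ℝ → ℝ} (hx : ∀ k, Measurable (x k)) :
    Measurable (fun p : ℝ × ℝ => density L c N (fun k => x k p.1) p.2) := by
  unfold density
  refine Finset.measurable_sum _ fun k _ => ?_
  have hx' : ∀ k, Measurable (fun p : ℝ × ℝ => x k p.1) := fun k => (hx k).comp measurable_fst
  have hS : MeasurableSet {p : ℝ × ℝ | ∃ m : ℤ, p.2 + m * L ∈ Set.Ico (x k p.1) (x (k + 1) p.1)} := by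
    rw [show {p : ℝ × ℝ | ∃ m : ℤ, p.2 + m * L ∈ Set.Ico (x k p.1) (x (k + 1) p.1)}
      = ⋃ m : ℤ, {p : ℝ × ℝ | p.2 + m * L ∈ Set.Ico (x k p.1) (x (k + 1) p.1)} by
        ext p; simp]
    refine MeasurableSet.iUnion fun m => ?_
    exact (measurableSet_le (hx' k) (by fun_prop)).inter
      (measurableSet_lt (by fun_prop) (hx' (k + 1)))
  have hc : Measurable (fun p : ℝ × ℝ => cellDensity c N (fun k => x k p.1) k) := by
    unfold cellDensity
    exact measurable_const.div (measurable_const.mul ((hx' _).sub (hx' _)))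
  exact hc.indicator hS

theorem measurable_density_right (L c : ℝ) (N : ℕ) (y : ℤ → ℝ) :
    Measurable (density L c N y) :=
  (measurable_density L c N (x := fun k _ => y k) (fun _ => measurable_const)).comp
    (measurable_const (a := (0 : ℝ)).prodMk measurable_id)

/-! ### The initial positions -/

theorem intervalIntegrable_of_memLp_top {ρ₀ : ℝ → ℝ} (hbdd : MemLp ρ₀ ∞ volume) (a b : ℝ) :
    IntervalIntegrable ρ₀ volume a b :=
  ((hbdd.locallyIntegrable le_top).integrableOn_isCompact isCompact_uIcc).intervalIntegrable

/-- Two-sided bounds for the integrals of `ρ₀`. -/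
structure DataBound (ρ₀ : ℝ → ℝ) (ε M₀ : ℝ) : Prop where
  pos : 0 < ε
  le : ε ≤ M₀
  intervalIntegrable : ∀ a b, IntervalIntegrable ρ₀ volume a b
  lower : ∀ a b, a ≤ b → ε * (b - a) ≤ ∫ y in a..b, ρ₀ y
  upper : ∀ a b, a ≤ b → ∫ y in a..b, ρ₀ y ≤ M₀ * (b - a)

theorem exists_dataBound {ρ₀ : ℝ → ℝ} (hbdd : MemLp ρ₀ ∞ volume) {ε : ℝ} (hε : 0 < ε)
    (hpos : ∀ᵐ x, ε ≤ ρ₀ x) : ∃ M₀, DataBound ρ₀ ε M₀ := by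
  have hi := intervalIntegrable_of_memLp_top hbdd
  have hup : ∃ M₀ : ℝ, ∀ᵐ x, ρ₀ x ≤ M₀ := by
    refine ⟨(eLpNorm ρ₀ ∞ volume).toReal, ?_⟩
    have h := ae_le_eLpNormEssSup (f := ρ₀) (μ := volume)
    rw [← eLpNorm_exponent_top] at h
    filter_upwards [h] with x hx
    refine (le_abs_self _).trans ?_
    have := ENNReal.toReal_mono hbdd.2.ne hx
    simpa using this
  obtain ⟨M₀, hM₀⟩ := hup
  have hlow : ∀ a b, a ≤ b → ε * (b - a) ≤ ∫ y in a..b, ρ₀ y := by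
    intro a b hab
    have := intervalIntegral.integral_mono_ae hab (f := fun _ => ε) (g := ρ₀)
      (by simp) (hi a b) hpos
    simpa [mul_comm] using this
  have hupp : ∀ a b, a ≤ b → ∫ y in a..b, ρ₀ y ≤ M₀ * (b - a) := by
    intro a b hab
    have := intervalIntegral.integral_mono_ae hab (f := ρ₀) (g := fun _ => M₀) (hi a b)
      (by simp) hM₀
    simpa [mul_comm] using this
  refine ⟨M₀, hε, ?_, hi, hlow, hupp⟩
  have h₁ := hlow 0 1 zero_le_one
  have h₂ := hupp 0 1 zero_le_one
  linarith

namespace DataBound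

variable {ρ₀ : ℝ → ℝ} {ε M₀ L : ℝ}

theorem mass_pos (h : DataBound ρ₀ ε M₀) (hL : 0 < L) : 0 < mass L ρ₀ := by
  have := h.lower (-(L / 2)) (L / 2) (by linarith)
  refine lt_of_lt_of_le ?_ this
  have := h.pos
  rw [show L / 2 - -(L / 2) = L by ring]
  positivity

theorem strictMono (h : DataBound ρ₀ ε M₀) (a : ℝ) :
    StrictMono (fun x => ∫ y in a..x, ρ₀ y) := by
  intro x x' hx
  have h₁ := h.lower x x' hx.le
  have h₂ := intervalIntegral.integral_add_adjacent_intervals (h.intervalIntegrable a x)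
    (h.intervalIntegrable x x')
  have : 0 < ε * (x' - x) := mul_pos h.pos (by linarith)
  simp only
  linarith

theorem initialPos_spec (h : DataBound ρ₀ ε M₀) (hL : 0 < L) {N : ℕ} (hN : 0 < N) (k : ℕ)
    (hk : k ≤ N) : initialPos L ρ₀ N k ∈ Set.Icc (-(L / 2)) (L / 2) ∧
      ∫ y in (-(L / 2))..(initialPos L ρ₀ N k), ρ₀ y = k * (mass L ρ₀ / N) := by
  have hN' : (0 : ℝ) < N := by exact_mod_cast hN
  have hc := h.mass_pos hL
  have hq : 0 < mass L ρ₀ / N := by positivity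
  induction k with
  | zero =>
    simp only [initialPos, intervalIntegral.integral_same, Nat.cast_zero, zero_mul, and_true]
    constructor <;> linarith
  | succ k ih =>
    obtain ⟨ih₁, ih₂⟩ := ih (by omega)
    set F : ℝ → ℝ := fun x => ∫ y in (-(L / 2))..x, ρ₀ y with hF
    have hmono : StrictMono F := h.strictMono _
    have hcont : Continuous F :=
      intervalIntegral.continuous_primitive (fun a b => h.intervalIntegrable a b) _
    have hk1 : ((k + 1 : ℕ) : ℝ) ≤ N := by exact_mod_cast hk
    have hmem : ((k + 1 : ℕ) : ℝ) * (mass L ρ₀ / N) ∈ Set.Icc (F (-(L / 2))) (F (L / 2)) := by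
      constructor
      · simp only [hF, intervalIntegral.integral_same]; positivity
      · have : F (L / 2) = N * (mass L ρ₀ / N) := by
          rw [mul_div_cancel₀ _ hN'.ne']; rfl
        rw [this]
        gcongr
    obtain ⟨p, hp, hFp⟩ := intermediate_value_Icc (by linarith) hcont.continuousOn hmem
    have hplt : -(L / 2) < p := by
      rw [← hmono.lt_iff_lt, hFp]
      simp only [hF, intervalIntegral.integral_same]; positivity
    -- The mass up to xₖ is k c/N, so the condition reads F x < F p. Strict monotonicity of F turns
    -- the set into a half-open interval with supremum p.
    have hset : {x | x ∈ Set.Icc (-(L / 2)) (L / 2) ∧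
        ∫ y in (initialPos L ρ₀ N k)..x, ρ₀ y < mass L ρ₀ / N} = Set.Ico (-(L / 2)) p := by
      ext x
      have hx := intervalIntegral.integral_add_adjacent_intervals
        (h.intervalIntegrable (-(L / 2)) (initialPos L ρ₀ N k))
        (h.intervalIntegrable (initialPos L ρ₀ N k) x)
      have hiff : ∫ y in (initialPos L ρ₀ N k)..x, ρ₀ y < mass L ρ₀ / N ↔ x < p := by
        rw [← hmono.lt_iff_lt (a := x) (b := p), hFp]
        push_cast
        have : F x = ∫ y in (-(L / 2))..x, ρ₀ y := rfl
        rw [this, ← hx, ih₂]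
        constructor <;> intro h' <;> linarith
      simp only [Set.mem_ofPred_eq, Set.mem_Icc, Set.mem_Ico, hiff]
      constructor
      · rintro ⟨⟨a, _⟩, b⟩; exact ⟨a, b⟩
      · rintro ⟨a, b⟩; exact ⟨⟨a, by linarith [hp.2]⟩, b⟩
    have hpos : initialPos L ρ₀ N (k + 1) = p := by
      rw [initialPos, hset, csSup_Ico hplt]
    rw [hpos]
    exact ⟨hp, hFp⟩

theorem initialPos_last (h : DataBound ρ₀ ε M₀) (hL : 0 < L) {N : ℕ} (hN : 0 < N) :
    initialPos L ρ₀ N N = L / 2 := by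
  have hN' : (0 : ℝ) < N := by exact_mod_cast hN
  have := (h.initialPos_spec hL hN N le_rfl).2
  rw [mul_div_cancel₀ _ hN'.ne'] at this
  exact (h.strictMono (-(L / 2))).injective this

theorem initialPos_integral (h : DataBound ρ₀ ε M₀) (hL : 0 < L) {N : ℕ} (hN : 0 < N) (k : ℕ)
    (hk : k < N) :
    ∫ y in (initialPos L ρ₀ N k)..(initialPos L ρ₀ N (k + 1)), ρ₀ y = mass L ρ₀ / N := by
  have h₁ := (h.initialPos_spec hL hN k hk.le).2
  have h₂ := (h.initialPos_spec hL hN (k + 1) hk).2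
  have h₃ := intervalIntegral.integral_add_adjacent_intervals
    (h.intervalIntegrable (-(L / 2)) (initialPos L ρ₀ N k))
    (h.intervalIntegrable (initialPos L ρ₀ N k) (initialPos L ρ₀ N (k + 1)))
  rw [h₁, h₂] at h₃
  push_cast at h₃
  linarith

theorem initialPos_lt (h : DataBound ρ₀ ε M₀) (hL : 0 < L) {N : ℕ} (hN : 0 < N) (k : ℕ)
    (hk : k < N) : initialPos L ρ₀ N k < initialPos L ρ₀ N (k + 1) := by
  have hN' : (0 : ℝ) < N := by exact_mod_cast hN
  have hc := h.mass_pos hL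
  rw [← (h.strictMono (initialPos L ρ₀ N k)).lt_iff_lt]
  simp only [intervalIntegral.integral_same, h.initialPos_integral hL hN k hk]
  positivity

/-- The initial positions, extended to all indices, form a configuration. -/
theorem exists_initial_config (h : DataBound ρ₀ ε M₀) (hL : 0 < L) {N : ℕ} (hN : 0 < N) :
    ∃ y : ℤ → ℝ, IsConfig L N y ∧ ∀ k : ℕ, k < N → y k = initialPos L ρ₀ N k := by
  have hN' : (0 : ℤ) < N := by exact_mod_cast hN
  set y : ℤ → ℝ := fun k => initialPos L ρ₀ N (k % N).toNat + (k / N : ℤ) * L with hy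
  have hylift : ∀ k, y (k + N) = y k + L := by
    intro k
    simp only [hy, Int.add_emod_right, Int.add_ediv_of_dvd_right (dvd_refl (N : ℤ)),
      Int.ediv_self hN'.ne']
    push_cast; ring
  refine ⟨y, ⟨hylift, ?_⟩, ?_⟩
  · intro k
    have hr₀ : 0 ≤ k % N := Int.emod_nonneg _ hN'.ne'
    have hr₁ : k % N < N := Int.emod_lt_of_pos _ hN'
    have hk : k = k % N + N * (k / N) := (Int.emod_add_mul_ediv k N).symm
    have hlt := h.initialPos_lt hL hN (k % N).toNat (by omega)
    -- The last cell of a period ends at `initialPos L ρ₀ N N`, which is L/2 and thus the lift of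
    -- the first particle.
    by_cases hlast : k % N + 1 = N
    · have h₁ : (k + 1) % N = 0 := by
        rw [hk, show k % N + N * (k / N) + 1 = (k % N + 1) + N * (k / N) by ring, hlast]
        simp
      have h₂ : (k + 1) / N = k / N + 1 := by
        rw [show k + 1 = (k % N + 1) + N * (k / N) by omega, hlast,
          Int.add_mul_ediv_left _ _ hN'.ne', Int.ediv_self hN'.ne']
        ring
      have h₃ : (k % N).toNat + 1 = N := by omega
      rw [h₃, h.initialPos_last hL hN] at hlt
      simp only [hy, h₁, h₂, Int.toNat_zero, initialPos]
      push_cast; linarith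
    · have h₁ : (k + 1) % N = k % N + 1 := by
        rw [show k + 1 = (k % N + 1) + N * (k / N) by omega, Int.add_mul_emod_self_left]
        exact Int.emod_eq_of_lt (by omega) (by omega)
      have h₂ : (k + 1) / N = k / N := by
        rw [show k + 1 = (k % N + 1) + N * (k / N) by omega,
          Int.add_mul_ediv_left _ _ hN'.ne', Int.ediv_eq_zero_of_lt (by omega) (by omega)]
        ring
      have h₃ : (k % N + 1).toNat = (k % N).toNat + 1 := by omega
      simp only [hy, h₁, h₂, h₃]
      linarith
  · intro k hk
    have h₁ : (k : ℤ) % N = k := Int.emod_eq_of_lt (by omega) (by omega)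
    have h₂ : (k : ℤ) / N = 0 := Int.ediv_eq_zero_of_lt (by omega) (by omega)
    simp only [hy, h₁, h₂]
    simp

/-- Each initial cell carries the mass c/N, so its density is the mean of ρ₀ over the cell. -/
theorem cellDensity_initial (h : DataBound ρ₀ ε M₀) (hL : 0 < L) {N : ℕ} {y : ℤ → ℝ}
    (hy : IsConfig L N y) (hi : ∀ k : ℕ, k < N → y k = initialPos L ρ₀ N k) (k : ℤ) :
    ε ≤ cellDensity (mass L ρ₀) N y k ∧ cellDensity (mass L ρ₀) N y k ≤ M₀ := by
  have hN := hy.pos hL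
  have hN' : (0 : ℝ) < N := by exact_mod_cast hN
  revert k
  refine hy.forall_of_range hL (fun k m hk => by rwa [hy.cellDensity_add_mul]) fun k hk => ?_
  have hk' := Finset.mem_range.1 hk
  have h₁ : y (k + 1) = initialPos L ρ₀ N (k + 1) := by
    by_cases hlast : k + 1 < N
    · exact_mod_cast hi (k + 1) hlast
    · have : k + 1 = N := by omega
      have e₁ : y (k + 1) = y 0 + L := by
        rw [← hy.lift 0, zero_add]; congr 1; exact_mod_cast this
      have e₂ := hi 0 hN
      rw [Nat.cast_zero] at e₂
      rw [e₁, this, h.initialPos_last hL hN, e₂, initialPos]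
      ring
  have h₀ := hi k hk'
  have hint := h.initialPos_integral hL hN k hk'
  rw [← h₀, ← h₁] at hint
  have hlt := hy.ordered k
  have hl := h.lower _ _ hlt.le
  have hu := h.upper _ _ hlt.le
  rw [hint] at hl hu
  have hg : 0 < (N : ℝ) * (y (k + 1) - y k) := mul_pos hN' (by linarith)
  rw [cellDensity, le_div_iff₀ hg, div_le_iff₀ hg]
  rw [le_div_iff₀ hN'] at hl
  rw [div_le_iff₀ hN'] at hu
  constructor <;> linarith

end DataBound

/-! ### Absolutely continuous functions -/

theorem absolutelyContinuousOnInterval_of_abs_sub_le {f : ℝ → ℝ} {a b C : ℝ} (hab : a ≤ b)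
    (h : ∀ s ∈ Set.Icc a b, ∀ t ∈ Set.Icc a b, |f s - f t| ≤ C * |s - t|) :
    AbsolutelyContinuousOnInterval f a b := by
  refine LipschitzOnWith.absolutelyContinuousOnInterval (K := C.toNNReal) ?_
  rw [Set.uIcc_of_le hab]
  refine LipschitzOnWith.of_dist_le_mul fun s hs t ht => ?_
  rw [Real.dist_eq, Real.dist_eq]
  refine (h s hs t ht).trans ?_
  gcongr
  exact Real.le_coe_toNNReal C

theorem ae_restrict_Icc_of_Ioo {a b : ℝ} {p : ℝ → Prop} (h : ∀ᵐ t, t ∈ Set.Ioo a b → p t) :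
    ∀ᵐ t ∂(volume.restrict (Set.Icc a b)), p t := by
  rw [← Measure.restrict_congr_set Ioo_ae_eq_Icc, ae_restrict_iff' measurableSet_Ioo]
  exact h

/-- The particle equation holds only almost everywhere, so differential inequalities are integrated
through absolute continuity. -/
theorem sub_le_integral_of_deriv_le {f g : ℝ → ℝ} {a b : ℝ} (hab : a ≤ b)
    (hf : AbsolutelyContinuousOnInterval f a b) (hg : IntervalIntegrable g volume a b)
    (h : ∀ᵐ t, t ∈ Set.Ioo a b → deriv f t ≤ g t) : f b - f a ≤ ∫ t in a..b, g t := by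
  rw [← hf.integral_deriv_eq_sub]
  exact intervalIntegral.integral_mono_ae_restrict hab hf.intervalIntegrable_deriv hg
    (ae_restrict_Icc_of_Ioo h)

theorem abs_sub_le_integral_of_abs_deriv_le {f g : ℝ → ℝ} {a b : ℝ} (hab : a ≤ b)
    (hf : AbsolutelyContinuousOnInterval f a b) (hg : IntervalIntegrable g volume a b)
    (h : ∀ᵐ t, t ∈ Set.Ioo a b → |deriv f t| ≤ g t) : |f b - f a| ≤ ∫ t in a..b, g t := by
  rw [abs_le]
  constructor
  · have := sub_le_integral_of_deriv_le hab hf.neg hg (by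
      filter_upwards [h] with t ht hmem
      have := (abs_le.1 (ht hmem)).1
      rw [show -f = fun x => -f x from rfl, deriv.fun_neg]
      linarith)
    simp only [Pi.neg_apply] at this
    linarith
  · exact sub_le_integral_of_deriv_le hab hf hg (by
      filter_upwards [h] with t ht hmem using (abs_le.1 (ht hmem)).2)

theorem abs_sub_le_of_abs_deriv_le {f : ℝ → ℝ} {a b C : ℝ}
    (hf : AbsolutelyContinuousOnInterval f a b)
    (h : ∀ᵐ t, t ∈ Set.Ioo a b → |deriv f t| ≤ C) :
    ∀ s ∈ Set.Icc a b, ∀ t ∈ Set.Icc a b, |f s - f t| ≤ C * |s - t| := by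
  have key : ∀ s ∈ Set.Icc a b, ∀ t ∈ Set.Icc a b, s ≤ t → |f t - f s| ≤ C * (t - s) := by
    intro s hs t ht hst
    have hsub : Set.Icc s t ⊆ Set.Icc a b := Set.Icc_subset_Icc hs.1 ht.2
    have := abs_sub_le_integral_of_abs_deriv_le (g := fun _ => C) hst
      (hf.mono (by rwa [Set.uIcc_of_le hst, Set.uIcc_of_le (hs.1.trans hs.2)])) (by simp)
      (by
        filter_upwards [h] with r hr hmem
        exact hr ⟨hs.1.trans_lt hmem.1, hmem.2.trans_le ht.2⟩)
    simpa [mul_comm] using this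
  intro s hs t ht
  rcases le_total s t with hst | hst
  · rw [abs_sub_comm, abs_sub_comm s t, abs_of_nonneg (sub_nonneg.2 hst)]
    exact key s hs t ht hst
  · rw [abs_of_nonneg (sub_nonneg.2 hst)]
    exact key t ht s hs hst

/-! ### Velocities -/

/-- `v` is an interaction velocity of the `k`-th particle, up to the sign. -/
def IsDrift (K : ℝ → ℝ) (L c : ℝ) (N : ℕ) (y : ℤ → ℝ) (k : ℤ) (v : ℝ) : Prop :=
  ∃ s : ℤ → ℝ, (∀ j ∈ Finset.Ioo k (k + N), s j ∈ slopes K L (y k - y j)) ∧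
    v = c / N * ∑ j ∈ Finset.Ioo k (k + N), s j

/-- The increment `φ (ρₖ) - φ (ρₖ₋₁)`. -/
noncomputable def increment (φ : ℝ → ℝ) (c : ℝ) (N : ℕ) (y : ℤ → ℝ) (k : ℤ) : ℝ :=
  φ (cellDensity c N y k) - φ (cellDensity c N y (k - 1))

/-- The discrete dissipation `N ∑ₖ (φ (ρₖ) - φ (ρₖ₋₁))²`. -/
noncomputable def dissipation (φ : ℝ → ℝ) (c : ℝ) (N : ℕ) (y : ℤ → ℝ) : ℝ :=
  N * ∑ k ∈ Finset.range N, increment φ c N y k ^ 2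

theorem dissipation_nonneg (φ : ℝ → ℝ) (c : ℝ) (N : ℕ) (y : ℤ → ℝ) : 0 ≤ dissipation φ c N y := by
  unfold dissipation; positivity

section Drift

variable {K φ : ℝ → ℝ} {L M c : ℝ} {N : ℕ} {y : ℤ → ℝ}

theorem IsDrift.abs_le (hM : KernelBound K M) (hc : 0 < c) {k : ℤ} {v : ℝ}
    (h : IsDrift K L c N y k v) : |v| ≤ c * M := by
  obtain ⟨s, hs, rfl⟩ := h
  rcases Nat.eq_zero_or_pos N with rfl | hN
  · simp only [Nat.cast_zero, div_zero, zero_mul, abs_zero]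
    exact (mul_pos hc hM.pos).le
  have hN' : (0 : ℝ) < N := by exact_mod_cast hN
  have h₁ : |∑ j ∈ Finset.Ioo k (k + N), s j| ≤ N * M := by
    refine (Finset.abs_sum_le_sum_abs _ _).trans ?_
    refine (Finset.sum_le_card_nsmul _ _ M fun j hj => hM.abs_slopes_le (hs j hj)).trans ?_
    rw [nsmul_eq_mul]
    gcongr
    · exact hM.pos.le
    · rw [Int.card_Ioo]; omega
  rw [abs_mul, abs_of_pos (div_pos hc hN')]
  calc c / N * |∑ j ∈ Finset.Ioo k (k + N), s j| ≤ c / N * (N * M) := by gcongr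
    _ = c * M := by field_simp

/-- At a shortest cell, the drifts of the two end points are close. -/
theorem IsDrift.abs_sub_le (hM : KernelBound K M) (hL : 0 < L) (hc : 0 < c) (hN : 2 ≤ N)
    (hy : IsConfig L N y) {k : ℤ} (hmin : ∀ j, y (k + 1) - y k ≤ y (j + 1) - y j) {v v' : ℝ}
    (h : IsDrift K L c N y k v) (h' : IsDrift K L c N y (k + 1) v') :
    |v' - v| ≤ c * M * (y (k + 1) - y k) + 6 * M * (c / N) := by
  obtain ⟨s, hs, rfl⟩ := h
  obtain ⟨s', hs', rfl⟩ := h'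
  have hN' : (0 : ℝ) < N := by exact_mod_cast (by omega : 0 < N)
  set d := y (k + 1) - y k with hd
  have hd0 : 0 < d := sub_pos.2 (hy.ordered k)
  -- These particles act on both end points of the cell. The two remaining terms are the interaction
  -- of the end points with each other, where particle k appears as its lift k + N.
  set I := Finset.Ioo (k + 1) (k + N) with hI
  have e₁ : Finset.Ioo (k + 1) (k + 1 + N) = insert (k + N : ℤ) I := by
    ext j; simp only [hI, Finset.mem_insert, Finset.mem_Ioo]; omega
  have e₂ : Finset.Ioo k (k + N) = insert (k + 1) I := by
    ext j; simp only [hI, Finset.mem_insert, Finset.mem_Ioo]; omega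
  rw [e₁] at hs' ⊢
  rw [e₂] at hs ⊢
  rw [Finset.sum_insert (by simp [hI]), Finset.sum_insert (by simp [hI])]
  -- For these j the antipodal point of yⱼ lies in the cell, so the slope may jump. Their positions
  -- fit into an interval of length d while every cell has length at least d, so no two of these
  -- indices differ by 2 or more.
  set B := I.filter (fun j => y k - y j ≤ -(L / 2) ∧ -(L / 2) ≤ y (k + 1) - y j) with hB
  have hcard : B.card ≤ 2 := by
    refine card_le_two_of_le_add_one fun i hi j hj => ?_
    by_contra hlt
    have hi' := (Finset.mem_filter.1 hi).2
    have hj' := (Finset.mem_filter.1 hj).2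
    have h₁ := hmin i
    have h₂ := hmin (i + 1)
    have h₃ := hy.strictMono.monotone (show i + 1 + 1 ≤ j by omega)
    linarith [hi'.1, hi'.2, hj'.1, hj'.2]
  have hterm : ∀ j ∈ I, |s' j - s j| ≤ M * d +
      (if y k - y j ≤ -(L / 2) ∧ -(L / 2) ≤ y (k + 1) - y j then 2 * M else 0) := by
    intro j hj
    have hsj := hs j (Finset.mem_insert_of_mem hj)
    have hsj' := hs' j (Finset.mem_insert_of_mem hj)
    have hm₁ : j ∈ Finset.Ioo k (k + N) := by rw [e₂]; exact Finset.mem_insert_of_mem hj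
    have hm₂ : j ∈ Finset.Ioo (k + 1) (k + 1 + N) := by rw [e₁]; exact Finset.mem_insert_of_mem hj
    have hMd : 0 ≤ M * d := (mul_pos hM.pos hd0).le
    split_ifs with hbad
    · have := hM.slopes_sub_le_two hsj' hsj
      linarith
    · have := hM.slopes_sub_le hL (hy.sub_mem_Ioo hm₁).1 (by linarith [hy.ordered k])
        (hy.sub_mem_Ioo hm₂).2 hbad hsj hsj'
      rw [abs_sub_comm, add_zero]
      refine this.trans (le_of_eq ?_)
      rw [hd]; ring
  have hsum : |∑ j ∈ I, (s' j - s j)| ≤ N * (M * d) + 4 * M := by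
    refine (Finset.abs_sum_le_sum_abs _ _).trans ((Finset.sum_le_sum hterm).trans ?_)
    rw [Finset.sum_add_distrib, ← Finset.sum_filter, ← hB, Finset.sum_const, Finset.sum_const,
      nsmul_eq_mul, nsmul_eq_mul]
    have h₁ : (I.card : ℝ) ≤ N := by
      rw [hI, Int.card_Ioo]; exact_mod_cast (by omega)
    have h₂ : (B.card : ℝ) ≤ 2 := by exact_mod_cast hcard
    have := hM.pos
    have : (B.card : ℝ) * (2 * M) ≤ 2 * (2 * M) := by gcongr
    have : (I.card : ℝ) * (M * d) ≤ N * (M * d) := by gcongr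
    linarith
  have hl₁ := hM.abs_slopes_le (hs' (k + N) (Finset.mem_insert_self _ _))
  have hl₂ := hM.abs_slopes_le (hs (k + 1) (Finset.mem_insert_self _ _))
  rw [Finset.sum_sub_distrib] at hsum
  -- The constant 6M consists of two jumps of size 2M and the two unmatched terms, each at most M.
  have htot : |(s' (k + N) + ∑ j ∈ I, s' j) - (s (k + 1) + ∑ j ∈ I, s j)|
      ≤ N * (M * d) + 6 * M := by
    rw [_root_.abs_le] at *
    constructor <;> linarith [hl₁.1, hl₁.2, hl₂.1, hl₂.2, hsum.1, hsum.2]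
  rw [← mul_sub, abs_mul, abs_of_pos (div_pos hc hN')]
  calc c / N * _ ≤ c / N * (N * (M * d) + 6 * M) := by gcongr
    _ = c * M * d + 6 * M * (c / N) := by field_simp

end Drift

/-! ### Total variation of the discrete density -/

section Variation

variable {φ : ℝ → ℝ} {L c : ℝ} {N : ℕ} {y : ℤ → ℝ}

theorem increment_add (hy : IsConfig L N y) (k : ℤ) :
    increment φ c N y (k + N) = increment φ c N y k := by
  unfold increment
  rw [hy.cellDensity_add, show k + (N : ℤ) - 1 = k - 1 + N by ring, hy.cellDensity_add]

/-- Cauchy–Schwarz over N terms; the factor N in `dissipation` is there so that no N is left in this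
bound. -/
theorem sum_abs_increment_le (φ : ℝ → ℝ) (c : ℝ) (N : ℕ) (y : ℤ → ℝ) :
    ∑ k ∈ Finset.range N, |increment φ c N y k| ≤ √(dissipation φ c N y) := by
  refine Real.le_sqrt_of_sq_le ?_
  have := sq_sum_le_card_mul_sum_sq (s := Finset.range N)
    (f := fun k : ℕ => |increment φ c N y k|)
  simpa [dissipation, sq_abs] using this

theorem abs_sub_le_sum_increment (hy : IsConfig L N y) {i k : ℕ} (hi : i < N) (hk : k < N) :
    |φ (cellDensity c N y k) - φ (cellDensity c N y i)|
      ≤ ∑ k ∈ Finset.range N, |increment φ c N y k| := by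
  have hshift := sum_range_shift (g := fun k => |increment φ c N y k|) (N := N)
    (fun k => by simp only [increment_add hy])
  rw [← hshift]
  have key : ∀ m n : ℕ, m ≤ n → n < N →
      dist (φ (cellDensity c N y m)) (φ (cellDensity c N y n))
        ≤ ∑ k ∈ Finset.range N, |increment φ c N y (k + 1)| := by
    intro m n hmn hn
    refine (dist_le_Ico_sum_dist (fun i : ℕ => φ (cellDensity c N y i)) hmn).trans ?_
    refine (Finset.sum_le_sum_of_subset_of_nonneg (t := Finset.range N) ?_
      (fun _ _ _ => dist_nonneg)).trans (le_of_eq ?_)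
    · intro j hj
      rw [Finset.mem_Ico] at hj
      rw [Finset.mem_range]; omega
    · refine Finset.sum_congr rfl fun j _ => ?_
      rw [dist_comm, Real.dist_eq, increment]
      congr 3
      ring_nf
  rcases le_total i k with h | h
  · have := key i k h hk
    rwa [dist_comm, Real.dist_eq] at this
  · have := key k i h hi
    rwa [Real.dist_eq] at this

/-- Compare with a cell of density at most the mean c/L; going from there to cell k costs at most
the total variation. -/
theorem map_cellDensity_le (hy : IsConfig L N y) (hL : 0 < L) (hc : 0 < c)
    (hφ : StrictMonoOn φ (Set.Ici 0)) (k : ℤ) :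
    φ (cellDensity c N y k) ≤ φ (c / L) + √(dissipation φ c N y) := by
  obtain ⟨i, hi, hil⟩ := hy.exists_cellDensity_le hL hc
  have h₁ : φ (cellDensity c N y i) ≤ φ (c / L) :=
    hφ.monotoneOn (hy.cellDensity_pos hL hc i).le (div_pos hc hL).le hil
  revert k
  refine hy.forall_of_range hL (fun k m h => by rwa [hy.cellDensity_add_mul]) fun k hk => ?_
  have h₂ := abs_sub_le_sum_increment (φ := φ) (c := c) hy (Finset.mem_range.1 hi)
    (Finset.mem_range.1 hk)
  have h₃ := sum_abs_increment_le φ c N y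
  have h₄ := le_abs_self (φ (cellDensity c N y k) - φ (cellDensity c N y i))
  linarith

end Variation

/-! ### Regularity of the particle paths -/

theorem IsDiffusion.map_nonneg {W φ : ℝ → ℝ} (hφ : IsDiffusion W φ) {r : ℝ} (hr : 0 ≤ r) :
    0 ≤ φ r := by
  rw [← hφ.zero]
  exact hφ.strictMonoOn.monotoneOn Set.self_mem_Ici hr hr

theorem abs_sub_le_of_mem_Icc {a b B : ℝ} (ha : 0 ≤ a) (ha' : a ≤ B) (hb : 0 ≤ b) (hb' : b ≤ B) :
    |a - b| ≤ B := by
  rw [abs_le]; constructor <;> linarith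

namespace IsParticles

variable {K W φ ρ₀ : ℝ → ℝ} {L T M : ℝ} {N : ℕ} {x : ℤ → ℝ → ℝ}

theorem config (h : IsParticles K φ L ρ₀ T N x) {t : ℝ} (ht : t ∈ Set.Icc 0 T) :
    IsConfig L N (fun k => x k t) :=
  ⟨h.lift t ht, h.ordered t ht⟩

theorem ae_hasDerivAt (h : IsParticles K φ L ρ₀ T N x) : ∀ᵐ t, t ∈ Set.Ioo 0 T → ∀ k,
    ∃ v, IsDrift K L (mass L ρ₀) N (fun i => x i t) k v ∧
      HasDerivAt (x k) (-v - N / mass L ρ₀ * increment φ (mass L ρ₀) N (fun i => x i t) k) t := by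
  filter_upwards [h.ode] with t ht hmem k
  obtain ⟨s, hs, hder⟩ := ht hmem k
  refine ⟨_, ⟨s, hs, rfl⟩, ?_⟩
  convert hder using 1
  unfold increment
  ring

theorem continuousOn (h : IsParticles K φ L ρ₀ T N x) (hT : 0 ≤ T) (k : ℤ) :
    ContinuousOn (x k) (Set.Icc 0 T) := by
  have := (h.absolutelyContinuous k).continuousOn
  rwa [Set.uIcc_of_le hT] at this

/-- Only qualitative: m₀ comes from compactness of [0, T] and depends on the solution. It serves to
make the paths and the functionals of them Lipschitz in time, and does not enter the uniform
estimates. -/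
theorem exists_gap_pos (h : IsParticles K φ L ρ₀ T N x) (hL : 0 < L) (hT : 0 ≤ T) :
    ∃ m₀ > 0, ∀ t ∈ Set.Icc 0 T, ∀ k, m₀ ≤ x (k + 1) t - x k t := by
  have hN : 0 < N := (h.config (Set.left_mem_Icc.2 hT)).pos hL
  have hk : ∀ k : ℕ, ∃ m₀ > 0, ∀ t ∈ Set.Icc 0 T, m₀ ≤ x (k + 1) t - x k t := by
    intro k
    obtain ⟨t₀, ht₀, hmin⟩ := isCompact_Icc.exists_isMinOn (Set.nonempty_Icc.2 hT)
      ((h.continuousOn hT (k + 1)).sub (h.continuousOn hT k))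
    exact ⟨x (k + 1) t₀ - x k t₀, sub_pos.2 (h.ordered t₀ ht₀ k), fun t ht => hmin ht⟩
  choose m hm hm' using hk
  have hne : (Finset.range N).Nonempty := Finset.nonempty_range_iff.2 hN.ne'
  refine ⟨(Finset.range N).inf' hne m, ?_, fun t ht => ?_⟩
  · rw [gt_iff_lt, Finset.lt_inf'_iff]
    exact fun k _ => hm k
  · refine (h.config ht).forall_of_range hL ?_ ?_
    · intro k j hk
      have h₁ := (h.config ht).lift_mul k j
      have h₂ := (h.config ht).lift_mul (k + 1) j
      rw [show k + j * (N : ℤ) + 1 = k + 1 + j * N by ring, h₁, h₂]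
      linarith
    · intro k hk
      exact (Finset.inf'_le m hk).trans (hm' k t ht)

theorem cellDensity_le_of_gap {c m₀ : ℝ} {y : ℤ → ℝ} (hc : 0 < c) (hm₀ : 0 < m₀) (hN : 0 < N)
    {k : ℤ} (h : m₀ ≤ y (k + 1) - y k) : cellDensity c N y k ≤ c / (N * m₀) := by
  have hN' : (0 : ℝ) < N := by exact_mod_cast hN
  unfold cellDensity
  gcongr

theorem exists_lipschitz (h : IsParticles K φ L ρ₀ T N x) (hM : KernelBound K M)
    (hφ : IsDiffusion W φ) (hL : 0 < L) (hT : 0 ≤ T) (hc : 0 < mass L ρ₀) :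
    ∃ C, 0 ≤ C ∧
      ∀ k, ∀ s ∈ Set.Icc 0 T, ∀ t ∈ Set.Icc 0 T, |x k s - x k t| ≤ C * |s - t| := by
  obtain ⟨m₀, hm₀, hgap⟩ := h.exists_gap_pos hL hT
  have hN : 0 < N := (h.config (Set.left_mem_Icc.2 hT)).pos hL
  have hN' : (0 : ℝ) < N := by exact_mod_cast hN
  set c := mass L ρ₀ with hcdef
  set B := φ (c / (N * m₀)) with hB
  have hB0 : 0 ≤ B := hφ.map_nonneg (by positivity)
  refine ⟨c * M + N / c * B, ?_, fun k => ?_⟩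
  · have := hM.pos
    positivity
  refine abs_sub_le_of_abs_deriv_le (h.absolutelyContinuous k) ?_
  filter_upwards [h.ae_hasDerivAt] with t ht hmem
  obtain ⟨v, hv, hder⟩ := ht hmem k
  have hmem' : t ∈ Set.Icc 0 T := Set.Ioo_subset_Icc_self hmem
  rw [hder.deriv]
  have hbd : ∀ k, 0 ≤ φ (cellDensity c N (fun i => x i t) k) ∧
      φ (cellDensity c N (fun i => x i t) k) ≤ B := by
    intro k
    have h₀ := ((h.config hmem').cellDensity_pos hL hc k).le
    exact ⟨hφ.map_nonneg h₀, hφ.strictMonoOn.monotoneOn h₀ (by simp only [Set.mem_Ici]; positivity)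
      (cellDensity_le_of_gap hc hm₀ hN (hgap t hmem' k))⟩
  have hinc : |increment φ c N (fun i => x i t) k| ≤ B :=
    abs_sub_le_of_mem_Icc (hbd k).1 (hbd k).2 (hbd (k - 1)).1 (hbd (k - 1)).2
  calc |-v - N / c * increment φ c N (fun i => x i t) k|
      ≤ |-v| + |N / c * increment φ c N (fun i => x i t) k| := abs_sub _ _
    _ = |v| + N / c * |increment φ c N (fun i => x i t) k| := by
        rw [abs_neg, abs_mul, abs_of_pos (div_pos hN' hc)]
    _ ≤ c * M + N / c * B := by
        have := hv.abs_le hM hc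
        gcongr

theorem continuousOn_cellDensity (h : IsParticles K φ L ρ₀ T N x) (hL : 0 < L) (hT : 0 ≤ T)
    (c : ℝ) (k : ℤ) :
    ContinuousOn (fun t => cellDensity c N (fun i => x i t) k) (Set.Icc 0 T) := by
  have hN : 0 < N := (h.config (Set.left_mem_Icc.2 hT)).pos hL
  have hN' : (0 : ℝ) < N := by exact_mod_cast hN
  unfold cellDensity
  refine continuousOn_const.div (continuousOn_const.mul
    ((h.continuousOn hT _).sub (h.continuousOn hT _))) fun t ht => ?_
  exact (mul_pos hN' (sub_pos.2 (h.ordered t ht k))).ne'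

theorem continuousOn_increment (h : IsParticles K φ L ρ₀ T N x) (hφ : IsDiffusion W φ)
    (hL : 0 < L) (hT : 0 ≤ T) {c : ℝ} (hc : 0 < c) (k : ℤ) :
    ContinuousOn (fun t => increment φ c N (fun i => x i t) k) (Set.Icc 0 T) := by
  have : ∀ k, ContinuousOn (fun t => φ (cellDensity c N (fun i => x i t) k)) (Set.Icc 0 T) :=
    fun k => hφ.contDiffOn.continuousOn.comp (h.continuousOn_cellDensity hL hT c k)
      fun t ht => ((h.config ht).cellDensity_pos hL hc k).le
  exact (this k).sub (this (k - 1))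

theorem continuousOn_dissipation (h : IsParticles K φ L ρ₀ T N x) (hφ : IsDiffusion W φ)
    (hL : 0 < L) (hT : 0 ≤ T) {c : ℝ} (hc : 0 < c) :
    ContinuousOn (fun t => dissipation φ c N (fun i => x i t)) (Set.Icc 0 T) := by
  unfold dissipation
  exact continuousOn_const.mul (continuousOn_finsetSum _ fun k _ =>
    (h.continuousOn_increment hφ hL hT hc k).pow 2)

end IsParticles

/-! ### The energy estimate -/

/-- The energy of a cell of length `d` containing the mass `m`. -/
noncomputable def cellEnergy (W : ℝ → ℝ) (m d : ℝ) : ℝ := d * W (m / d)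

/-- This is where the relation between φ and W enters: with r = m/d the derivative is W(r) - r
W'(r). -/
theorem hasDerivAt_cellEnergy {W φ : ℝ → ℝ} (hφ : IsDiffusion W φ) {m d : ℝ} (hm : 0 < m)
    (hd : 0 < d) : HasDerivAt (cellEnergy W m) (-φ (m / d)) d := by
  have hr : 0 < m / d := div_pos hm hd
  have hW : HasDerivAt W (deriv W (m / d)) (m / d) :=
    (hφ.differentiableOn.differentiableAt (Ioi_mem_nhds hr)).hasDerivAt
  have hq : HasDerivAt (fun d : ℝ => m / d) (-m / d ^ 2) d := by
    have := (hasDerivAt_const d m).fun_div (hasDerivAt_id' d) hd.ne'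
    simpa using this
  have : HasDerivAt (cellEnergy W m) _ d := (hasDerivAt_id' d).fun_mul (hW.comp d hq)
  refine this.congr_deriv ?_
  rw [hφ.eq _ hr.le]
  field_simp
  ring

theorem cellEnergy_sub_le {W φ : ℝ → ℝ} (hφ : IsDiffusion W φ) {m m₀ : ℝ} (hm : 0 < m)
    (hm₀ : 0 < m₀) {d d' : ℝ} (hd : m₀ ≤ d) (hd' : m₀ ≤ d') :
    |cellEnergy W m d - cellEnergy W m d'| ≤ φ (m / m₀) * |d - d'| := by
  have := (convex_Ici m₀).norm_image_sub_le_of_norm_hasDerivWithin_le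
    (f := cellEnergy W m) (f' := fun d => -φ (m / d)) (C := φ (m / m₀))
    (fun d hd => (hasDerivAt_cellEnergy hφ hm (hm₀.trans_le hd)).hasDerivWithinAt)
    (fun d hd => by
      have hd0 : 0 < d := hm₀.trans_le hd
      rw [norm_neg, Real.norm_eq_abs, abs_of_nonneg (hφ.map_nonneg (by positivity))]
      refine hφ.strictMonoOn.monotoneOn (Set.mem_Ici.2 (by positivity))
        (Set.mem_Ici.2 (by positivity)) ?_
      gcongr
      exact hd) hd' hd
  simpa [Real.norm_eq_abs] using this

namespace IsParticles

variable {K W φ ρ₀ : ℝ → ℝ} {L T M ε M₀ : ℝ} {N : ℕ} {x : ℤ → ℝ → ℝ}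

/-- Summation by parts for the energy production, and the resulting bound. -/
theorem energy_production_le {c : ℝ} {y : ℤ → ℝ} (hy : IsConfig L N y) (hM : KernelBound K M)
    (hL : 0 < L) (hc : 0 < c) {v : ℤ → ℝ} (hv : ∀ k, IsDrift K L c N y k (v k))
    {w : ℤ → ℝ} (hw : ∀ k, w k = -v k - N / c * increment φ c N y k)
    (hper : ∀ k, w (k + N) = w k) :
    ∑ k ∈ Finset.range N, -φ (cellDensity c N y k) * (w (k + 1) - w k)
      ≤ c ^ 3 * M ^ 2 / 2 - dissipation φ c N y / (2 * c) := by
  have hN : (0 : ℝ) < N := by exact_mod_cast hy.pos hL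
  have h₁ := sum_range_shift_neg (N := N)
    (g := fun k => φ (cellDensity c N y k) * w (k + 1)) (fun k => by
      simp only [hy.cellDensity_add]
      rw [show k + (N : ℤ) + 1 = k + 1 + N by ring, hper])
  simp only [sub_add_cancel] at h₁
  have h₂ : ∑ k ∈ Finset.range N, -φ (cellDensity c N y k) * (w (k + 1) - w k)
      = ∑ k ∈ Finset.range N, w k * increment φ c N y k := by
    have : ∀ k : ℕ, -φ (cellDensity c N y k) * (w (k + 1) - w k)
        = φ (cellDensity c N y k) * w k - φ (cellDensity c N y k) * w (k + 1) := fun k => by ring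
    rw [Finset.sum_congr rfl fun k _ => this k, Finset.sum_sub_distrib, ← h₁,
      ← Finset.sum_sub_distrib]
    refine Finset.sum_congr rfl fun k _ => ?_
    rw [increment]; ring
  rw [h₂]
  have hterm : ∀ k ∈ Finset.range N, w k * increment φ c N y k
      ≤ c / (2 * N) * (c * M) ^ 2 - N / (2 * c) * increment φ c N y k ^ 2 := by
    intro k _
    have hvk := (hv k).abs_le hM hc
    have hsq : v k ^ 2 ≤ (c * M) ^ 2 := sq_le_sq' (abs_le.1 hvk).1 (abs_le.1 hvk).2
    -- Completing the square: half of the dissipation pays for the interaction, at the price of c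
    -- vₖ² / (2N) per particle.
    have hid : w k * increment φ c N y k = c / (2 * N) * v k ^ 2
        - N / (2 * c) * increment φ c N y k ^ 2
        - c / (2 * N) * (v k + N / c * increment φ c N y k) ^ 2 := by
      rw [hw]; field_simp; ring
    rw [hid]
    have : 0 ≤ c / (2 * N) * (v k + N / c * increment φ c N y k) ^ 2 := by positivity
    have : c / (2 * N) * v k ^ 2 ≤ c / (2 * N) * (c * M) ^ 2 := by gcongr
    linarith
  refine (Finset.sum_le_sum hterm).trans (le_of_eq ?_)
  rw [Finset.sum_sub_distrib, dissipation]
  simp only [← Finset.mul_sum, Finset.sum_const, Finset.card_range, nsmul_eq_mul]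
  field_simp

/-- The energy is nonnegative at the final time and at most L B initially, because the initial
densities lie in [ε, M₀]. Integrating the energy production between the two leaves a bound without
N. -/
theorem integral_dissipation_le (h : IsParticles K φ L ρ₀ T N x) (hM : KernelBound K M)
    (hφ : IsDiffusion W φ) (hL : 0 < L) (hT : 0 ≤ T) (hD : DataBound ρ₀ ε M₀) {B : ℝ}
    (hB : ∀ r ∈ Set.Icc ε M₀, W r ≤ B) :
    ∫ t in (0 : ℝ)..T, dissipation φ (mass L ρ₀) N (fun k => x k t)
      ≤ 2 * mass L ρ₀ * (L * B + T * (mass L ρ₀ ^ 3 * M ^ 2 / 2)) := by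
  have hc := hD.mass_pos hL
  set c := mass L ρ₀ with hcdef
  have h0 : (0 : ℝ) ∈ Set.Icc 0 T := Set.left_mem_Icc.2 hT
  have hN : 0 < N := (h.config h0).pos hL
  have hN' : (0 : ℝ) < N := by exact_mod_cast hN
  obtain ⟨m₀, hm₀, hgap⟩ := h.exists_gap_pos hL hT
  obtain ⟨C, hC, hlip⟩ := h.exists_lipschitz hM hφ hL hT hc
  have hm : 0 < c / N := div_pos hc hN'
  set E : ℝ → ℝ := fun t => ∑ k ∈ Finset.range N, cellEnergy W (c / N) (x (k + 1) t - x k t)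
    with hE
  have hdens : ∀ t k, c / N / (x (k + 1) t - x k t) = cellDensity c N (fun i => x i t) k := by
    intro t k; rw [cellDensity, div_div]
  have hAC : AbsolutelyContinuousOnInterval E 0 T := by
    refine absolutelyContinuousOnInterval_of_abs_sub_le
      (C := N * (φ (c / N / m₀) * (2 * C))) hT fun s hs t ht => ?_
    simp only [hE]
    rw [← Finset.sum_sub_distrib]
    refine (Finset.abs_sum_le_sum_abs _ _).trans ?_
    refine (Finset.sum_le_card_nsmul _ _ (φ (c / N / m₀) * (2 * C) * |s - t|)
      fun k _ => ?_).trans (le_of_eq ?_)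
    · refine (cellEnergy_sub_le hφ hm hm₀ (hgap s hs k) (hgap t ht k)).trans ?_
      rw [mul_assoc]
      refine mul_le_mul_of_nonneg_left ?_ (hφ.map_nonneg (by positivity))
      have h₁ := abs_le.1 (hlip (k + 1) s hs t ht)
      have h₂ := abs_le.1 (hlip k s hs t ht)
      rw [abs_le]
      constructor <;> linarith [h₁.1, h₁.2, h₂.1, h₂.2]
    · rw [Finset.card_range, nsmul_eq_mul]; ring
  have hcont := h.continuousOn_dissipation hφ hL hT hc
  have hint : IntervalIntegrable (fun t => dissipation φ c N (fun k => x k t)) volume 0 T :=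
    ContinuousOn.intervalIntegrable (by rwa [Set.uIcc_of_le hT])
  have hmain := sub_le_integral_of_deriv_le
    (g := fun t => c ^ 3 * M ^ 2 / 2 - (2 * c)⁻¹ * dissipation φ c N (fun k => x k t)) hT hAC
    (intervalIntegrable_const.sub (hint.const_mul _)) (by
      filter_upwards [h.ae_hasDerivAt] with t ht hmem
      have hmem' : t ∈ Set.Icc 0 T := Set.Ioo_subset_Icc_self hmem
      choose v hv hder using ht hmem
      set w : ℤ → ℝ := fun k => -v k - N / c * increment φ c N (fun i => x i t) k with hw
      -- The drifts are chosen separately for each index, so the periodicity of the velocities is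
      -- read off from the uniqueness of derivatives.
      have hwper : ∀ k, w (k + N) = w k := by
        intro k
        refine (hder (k + N)).unique (((hder k).add_const L).congr_of_eventuallyEq ?_)
        filter_upwards [Ioo_mem_nhds hmem.1 hmem.2] with s hs
        exact h.lift s (Set.Ioo_subset_Icc_self hs) k
      have hEd : HasDerivAt E
          (∑ k ∈ Finset.range N, -φ (cellDensity c N (fun i => x i t) k) * (w (k + 1) - w k)) t := by
        refine HasDerivAt.fun_sum fun k _ => ?_
        rw [← hdens]
        exact (hasDerivAt_cellEnergy hφ hm (sub_pos.2 (h.ordered t hmem' k))).comp t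
          ((hder (k + 1)).sub (hder k))
      rw [hEd.deriv]
      have := energy_production_le (φ := φ) (h.config hmem') hM hL hc hv (w := w)
        (fun k => rfl) hwper
      rwa [div_eq_inv_mul (dissipation _ _ _ _)] at this)
  rw [intervalIntegral.integral_sub intervalIntegrable_const (hint.const_mul _),
    intervalIntegral.integral_const, intervalIntegral.integral_const_mul, sub_zero,
    smul_eq_mul] at hmain
  have hET : 0 ≤ E T := by
    refine Finset.sum_nonneg fun k _ => ?_
    have := sub_pos.2 (h.ordered T (Set.right_mem_Icc.2 hT) k)
    exact mul_nonneg this.le (hφ.nonneg _ (by positivity))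
  have hE0 : E 0 ≤ L * B := by
    have hle : ∀ k ∈ Finset.range N, cellEnergy W (c / N) (x (k + 1) 0 - x k 0)
        ≤ (x (k + 1) 0 - x k 0) * B := by
      intro k _
      have := sub_pos.2 (h.ordered 0 h0 k)
      rw [cellEnergy, hdens]
      refine mul_le_mul_of_nonneg_left (hB _ ?_) this.le
      exact hD.cellDensity_initial hL (h.config h0) h.initial k
    refine (Finset.sum_le_sum hle).trans (le_of_eq ?_)
    rw [← Finset.sum_mul, (h.config h0).sum_gap]
  have : (2 * c)⁻¹ * ∫ t in (0 : ℝ)..T, dissipation φ c N (fun k => x k t)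
      ≤ L * B + T * (c ^ 3 * M ^ 2 / 2) := by linarith
  rw [inv_mul_le_iff₀ (by positivity)] at this
  exact this

end IsParticles

/-! ### The upper bound for the density -/

theorem abs_log_sub_log_le {a b m : ℝ} (hm : 0 < m) (ha : m ≤ a) (hb : m ≤ b) :
    |Real.log a - Real.log b| ≤ |a - b| / m := by
  have key : ∀ a b : ℝ, m ≤ a → m ≤ b → Real.log a - Real.log b ≤ |a - b| / m := by
    intro a b ha hb
    have ha0 := hm.trans_le ha
    have hb0 := hm.trans_le hb
    rw [← Real.log_div ha0.ne' hb0.ne']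
    calc Real.log (a / b) ≤ a / b - 1 := Real.log_le_sub_one_of_pos (by positivity)
      _ = (a - b) / b := by field_simp
      _ ≤ |a - b| / b := by gcongr; exact le_abs_self _
      _ ≤ |a - b| / m := by gcongr
  rw [abs_le]
  have h₁ := key a b ha hb
  have h₂ := key b a hb ha
  rw [abs_sub_comm] at h₂
  constructor <;> linarith

theorem abs_inf'_sub_inf'_le {ι : Type*} {s : Finset ι} (hs : s.Nonempty) {f g : ι → ℝ} {C : ℝ}
    (h : ∀ i ∈ s, |f i - g i| ≤ C) : |s.inf' hs f - s.inf' hs g| ≤ C := by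
  obtain ⟨i, hi, hif⟩ := Finset.exists_mem_eq_inf' hs f
  obtain ⟨j, hj, hjg⟩ := Finset.exists_mem_eq_inf' hs g
  have h₁ : s.inf' hs f ≤ f j := Finset.inf'_le f hj
  have h₂ : s.inf' hs g ≤ g i := Finset.inf'_le g hi
  have h₃ := abs_le.1 (h i hi)
  have h₄ := abs_le.1 (h j hj)
  rw [abs_le]
  constructor <;> linarith [h₃.1, h₃.2, h₄.1, h₄.2]

theorem sqrt_le_one_add_half {a : ℝ} (ha : 0 ≤ a) : √a ≤ (1 + a) / 2 := by
  nlinarith [Real.sq_sqrt ha, sq_nonneg (√a - 1)]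

namespace IsParticles

variable {K W φ ρ₀ : ℝ → ℝ} {L T M ε M₀ : ℝ} {N : ℕ} {x : ℤ → ℝ → ℝ}

/-- A discrete maximum principle: at a shortest cell ρₖ is maximal, so the diffusive part lengthens
the cell. The jump error 6M c/N of the drifts becomes proportional to the length through c/N = ρₖ
(yₖ₊₁ - yₖ). -/
theorem neg_deriv_gap_le {c : ℝ} {y : ℤ → ℝ} (hy : IsConfig L N y) (hM : KernelBound K M)
    (hL : 0 < L) (hc : 0 < c) (hN : 2 ≤ N) (hφ : StrictMonoOn φ (Set.Ici 0)) {k : ℤ}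
    (hmin : ∀ j, y (k + 1) - y k ≤ y (j + 1) - y j) {v v' : ℝ}
    (hv : IsDrift K L c N y k v) (hv' : IsDrift K L c N y (k + 1) v') :
    -((-v' - N / c * increment φ c N y (k + 1)) - (-v - N / c * increment φ c N y k))
      ≤ (c * M + 6 * M * cellDensity c N y k) * (y (k + 1) - y k) := by
  have hN' : (0 : ℝ) < N := by exact_mod_cast (by omega : 0 < N)
  have h₁ := (abs_le.1 (hv.abs_sub_le hM hL hc hN hy hmin hv')).2
  rw [add_mul, mul_assoc (6 * M), hy.cellDensity_mul_gap hL]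
  have hmax : ∀ j, φ (cellDensity c N y j) ≤ φ (cellDensity c N y k) := by
    intro j
    refine hφ.monotoneOn (hy.cellDensity_pos hL hc j).le (hy.cellDensity_pos hL hc k).le ?_
    have := sub_pos.2 (hy.ordered k)
    have := hmin j
    unfold cellDensity
    gcongr
  have h₂ : increment φ c N y (k + 1) - increment φ c N y k ≤ 0 := by
    simp only [increment, add_sub_cancel_right]
    linarith [hmax (k + 1), hmax (k - 1)]
  have h₃ : N / c * (increment φ c N y (k + 1) - increment φ c N y k) ≤ 0 :=
    mul_nonpos_of_nonneg_of_nonpos (div_pos hN' hc).le h₂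
  linarith

/-- Gronwall's argument for minus the logarithm of the shortest length. The rate contains the
density itself, so an a priori majorant Q with controlled time integral is required. -/
theorem cellDensity_le_exp (h : IsParticles K φ L ρ₀ T N x) (hM : KernelBound K M)
    (hφ : IsDiffusion W φ) (hL : 0 < L) (hT : 0 ≤ T) (hD : DataBound ρ₀ ε M₀) (hN : 2 ≤ N)
    {Q : ℝ → ℝ} (hQ : ContinuousOn Q (Set.Icc 0 T))
    (hQ' : ∀ t ∈ Set.Icc 0 T, ∀ k, cellDensity (mass L ρ₀) N (fun i => x i t) k ≤ Q t) {A : ℝ}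
    (hA : ∀ t ∈ Set.Icc 0 T, ∫ s in (0 : ℝ)..t, (mass L ρ₀ * M + 6 * M * Q s) ≤ A) :
    ∀ t ∈ Set.Icc 0 T, ∀ k, cellDensity (mass L ρ₀) N (fun i => x i t) k ≤ M₀ * Real.exp A := by
  have hc := hD.mass_pos hL
  set c := mass L ρ₀ with hcdef
  have h0 : (0 : ℝ) ∈ Set.Icc 0 T := Set.left_mem_Icc.2 hT
  have hN0 : 0 < N := by omega
  have hN' : (0 : ℝ) < N := by exact_mod_cast hN0
  obtain ⟨m₀, hm₀, hgap⟩ := h.exists_gap_pos hL hT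
  obtain ⟨C, hC, hlip⟩ := h.exists_lipschitz hM hφ hL hT hc
  have hne : (Finset.range N).Nonempty := Finset.nonempty_range_iff.2 hN0.ne'
  set m : ℝ → ℝ := fun t => (Finset.range N).inf' hne (fun k => x (k + 1) t - x k t) with hm
  have hmle : ∀ t ∈ Set.Icc 0 T, ∀ k, m t ≤ x (k + 1) t - x k t := by
    intro t ht
    refine (h.config ht).forall_of_range hL ?_ ?_
    · intro k j hk
      have h₁ := (h.config ht).lift_mul k j
      have h₂ := (h.config ht).lift_mul (k + 1) j
      rw [show k + j * (N : ℤ) + 1 = k + 1 + j * N by ring, h₁, h₂]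
      linarith
    · intro k hk
      exact Finset.inf'_le (fun k : ℕ => x (k + 1) t - x k t) hk
  have hmm₀ : ∀ t ∈ Set.Icc 0 T, m₀ ≤ m t := by
    intro t ht
    rw [hm, Finset.le_inf'_iff]
    exact fun k _ => hgap t ht k
  have hmatt : ∀ t, ∃ k : ℕ, m t = x (k + 1) t - x k t := by
    intro t
    obtain ⟨k, _, hk⟩ := Finset.exists_mem_eq_inf' hne (fun k : ℕ => x (k + 1) t - x k t)
    exact ⟨k, hk⟩
  have hAC : AbsolutelyContinuousOnInterval (fun t => -Real.log (m t)) 0 T := by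
    refine absolutelyContinuousOnInterval_of_abs_sub_le (C := 2 * C / m₀) hT fun s hs t ht => ?_
    rw [neg_sub_neg, abs_sub_comm]
    refine (abs_log_sub_log_le hm₀ (hmm₀ s hs) (hmm₀ t ht)).trans ?_
    rw [div_mul_eq_mul_div]
    gcongr
    refine abs_inf'_sub_inf'_le hne fun k _ => ?_
    have h₁ := abs_le.1 (hlip (k + 1) s hs t ht)
    have h₂ := abs_le.1 (hlip k s hs t ht)
    rw [abs_le]
    constructor <;> linarith [h₁.1, h₁.2, h₂.1, h₂.2]
  have hderiv : ∀ᵐ t, t ∈ Set.Ioo 0 T →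
      deriv (fun t => -Real.log (m t)) t ≤ c * M + 6 * M * Q t := by
    filter_upwards [h.ae_hasDerivAt, hAC.ae_differentiableAt] with t ht hdiff hmem
    have hmem' : t ∈ Set.Icc 0 T := Set.Ioo_subset_Icc_self hmem
    have hdf := (hdiff (by rwa [Set.uIcc_of_le hT])).hasDerivAt
    choose v hv hder using ht hmem
    obtain ⟨k, hk⟩ := hmatt t
    have hgk : 0 < x (k + 1) t - x k t := sub_pos.2 (h.ordered t hmem' k)
    have hlog := ((hder (k + 1)).sub (hder k)).log hgk.ne'
    -- The logarithm of the k-th length lies above that of the minimum and touches it at time t.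
    -- Hence the two derivatives agree wherever both exist.
    have hmin : IsLocalMin
        (fun s => Real.log ((x (k + 1) - x k) s) + -Real.log (m s)) t := by
      filter_upwards [Ioo_mem_nhds hmem.1 hmem.2] with s hs
      have hs' : s ∈ Set.Icc 0 T := Set.Ioo_subset_Icc_self hs
      have : Real.log (m s) ≤ Real.log ((x (k + 1) - x k) s) :=
        Real.log_le_log (hm₀.trans_le (hmm₀ s hs')) (hmle s hs' k)
      have h₂ : Real.log ((x (k + 1) - x k) t) = Real.log (m t) := by rw [hk]; rfl
      rw [h₂]
      linarith
    have hzero := hmin.hasDerivAt_eq_zero (hlog.add hdf)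
    have hle := neg_deriv_gap_le (h.config hmem') hM hL hc hN hφ.strictMonoOn (k := k)
      (fun j => by rw [← hk]; exact hmle t hmem' j) (hv k) (hv (k + 1))
    have h₁ : deriv (fun t => -Real.log (m t)) t
        ≤ c * M + 6 * M * cellDensity c N (fun i => x i t) k := by
      rw [← div_le_iff₀ hgk, neg_div] at hle
      rw [eq_neg_of_add_eq_zero_right hzero]
      exact hle
    have := hQ' t hmem' k
    have := hM.pos
    refine h₁.trans ?_
    gcongr
  intro t ht k
  have hint : IntervalIntegrable (fun s => c * M + 6 * M * Q s) volume 0 t := by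
    refine ContinuousOn.intervalIntegrable ?_
    rw [Set.uIcc_of_le ht.1]
    exact continuousOn_const.add (continuousOn_const.mul
      (hQ.mono (Set.Icc_subset_Icc_right ht.2)))
  have hmain := sub_le_integral_of_deriv_le ht.1
    (hAC.mono (by rw [Set.uIcc_of_le ht.1, Set.uIcc_of_le hT]
                  exact Set.Icc_subset_Icc_right ht.2)) hint (by
      filter_upwards [hderiv] with s hs hmem
      exact hs ⟨hmem.1, hmem.2.trans_le ht.2⟩)
  have hmt : 0 < m t := hm₀.trans_le (hmm₀ t ht)
  have hm0 : 0 < m 0 := hm₀.trans_le (hmm₀ 0 h0)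
  have hlog : Real.log (m 0) ≤ Real.log (m t * Real.exp A) := by
    rw [Real.log_mul hmt.ne' (Real.exp_pos _).ne', Real.log_exp]
    linarith [hA t ht]
  have hm0t : m 0 ≤ m t * Real.exp A :=
    (Real.log_le_log_iff hm0 (mul_pos hmt (Real.exp_pos _))).1 hlog
  obtain ⟨j, hj⟩ := hmatt 0
  have hinit := (hD.cellDensity_initial hL (h.config h0) h.initial j).2
  rw [cellDensity, ← hj, div_le_iff₀ (by positivity)] at hinit
  have hM₀ : 0 < M₀ := hD.pos.trans_le hD.le
  refine (cellDensity_le_of_gap hc hmt hN0 (hmle t ht k)).trans ?_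
  rw [div_le_iff₀ (by positivity)]
  calc c ≤ M₀ * (N * m 0) := hinit
    _ ≤ M₀ * (N * (m t * Real.exp A)) := by gcongr
    _ = M₀ * Real.exp A * (N * m t) := by ring

end IsParticles

/-- The a priori bounds, uniform in the number of particles. -/
theorem exists_apriori_bounds {K W φ ρ₀ : ℝ → ℝ} {L M ε M₀ : ℝ} (hM : KernelBound K M)
    (hφ : IsDiffusion W φ) (hL : 0 < L) (hD : DataBound ρ₀ ε M₀) {T : ℝ} (hT : 0 ≤ T) :
    ∃ R C : ℝ, 0 < R ∧ M₀ ≤ R ∧ 0 ≤ C ∧ ∀ N : ℕ, 2 ≤ N → ∀ T' ∈ Set.Icc 0 T, ∀ x : ℤ → ℝ → ℝ,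
      IsParticles K φ L ρ₀ T' N x →
        (∀ t ∈ Set.Icc 0 T', ∀ k, cellDensity (mass L ρ₀) N (fun i => x i t) k ≤ R) ∧
        ∫ t in (0 : ℝ)..T', dissipation φ (mass L ρ₀) N (fun k => x k t) ≤ C := by
  have hc := hD.mass_pos hL
  set c := mass L ρ₀ with hcdef
  -- No regularity of `W` at 0 is available; the lower bound ε keeps the initial densities in a
  -- compact subset of (0, ∞).
  obtain ⟨B, hB⟩ : ∃ B, ∀ r ∈ Set.Icc ε M₀, W r ≤ B := by
    have hcont : ContinuousOn W (Set.Icc ε M₀) :=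
      hφ.differentiableOn.continuousOn.mono fun r hr => hD.pos.trans_le hr.1
    obtain ⟨B, hB⟩ := (isCompact_Icc.image_of_continuousOn hcont).bddAbove
    exact ⟨B, fun r hr => hB (Set.mem_image_of_mem W hr)⟩
  have hB0 : 0 ≤ B :=
    (hφ.nonneg ε hD.pos.le).trans (hB ε (Set.left_mem_Icc.2 hD.le))
  obtain ⟨c₂, hc₂, r₂, hr₂, hlarge⟩ := hφ.large
  set C := 2 * c * (L * B + T * (c ^ 3 * M ^ 2 / 2)) with hC
  have hMp := hM.pos
  have hC0 : 0 ≤ C := by positivity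
  have hΦ : 0 ≤ φ (c / L) := hφ.map_nonneg (by positivity)
  -- This bounds the time integral of cM + 6M Q for the majorant Q used below, given that the
  -- integral of the dissipation is at most C.
  set A := T * (c * M + 6 * M * (r₂ + (φ (c / L) + 1 / 2) / c₂)) + 6 * M / (2 * c₂) * C with hA
  have hM₀ : 0 < M₀ := hD.pos.trans_le hD.le
  refine ⟨M₀ * Real.exp A, C, mul_pos hM₀ (Real.exp_pos _),
    le_mul_of_one_le_right hM₀.le (Real.one_le_exp (by positivity)), hC0, ?_⟩
  -- Shorter times T' share the same constants, which the continuation argument for existence needs.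
  intro N hN T' hT' x h
  have hdiss : ∀ t ∈ Set.Icc 0 T',
      ∫ t in (0 : ℝ)..t, dissipation φ c N (fun k => x k t) ≤ C := by
    intro t ht
    have h₁ := h.integral_dissipation_le hM hφ hL hT'.1 hD hB
    have h₂ : ∫ t in (0 : ℝ)..t, dissipation φ c N (fun k => x k t)
        ≤ ∫ t in (0 : ℝ)..T', dissipation φ c N (fun k => x k t) := by
      refine intervalIntegral.integral_mono_interval le_rfl ht.1 ht.2
        (Eventually.of_forall fun s => dissipation_nonneg φ c N _) ?_
      refine ContinuousOn.intervalIntegrable ?_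
      rw [Set.uIcc_of_le hT'.1]
      exact h.continuousOn_dissipation hφ hL hT'.1 hc
    refine h₂.trans (h₁.trans ?_)
    rw [hC]
    have := hT'.2
    gcongr
  refine ⟨?_, hdiss T' (Set.right_mem_Icc.2 hT'.1)⟩
  have hcontD := h.continuousOn_dissipation hφ hL hT'.1 hc
  refine h.cellDensity_le_exp hM hφ hL hT'.1 hD hN
    -- A density is either below r₂ or at most φ(ρ)/c₂, and √D ≤ (1 + D)/2 makes the bound on φ(ρ)
    -- linear in the dissipation.
    (Q := fun t => r₂ + (φ (c / L) + 1 / 2 + dissipation φ c N (fun k => x k t) / 2) / c₂) ?_ ?_ ?_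
  · exact continuousOn_const.add ((continuousOn_const.add (hcontD.div_const 2)).div_const c₂)
  · intro t ht k
    have hcfg := h.config ht
    have hd0 := dissipation_nonneg φ c N (fun k => x k t)
    have hle := map_cellDensity_le hcfg hL hc hφ.strictMonoOn k
    have hs := sqrt_le_one_add_half hd0
    rcases le_total r₂ (cellDensity c N (fun i => x i t) k) with hr | hr
    · have h₁ := hlarge _ hr
      have h₂ : cellDensity c N (fun i => x i t) k
          ≤ (φ (c / L) + 1 / 2 + dissipation φ c N (fun k => x k t) / 2) / c₂ := by
        rw [le_div_iff₀ hc₂]; linarith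
      linarith
    · have : 0 ≤ (φ (c / L) + 1 / 2 + dissipation φ c N (fun k => x k t) / 2) / c₂ := by
        positivity
      linarith
  · intro t ht
    have hint : IntervalIntegrable (fun s => dissipation φ c N (fun k => x k s)) volume 0 t := by
      refine ContinuousOn.intervalIntegrable ?_
      rw [Set.uIcc_of_le ht.1]
      exact hcontD.mono (Set.Icc_subset_Icc_right ht.2)
    have heq : ∀ s, c * M + 6 * M * (r₂ + (φ (c / L) + 1 / 2
          + dissipation φ c N (fun k => x k s) / 2) / c₂)
        = (c * M + 6 * M * (r₂ + (φ (c / L) + 1 / 2) / c₂))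
          + 6 * M / (2 * c₂) * dissipation φ c N (fun k => x k s) := by
      intro s; field_simp; ring
    rw [intervalIntegral.integral_congr (fun s _ => heq s),
      intervalIntegral.integral_add intervalIntegrable_const (hint.const_mul _),
      intervalIntegral.integral_const, intervalIntegral.integral_const_mul, sub_zero, smul_eq_mul,
      hA]
    have h₁ := hdiss t ht
    have h₂ : t ≤ T := ht.2.trans hT'.2
    gcongr

/-! ### Solutions of discontinuous differential equations as limits of Euler polygons -/

/-- The explicit Euler scheme with step `τ`. -/
noncomputable def euler (f : (ℤ → ℝ) → ℤ → ℝ) (τ : ℝ) (y₀ : ℤ → ℝ) : ℕ → ℤ → ℝ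
  | 0 => y₀
  | n + 1 => fun k => euler f τ y₀ n k + τ * f (euler f τ y₀ n) k

section Euler

variable {f : (ℤ → ℝ) → ℤ → ℝ} {B τ : ℝ} {y₀ : ℤ → ℝ}

theorem abs_euler_sub_le (hf : ∀ y k, |f y k| ≤ B) (hτ : 0 ≤ τ) (k : ℤ) (m n : ℕ) :
    |euler f τ y₀ m k - euler f τ y₀ n k| ≤ B * |τ * m - τ * n| := by
  have key : ∀ m i : ℕ, |euler f τ y₀ (m + i) k - euler f τ y₀ m k| ≤ B * (τ * i) := by
    intro m i
    induction i with
    | zero => simp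
    | succ i ih =>
      have h₁ : euler f τ y₀ (m + (i + 1)) k - euler f τ y₀ m k
          = (euler f τ y₀ (m + i) k - euler f τ y₀ m k) + τ * f (euler f τ y₀ (m + i)) k := by
        rw [← add_assoc, euler]; ring
      rw [h₁]
      refine (abs_add_le _ _).trans ?_
      rw [abs_mul, abs_of_nonneg hτ]
      have := mul_le_mul_of_nonneg_left (hf (euler f τ y₀ (m + i)) k) hτ
      push_cast
      linarith
  rcases le_total m n with h | h
  · obtain ⟨i, rfl⟩ := Nat.exists_eq_add_of_le h
    rw [abs_sub_comm, abs_sub_comm (τ * m)]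
    have : τ * ((m + i : ℕ) : ℝ) - τ * m = τ * i := by push_cast; ring
    rw [this, abs_of_nonneg (a := τ * (i : ℝ)) (by positivity)]
    exact key m i
  · obtain ⟨i, rfl⟩ := Nat.exists_eq_add_of_le h
    have : τ * ((n + i : ℕ) : ℝ) - τ * n = τ * i := by push_cast; ring
    rw [this, abs_of_nonneg (a := τ * (i : ℝ)) (by positivity)]
    exact key n i

theorem euler_sub_mem_Icc (hτ : 0 ≤ τ) {k : ℤ} {a b : ℕ} (hab : a ≤ b) {A A' : ℝ}
    (h : ∀ i, a ≤ i → i ≤ b → A ≤ f (euler f τ y₀ i) k ∧ f (euler f τ y₀ i) k ≤ A') :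
    A * (τ * b - τ * a) ≤ euler f τ y₀ b k - euler f τ y₀ a k ∧
      euler f τ y₀ b k - euler f τ y₀ a k ≤ A' * (τ * b - τ * a) := by
  obtain ⟨i, rfl⟩ := Nat.exists_eq_add_of_le hab
  have key : ∀ j ≤ i, A * (τ * j) ≤ euler f τ y₀ (a + j) k - euler f τ y₀ a k ∧
      euler f τ y₀ (a + j) k - euler f τ y₀ a k ≤ A' * (τ * j) := by
    intro j hj
    induction j with
    | zero => simp
    | succ j ih =>
      obtain ⟨h₁, h₂⟩ := ih (by omega)
      obtain ⟨h₃, h₄⟩ := h (a + j) (by omega) (by omega)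
      have h₃' := mul_le_mul_of_nonneg_left h₃ hτ
      have h₄' := mul_le_mul_of_nonneg_left h₄ hτ
      rw [← add_assoc, euler]
      push_cast
      constructor <;> linarith
  have : τ * ((a + i : ℕ) : ℝ) - τ * a = τ * i := by push_cast; ring
  rw [this]
  exact key i le_rfl

theorem euler_lift {L : ℝ} {N : ℕ}
    (hf : ∀ y : ℤ → ℝ, (∀ k, y (k + N) = y k + L) → ∀ k, f y (k + N) = f y k)
    (hy : ∀ k, y₀ (k + N) = y₀ k + L) (n : ℕ) (k : ℤ) :
    euler f τ y₀ n (k + N) = euler f τ y₀ n k + L := by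
  induction n generalizing k with
  | zero => exact hy k
  | succ n ih => simp only [euler, ih, hf _ ih]; ring

end Euler

/-- Neighbourhoods in the product topology restrict finitely many coordinates only. Coordinatewise
convergence of the Euler polygons therefore suffices to enter them. -/
theorem exists_finset_of_eventually_nhds {y : ℤ → ℝ} {p : (ℤ → ℝ) → Prop}
    (h : ∀ᶠ z in 𝓝 y, p z) :
    ∃ J : Finset ℤ, ∃ δ > 0, ∀ z, (∀ j ∈ J, |z j - y j| < δ) → p z := by
  obtain ⟨V, hV, hVo, hyV⟩ := eventually_nhds_iff.1 h
  obtain ⟨J, u, hu, hsub⟩ := isOpen_pi_iff.1 hVo y hyV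
  have hball : ∀ j : ℤ, ∃ δ > 0, j ∈ J → Metric.ball (y j) δ ⊆ u j := by
    intro j
    by_cases hj : j ∈ J
    · obtain ⟨δ, hδ, hb⟩ := Metric.isOpen_iff.1 (hu j hj).1 (y j) (hu j hj).2
      exact ⟨δ, hδ, fun _ => hb⟩
    · exact ⟨1, one_pos, fun h => absurd h hj⟩
  choose δ hδ hb using hball
  rcases J.eq_empty_or_nonempty with rfl | hJ
  · refine ⟨∅, 1, one_pos, fun z _ => hV z (hsub ?_)⟩
    simp
  · refine ⟨J, J.inf' hJ δ, ?_, fun z hz => hV z (hsub ?_)⟩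
    · rw [gt_iff_lt, Finset.lt_inf'_iff]
      exact fun j _ => hδ j
    · intro j hj
      refine hb j hj ?_
      rw [Metric.mem_ball, Real.dist_eq]
      exact (hz j hj).trans_le (Finset.inf'_le δ hj)

/-- A fixed nonprincipal ultrafilter selects limits for all times and all indices at once, so no
diagonal extraction is needed. -/
theorem exists_tendsto_hyperfilter {u : ℕ → ℝ} {a C : ℝ} (h : ∀ n, |u n - a| ≤ C) :
    ∃ l, Tendsto u (hyperfilter ℕ : Filter ℕ) (𝓝 l) := by
  obtain ⟨l, _, hl⟩ := (isCompact_closedBall a C).ultrafilter_le_nhds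
    ((hyperfilter ℕ).map u) (by
      rw [le_principal_iff]
      refine Ultrafilter.mem_coe.2 (Ultrafilter.mem_map.2 (univ_mem' fun n => ?_))
      simp only [Set.mem_preimage, Metric.mem_closedBall, Real.dist_eq]
      exact h n)
  exact ⟨l, hl⟩

/-- A bounded vector field, not assumed to be continuous, has generalized solutions: Lipschitz
curves whose derivatives lie between any bounds for the field that are valid nearby. -/
theorem exists_generalized_solution {f : (ℤ → ℝ) → ℤ → ℝ} {B : ℝ} (hf : ∀ y k, |f y k| ≤ B)
    (y₀ : ℤ → ℝ) {L : ℝ} {N : ℕ}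
    (hfl : ∀ y : ℤ → ℝ, (∀ k, y (k + N) = y k + L) → ∀ k, f y (k + N) = f y k)
    (hy : ∀ k, y₀ (k + N) = y₀ k + L) :
    ∃ x : ℤ → ℝ → ℝ, (∀ k, x k 0 = y₀ k) ∧ (∀ k t, 0 ≤ t → x (k + N) t = x k t + L) ∧
      (∀ k s t, 0 ≤ s → 0 ≤ t → |x k s - x k t| ≤ B * |s - t|) ∧
      ∀ k t, 0 ≤ t → ∀ A A' v, (∀ᶠ z in 𝓝 (fun j => x j t), A ≤ f z k ∧ f z k ≤ A') →
        HasDerivAt (x k) v t → A ≤ v ∧ v ≤ A' := by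
  have hB : 0 ≤ B := (abs_nonneg _).trans (hf y₀ 0)
  set U : Filter ℕ := (hyperfilter ℕ : Filter ℕ) with hU
  have hUle : U ≤ atTop := Nat.hyperfilter_le_atTop
  set τ : ℕ → ℝ := fun n => 1 / ((n : ℝ) + 1) with hτ
  have hτ0 : ∀ n, 0 ≤ τ n := fun n => by simp only [hτ]; positivity
  set i : ℕ → ℝ → ℕ := fun n t => ⌊t * ((n : ℝ) + 1)⌋₊ with hi
  set X : ℕ → ℝ → ℤ → ℝ := fun n t => euler f (τ n) y₀ (i n t) with hX
  have hgrid : ∀ t, 0 ≤ t → Tendsto (fun n => τ n * (i n t : ℝ)) U (𝓝 t) := by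
    intro t ht
    have h₁ : Tendsto (fun n : ℕ => (n : ℝ) + 1) atTop atTop :=
      tendsto_atTop_add_const_right _ _ tendsto_natCast_atTop_atTop
    refine (((tendsto_nat_floor_mul_div_atTop ht).comp h₁).congr fun n => ?_).mono_left hUle
    simp only [Function.comp, hτ, hi]
    ring
  have hXlip : ∀ n k s t, |X n s k - X n t k| ≤ B * |τ n * (i n s) - τ n * (i n t)| :=
    fun n k s t => abs_euler_sub_le hf (hτ0 n) k _ _
  have hX0 : ∀ n, X n 0 = y₀ := by
    intro n; simp [hX, hi, euler]
  have hlim : ∀ t k, ∃ l, 0 ≤ t → Tendsto (fun n => X n t k) U (𝓝 l) := by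
    intro t k
    by_cases ht : 0 ≤ t
    · obtain ⟨l, hl⟩ := exists_tendsto_hyperfilter (u := fun n => X n t k) (a := y₀ k) (C := B * t)
        (fun n => by
          have := hXlip n k t 0
          rw [hX0] at this
          refine this.trans ?_
          have h₁ : τ n * (i n t : ℝ) ≤ t := by
            simp only [hτ, hi]
            rw [one_div, inv_mul_le_iff₀ (by positivity), mul_comm]
            exact Nat.floor_le (by positivity)
          have h₀ : 0 ≤ τ n * (i n t : ℝ) := mul_nonneg (hτ0 n) (Nat.cast_nonneg _)
          have h₂ : (i n 0 : ℝ) = 0 := by simp [hi]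
          rw [h₂, mul_zero, sub_zero, abs_of_nonneg h₀]
          gcongr)
      exact ⟨l, fun _ => hl⟩
    · exact ⟨0, fun h => absurd h ht⟩
  choose x' hx' using hlim
  have hx : ∀ t, 0 ≤ t → ∀ k, Tendsto (fun n => X n t k) U (𝓝 (x' t k)) := fun t ht k => hx' t k ht
  refine ⟨fun k t => x' t k, ?_, ?_, ?_, ?_⟩
  · intro k
    refine tendsto_nhds_unique (hx 0 le_rfl k) ?_
    simp only [hX0]
    exact tendsto_const_nhds
  · intro k t ht
    refine tendsto_nhds_unique (hx t ht (k + N)) ?_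
    refine ((hx t ht k).add_const L).congr fun n => ?_
    exact (euler_lift hfl hy _ _).symm
  · intro k s t hs ht
    exact le_of_tendsto_of_tendsto' ((hx s hs k).sub (hx t ht k)).abs
      (((hgrid s hs).sub (hgrid t ht)).abs.const_mul B) fun n => hXlip n k s t
  · intro k t ht A A' v hev hder
    obtain ⟨J, δ, hδ, hJ⟩ := exists_finset_of_eventually_nhds hev
    -- On a short window the Euler points move by less than δ/2 and start within δ/2 of the limit,
    -- so they stay where the bounds on the field hold. Summing the steps gives bounds on the
    -- increment that survive in the limit.
    have hstep : ∀ h : ℝ, 0 < h → B * (2 * h) < δ / 2 →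
        A * h ≤ x' (t + h) k - x' t k ∧ x' (t + h) k - x' t k ≤ A' * h := by
      intro h hh hBh
      have hth : 0 ≤ t + h := by linarith
      have hd : Tendsto (fun n => τ n * (i n (t + h) : ℝ) - τ n * (i n t)) U (𝓝 h) := by
        have := (hgrid (t + h) hth).sub (hgrid t ht)
        rwa [add_sub_cancel_left] at this
      have hclose : ∀ᶠ n in U, ∀ j ∈ J, |X n t j - x' t j| < δ / 2 := by
        rw [Finset.eventually_all]
        intro j _
        have := Metric.tendsto_nhds.1 (hx t ht j) (δ / 2) (by linarith)
        simpa [Real.dist_eq] using this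
      have hmain : ∀ᶠ n in U,
          A * (τ n * (i n (t + h) : ℝ) - τ n * (i n t)) ≤ X n (t + h) k - X n t k ∧
          X n (t + h) k - X n t k ≤ A' * (τ n * (i n (t + h) : ℝ) - τ n * (i n t)) := by
        filter_upwards [hclose, hd.eventually (gt_mem_nhds (by linarith : h < 2 * h))]
          with n hn hn2
        have hab : i n t ≤ i n (t + h) := by
          simp only [hi]
          gcongr
          linarith
        refine euler_sub_mem_Icc (hτ0 n) hab fun l hl hl' => hJ _ fun j hj => ?_
        have h₁ := abs_euler_sub_le (y₀ := y₀) hf (hτ0 n) j l (i n t)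
        have h₂ : |τ n * (l : ℝ) - τ n * (i n t)| ≤ 2 * h := by
          have hl₁ : τ n * (i n t : ℝ) ≤ τ n * l :=
            mul_le_mul_of_nonneg_left (by exact_mod_cast hl) (hτ0 n)
          have hl₂ : τ n * (l : ℝ) ≤ τ n * i n (t + h) :=
            mul_le_mul_of_nonneg_left (by exact_mod_cast hl') (hτ0 n)
          rw [abs_of_nonneg (by linarith)]
          linarith
        have h₃ : |euler f (τ n) y₀ l j - X n t j| < δ / 2 :=
          (h₁.trans (mul_le_mul_of_nonneg_left h₂ hB)).trans_lt hBh
        have h₄ := hn j hj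
        calc |euler f (τ n) y₀ l j - x' t j|
            ≤ |euler f (τ n) y₀ l j - X n t j| + |X n t j - x' t j| := abs_sub_le _ _ _
          _ < δ := by linarith
      have hXd := (hx (t + h) hth k).sub (hx t ht k)
      exact ⟨le_of_tendsto_of_tendsto (hd.const_mul A) hXd (hmain.mono fun n hn => hn.1),
        le_of_tendsto_of_tendsto hXd (hd.const_mul A') (hmain.mono fun n hn => hn.2)⟩
    have hslope := hder.tendsto_slope_zero_right
    have hsmall : ∀ᶠ h : ℝ in 𝓝[>] 0, 0 < h ∧ B * (2 * h) < δ / 2 := by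
      have h₁ : Tendsto (fun h : ℝ => B * (2 * h)) (𝓝[>] 0) (𝓝 0) := by
        have : Continuous (fun h : ℝ => B * (2 * h)) := by fun_prop
        have := this.tendsto 0
        simp only [mul_zero] at this
        exact this.mono_left nhdsWithin_le_nhds
      exact eventually_mem_nhdsWithin.and (h₁.eventually (gt_mem_nhds (by linarith)))
    constructor
    · refine ge_of_tendsto hslope ?_
      filter_upwards [hsmall] with h hh
      rw [smul_eq_mul, le_inv_mul_iff₀ hh.1, mul_comm]
      exact (hstep h hh.1 hh.2).1
    · refine le_of_tendsto hslope ?_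
      filter_upwards [hsmall] with h hh
      rw [smul_eq_mul, inv_mul_le_iff₀ hh.1, mul_comm]
      exact (hstep h hh.1 hh.2).2

/-! ### Existence of the particles -/

/-- The right-hand side of the particle system, with the lengths of the cells bounded below by `δ`. -/
noncomputable def truncatedField (K φ : ℝ → ℝ) (L c : ℝ) (N : ℕ) (δ : ℝ) (y : ℤ → ℝ) (k : ℤ) : ℝ :=
  -(c / N) * ∑ j ∈ Finset.Ioo k (k + N), deriv K (rep L (y k - y j))
    - N / c * (φ (c / (N * max (y (k + 1) - y k) δ)) - φ (c / (N * max (y k - y (k - 1)) δ)))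

section Field

variable {K W φ : ℝ → ℝ} {L M c δ : ℝ} {N : ℕ}

theorem abs_truncatedField_le (hM : KernelBound K M) (hφ : IsDiffusion W φ) (hc : 0 < c)
    (hN : 0 < N) (hδ : 0 < δ) (y : ℤ → ℝ) (k : ℤ) :
    |truncatedField K φ L c N δ y k| ≤ c * M + N / c * φ (c / (N * δ)) := by
  have hN' : (0 : ℝ) < N := by exact_mod_cast hN
  have h₁ : |c / N * ∑ j ∈ Finset.Ioo k (k + N), deriv K (rep L (y k - y j))| ≤ c * M :=
    IsDrift.abs_le (L := L) (y := y) hM hc ⟨_, fun j _ => hM.deriv_mem_slopes _, rfl⟩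
  have hbd : ∀ d : ℝ, 0 ≤ φ (c / (N * max d δ)) ∧ φ (c / (N * max d δ)) ≤ φ (c / (N * δ)) := by
    intro d
    have hd : 0 < max d δ := lt_max_of_lt_right hδ
    refine ⟨hφ.map_nonneg (by positivity), hφ.strictMonoOn.monotoneOn
      (Set.mem_Ici.2 (by positivity)) (Set.mem_Ici.2 (by positivity)) ?_⟩
    gcongr
    exact le_max_right _ _
  have h₂ := abs_sub_le_of_mem_Icc (hbd (y (k + 1) - y k)).1 (hbd (y (k + 1) - y k)).2
    (hbd (y k - y (k - 1))).1 (hbd (y k - y (k - 1))).2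
  unfold truncatedField
  refine (abs_sub _ _).trans ?_
  rw [neg_mul, abs_neg, abs_mul (N / c), abs_of_pos (div_pos hN' hc)]
  gcongr

theorem truncatedField_add {y : ℤ → ℝ} (hy : ∀ k, y (k + N) = y k + L) (k : ℤ) :
    truncatedField K φ L c N δ y (k + N) = truncatedField K φ L c N δ y k := by
  have e₁ : y (k + N + 1) = y (k + 1) + L := by rw [← hy]; congr 1; ring
  have e₂ : y (k + N - 1) = y (k - 1) + L := by rw [← hy]; congr 1; ring
  have e₃ : ∑ j ∈ Finset.Ioo (k + (N : ℤ)) (k + N + N), deriv K (rep L (y (k + N) - y j))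
      = ∑ j ∈ Finset.Ioo k (k + N), deriv K (rep L (y k - y j)) := by
    refine Finset.sum_nbij' (fun j => j - N) (fun j => j + N) ?_ ?_ ?_ ?_ ?_
    · intro j hj; rw [Finset.mem_Ioo] at *; constructor <;> linarith [hj.1, hj.2]
    · intro j hj; rw [Finset.mem_Ioo] at *; constructor <;> linarith [hj.1, hj.2]
    · intro j _; ring
    · intro j _; ring
    · intro j _
      have := hy (j - N)
      rw [sub_add_cancel] at this
      rw [this, hy]
      congr 2; ring
  unfold truncatedField
  rw [e₃, hy, e₁, e₂]
  congr 5 <;> congr 2 <;> ring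

/-- The slopes at a point of `(-L, 0)` form an interval that is upper semicontinuous. -/
theorem exists_slopes_interval (hM : KernelBound K M) (hL : 0 < L) {z : ℝ} (h₁ : -L < z)
    (h₂ : z < 0) : ∃ l u, l ≤ u ∧ (∀ s, l ≤ s → s ≤ u → s ∈ slopes K L z) ∧
      ∀ η > 0, ∀ᶠ w in 𝓝 z, l - η ≤ deriv K (rep L w) ∧ deriv K (rep L w) ≤ u + η := by
  have hneg : ∀ a : ℝ, a < 0 → ContinuousAt (deriv K) a := by
    intro a ha
    have hlip : LipschitzOnWith M.toNNReal (deriv K) (Set.Iio 0) := by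
      refine LipschitzOnWith.of_dist_le_mul fun s hs t ht => ?_
      rw [Real.coe_toNNReal _ hM.pos.le]
      exact hM.lipschitz_neg s t hs ht
    exact hlip.continuousOn.continuousAt (Iio_mem_nhds ha)
  have hpos : ∀ a : ℝ, 0 < a → ContinuousAt (deriv K) a := by
    intro a ha
    have hlip : LipschitzOnWith M.toNNReal (deriv K) (Set.Ioi 0) := by
      refine LipschitzOnWith.of_dist_le_mul fun s hs t ht => ?_
      rw [Real.coe_toNNReal _ hM.pos.le]
      exact hM.lipschitz_pos s t hs ht
    exact hlip.continuousOn.continuousAt (Ioi_mem_nhds ha)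
  have hnear : ∀ (g : ℝ → ℝ) (a : ℝ), ContinuousAt g z → g z = a → ∀ η > 0,
      ∀ᶠ w in 𝓝 z, a - η ≤ g w ∧ g w ≤ a + η := by
    intro g a hg ha η hη
    have := Metric.tendsto_nhds.1 hg η hη
    filter_upwards [this] with w hw
    rw [Real.dist_eq, ha, abs_lt] at hw
    constructor <;> linarith [hw.1, hw.2]
  have hshift : ContinuousAt (fun w => deriv K (w + L)) z :=
    ContinuousAt.comp (f := fun w => w + L) (hpos (z + L) (by linarith)) (by fun_prop)
  rcases lt_trichotomy z (-(L / 2)) with hz | hz | hz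
  · refine ⟨deriv K (z + L), deriv K (z + L), le_rfl, ?_, fun η hη => ?_⟩
    · intro s hs hs'
      have : s = deriv K (z + L) := le_antisymm hs' hs
      rw [this, ← rep_eq_add hL h₁ hz]
      exact hM.deriv_mem_slopes z
    · filter_upwards [hnear _ _ hshift rfl η hη, Ioo_mem_nhds h₁ hz] with w hw hw'
      rwa [rep_eq_add hL hw'.1 hw'.2]
  · subst hz
    -- The sign of K'(L/2) is unknown, so the segment of slopes is written symmetrically with
    -- absolute values.
    refine ⟨-|deriv K (L / 2)|, |deriv K (L / 2)|, by linarith [abs_nonneg (deriv K (L / 2))],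
      ?_, fun η hη => ?_⟩
    · intro s hs hs'
      refine Or.inr ⟨rep_eq_self hL le_rfl (by linarith), ?_⟩
      rw [Set.mem_uIcc]
      rcases abs_cases (deriv K (L / 2)) with ⟨h, _⟩ | ⟨h, _⟩ <;> rw [h] at hs hs'
      · exact Or.inr ⟨hs, hs'⟩
      · exact Or.inl ⟨by linarith, hs'⟩
    · have hc₁ := hnear _ _ hshift rfl η hη
      have hc₂ := hnear _ _ (hneg (-(L / 2)) h₂) rfl η hη
      filter_upwards [hc₁, hc₂, Ioo_mem_nhds h₁ h₂] with w hw₁ hw₂ hw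
      rw [show -(L / 2) + L = L / 2 by ring] at hw₁
      rw [hM.odd] at hw₂
      have ha := le_abs_self (deriv K (L / 2))
      have hb := neg_abs_le (deriv K (L / 2))
      rcases lt_or_ge w (-(L / 2)) with hlt | hge
      · rw [rep_eq_add hL hw.1 hlt]
        constructor <;> linarith [hw₁.1, hw₁.2]
      · rw [rep_eq_self hL hge (by linarith [hw.2])]
        constructor <;> linarith [hw₂.1, hw₂.2]
  · refine ⟨deriv K z, deriv K z, le_rfl, ?_, fun η hη => ?_⟩
    · intro s hs hs'
      have : s = deriv K (rep L z) := by
        rw [rep_eq_self hL hz.le (by linarith)]; exact le_antisymm hs' hs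
      rw [this]
      exact hM.deriv_mem_slopes z
    · filter_upwards [hnear _ _ (hneg z h₂) rfl η hη, Ioo_mem_nhds hz h₂] with w hw hw'
      rwa [rep_eq_self hL hw'.1.le (by linarith [hw'.2])]

/-- The inclusion only determines the sum of the slopes; individual slopes are recovered by moving
all of them simultaneously from the lower to the upper ends. -/
theorem exists_sum_eq {I : Finset ℤ} {l u : ℤ → ℝ} (hlu : ∀ j ∈ I, l j ≤ u j) {S : ℝ}
    (h₁ : ∑ j ∈ I, l j ≤ S) (h₂ : S ≤ ∑ j ∈ I, u j) :
    ∃ s : ℤ → ℝ, (∀ j ∈ I, l j ≤ s j ∧ s j ≤ u j) ∧ ∑ j ∈ I, s j = S := by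
  have hcont : Continuous (fun θ : ℝ => ∑ j ∈ I, (l j + θ * (u j - l j))) := by fun_prop
  obtain ⟨θ, hθ, hS⟩ := intermediate_value_Icc zero_le_one hcont.continuousOn
    (show S ∈ _ by simp only [zero_mul, add_zero, one_mul, add_sub_cancel]; exact ⟨h₁, h₂⟩)
  refine ⟨fun j => l j + θ * (u j - l j), fun j hj => ?_, hS⟩
  have := hlu j hj
  constructor <;> nlinarith [hθ.1, hθ.2]

theorem continuous_truncatedDiffusion (hφ : IsDiffusion W φ) (hc : 0 < c) (hN : 0 < N) (hδ : 0 < δ)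
    (i j : ℤ) : Continuous (fun y : ℤ → ℝ => φ (c / (N * max (y i - y j) δ))) := by
  have hN' : (0 : ℝ) < N := by exact_mod_cast hN
  have hpos : ∀ y : ℤ → ℝ, 0 < N * max (y i - y j) δ := fun y =>
    mul_pos hN' (lt_max_of_lt_right hδ)
  refine hφ.contDiffOn.continuousOn.comp_continuous ?_ fun y => ?_
  · refine continuous_const.div ?_ fun y => (hpos y).ne'
    fun_prop
  · exact (div_pos hc (hpos y)).le

/-- A generalized solution of the truncated system satisfies the differential inclusion. -/
theorem exists_slopes_of_generalized (hM : KernelBound K M) (hφ : IsDiffusion W φ) (hL : 0 < L)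
    (hc : 0 < c) (hδ : 0 < δ) {y : ℤ → ℝ} (hy : IsConfig L N y)
    (hgap : ∀ k, δ ≤ y (k + 1) - y k) {k : ℤ} {v : ℝ}
    (hv : ∀ A A', (∀ᶠ z in 𝓝 y, A ≤ truncatedField K φ L c N δ z k ∧
      truncatedField K φ L c N δ z k ≤ A') → A ≤ v ∧ v ≤ A') :
    ∃ s : ℤ → ℝ, (∀ j ∈ Finset.Ioo k (k + N), s j ∈ slopes K L (y k - y j)) ∧
      v = -(c / N) * ∑ j ∈ Finset.Ioo k (k + N), s j
        - N / c * (φ (cellDensity c N y k) - φ (cellDensity c N y (k - 1))) := by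
  have hN := hy.pos hL
  have hN' : (0 : ℝ) < N := by exact_mod_cast hN
  have hint : ∀ j : ℤ, ∃ l u, j ∈ Finset.Ioo k (k + N) → (l ≤ u ∧
      (∀ s, l ≤ s → s ≤ u → s ∈ slopes K L (y k - y j)) ∧
      ∀ η > 0, ∀ᶠ w in 𝓝 (y k - y j), l - η ≤ deriv K (rep L w) ∧ deriv K (rep L w) ≤ u + η) := by
    intro j
    by_cases hj : j ∈ Finset.Ioo k (k + N)
    · obtain ⟨l, u, h⟩ := exists_slopes_interval hM hL (hy.sub_mem_Ioo hj).1 (hy.sub_mem_Ioo hj).2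
      exact ⟨l, u, fun _ => h⟩
    · exact ⟨0, 0, fun h => absurd h hj⟩
  choose l u hlu using hint
  set I := Finset.Ioo k (k + (N : ℤ)) with hI
  set D := N / c * (φ (cellDensity c N y k) - φ (cellDensity c N y (k - 1))) with hD
  set DD : (ℤ → ℝ) → ℝ := fun z =>
    N / c * (φ (c / (N * max (z (k + 1) - z k) δ)) - φ (c / (N * max (z k - z (k - 1)) δ))) with hDD
  have hDcont : Continuous DD := continuous_const.mul
    ((continuous_truncatedDiffusion hφ hc hN hδ _ _).sub
      (continuous_truncatedDiffusion hφ hc hN hδ _ _))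
  have hDy : DD y = D := by
    simp only [hDD, hD, cellDensity]
    have := hgap (k - 1)
    rw [sub_add_cancel] at this
    rw [max_eq_left (hgap k), max_eq_left this, sub_add_cancel]
  have hbound : ∀ η > 0, -(c / N) * ∑ j ∈ I, u j - D - η ≤ v ∧
      v ≤ -(c / N) * ∑ j ∈ I, l j - D + η := by
    intro η hη
    -- An error η' in each of fewer than N slopes, weighted by c/N, costs at most η/2. The other
    -- half is left for the diffusion.
    set η' := η / (2 * c) with hη'
    have hη'0 : 0 < η' := by positivity
    refine hv _ _ ?_
    have hev₁ : ∀ᶠ z in 𝓝 y, ∀ j ∈ I, l j - η' ≤ deriv K (rep L (z k - z j)) ∧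
        deriv K (rep L (z k - z j)) ≤ u j + η' := by
      rw [Finset.eventually_all]
      intro j hj
      have hcj : Tendsto (fun z : ℤ → ℝ => z k - z j) (𝓝 y) (𝓝 (y k - y j)) :=
        Continuous.tendsto (by fun_prop) y
      exact hcj.eventually ((hlu j hj).2.2 η' hη'0)
    have hev₂ : ∀ᶠ z in 𝓝 y, |DD z - D| < η / 2 := by
      have := Metric.tendsto_nhds.1 (hDcont.tendsto y) (η / 2) (by linarith)
      rw [hDy] at this
      simpa [Real.dist_eq] using this
    filter_upwards [hev₁, hev₂] with z hz₁ hz₂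
    have hfield : truncatedField K φ L c N δ z k
        = -(c / N) * ∑ j ∈ I, deriv K (rep L (z k - z j)) - DD z := rfl
    have hcard : (I.card : ℝ) ≤ N := by
      rw [hI, Int.card_Ioo]; exact_mod_cast (by omega)
    have hcη : c / N * (I.card * η') ≤ η / 2 := by
      calc c / N * (I.card * η') ≤ c / N * (N * η') := by gcongr
        _ = η / 2 := by rw [hη']; field_simp
    have hs₁ : ∑ j ∈ I, l j - I.card * η' ≤ ∑ j ∈ I, deriv K (rep L (z k - z j)) := by
      have := Finset.sum_le_sum fun j hj => (hz₁ j hj).1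
      simpa [Finset.sum_sub_distrib] using this
    have hs₂ : ∑ j ∈ I, deriv K (rep L (z k - z j)) ≤ ∑ j ∈ I, u j + I.card * η' := by
      have := Finset.sum_le_sum fun j hj => (hz₁ j hj).2
      simpa [Finset.sum_add_distrib] using this
    have hcN : 0 ≤ c / N := by positivity
    have hm₁ := mul_le_mul_of_nonneg_left hs₁ hcN
    have hm₂ := mul_le_mul_of_nonneg_left hs₂ hcN
    rw [hfield]
    rw [abs_lt] at hz₂
    constructor <;> linarith [hz₂.1, hz₂.2]
  have hlow : -(c / N) * ∑ j ∈ I, u j - D ≤ v :=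
    le_of_forall_pos_le_add fun η hη => by linarith [(hbound η hη).1]
  have hupp : v ≤ -(c / N) * ∑ j ∈ I, l j - D :=
    le_of_forall_pos_le_add fun η hη => by linarith [(hbound η hη).2]
  have hcN : 0 < c / N := by positivity
  obtain ⟨s, hs, hsum⟩ := exists_sum_eq (I := I) (l := l) (u := u)
    (fun j hj => (hlu j hj).1) (S := -(v + D) / (c / N))
    (by rw [le_div_iff₀ hcN]; linarith) (by rw [div_le_iff₀ hcN]; linarith)
  refine ⟨s, fun j hj => (hlu j hj).2.1 _ (hs j hj).1 (hs j hj).2, ?_⟩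
  rw [hsum]
  field_simp
  ring

end Field

/-- The a priori bound R forces cells of length at least d = c/(N R), so the field is truncated at
d/2. A continuity argument excludes a first time at which a cell shrinks to d/2. -/
theorem exists_particles {K W φ ρ₀ : ℝ → ℝ} {L M ε M₀ : ℝ} (hM : KernelBound K M)
    (hφ : IsDiffusion W φ) (hL : 0 < L) (hD : DataBound ρ₀ ε M₀) {T : ℝ} (hT : 0 ≤ T) {N : ℕ}
    (hN : 2 ≤ N) : ∃ x, IsParticles K φ L ρ₀ T N x := by
  obtain ⟨R, C, hR, hMR, _, hapr⟩ := exists_apriori_bounds hM hφ hL hD hT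
  have hc := hD.mass_pos hL
  set c := mass L ρ₀ with hcdef
  have hN0 : 0 < N := by omega
  have hN' : (0 : ℝ) < N := by exact_mod_cast hN0
  obtain ⟨y₀, hy₀, hinit⟩ := hD.exists_initial_config hL hN0
  set d := c / (N * R) with hd
  have hd0 : 0 < d := by positivity
  have hgap_of : ∀ {y : ℤ → ℝ}, IsConfig L N y → ∀ k, cellDensity c N y k ≤ R →
      d ≤ y (k + 1) - y k := by
    intro y hy k hk
    have h₁ := hy.cellDensity_mul_gap (c := c) hL k
    have h₂ := sub_pos.2 (hy.ordered k)
    rw [hd, ← div_div, div_le_iff₀ hR, ← h₁, mul_comm]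
    gcongr
  have hδ : 0 < d / 2 := by positivity
  set B := c * M + N / c * φ (c / (N * (d / 2))) with hB
  obtain ⟨x, hx0, hxl, hxlip, hxder⟩ := exists_generalized_solution
    (f := truncatedField K φ L c N (d / 2)) (B := B)
    (fun y k => abs_truncatedField_le hM hφ hc hN0 hδ y k) y₀ (L := L) (N := N)
    (fun y hy k => truncatedField_add hy k) hy₀.lift
  have hB0 : 0 ≤ B := (abs_nonneg _).trans (abs_truncatedField_le (L := L) hM hφ hc hN0 hδ y₀ 0)
  have hpart : ∀ T' ∈ Set.Icc 0 T, (∀ t ∈ Set.Icc 0 T', ∀ k, d / 2 < x (k + 1) t - x k t) →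
      IsParticles K φ L ρ₀ T' N x := by
    intro T' hT' hgap
    have hAC : ∀ k, AbsolutelyContinuousOnInterval (x k) 0 T' := fun k =>
      absolutelyContinuousOnInterval_of_abs_sub_le hT'.1
        (fun s hs t ht => hxlip k s t hs.1 ht.1)
    have hcfg : ∀ t ∈ Set.Icc 0 T', IsConfig L N (fun k => x k t) := fun t ht =>
      ⟨fun k => hxl k t ht.1, fun k => by linarith [hgap t ht k]⟩
    refine ⟨fun t ht => (hcfg t ht).lift, fun t ht => (hcfg t ht).ordered,
      fun k hk => by rw [hx0, hinit k hk], hAC, ?_⟩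
    filter_upwards [ae_all_iff.2 fun k => (hAC k).ae_differentiableAt] with t ht hmem k
    have hmem' : t ∈ Set.Icc 0 T' := Set.Ioo_subset_Icc_self hmem
    have hder := (ht k (by rwa [Set.uIcc_of_le hT'.1])).hasDerivAt
    obtain ⟨s, hs, hv⟩ := exists_slopes_of_generalized hM hφ hL hc hδ (hcfg t hmem')
      (fun k => (hgap t hmem' k).le) (k := k) (v := deriv (x k) t)
      (fun A A' hev => hxder k t hmem'.1 A A' _ hev hder)
    refine ⟨s, hs, ?_⟩
    rw [hv] at hder
    exact hder
  have hcont : ∀ k, ContinuousOn (x k) (Set.Icc 0 T) := by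
    intro k
    have := (absolutelyContinuousOnInterval_of_abs_sub_le hT
      (fun s hs t ht => hxlip k s t hs.1 ht.1)).continuousOn
    rwa [Set.uIcc_of_le hT] at this
  have hshift : ∀ t, 0 ≤ t → ∀ k m : ℤ, d / 2 < x (k + 1) t - x k t →
      d / 2 < x (k + m * N + 1) t - x (k + m * N) t := by
    have hmul : ∀ t, 0 ≤ t → ∀ k m : ℤ, x (k + m * N) t = x k t + m * L := by
      intro t ht k m
      induction m with
      | zero => simp
      | succ n ih =>
        rw [show k + ((n : ℤ) + 1) * N = k + n * N + N by ring, hxl _ t ht, ih]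
        push_cast; ring
      | pred n ih =>
        have := hxl (k + (-(n : ℤ) - 1) * N) t ht
        rw [show k + (-(n : ℤ) - 1) * N + N = k + (-(n : ℤ)) * N by ring, ih] at this
        push_cast at this ⊢
        linarith
    intro t ht k m hk
    rw [show k + m * (N : ℤ) + 1 = k + 1 + m * N by ring, hmul t ht, hmul t ht]
    linarith
  have hgood : ∀ t ∈ Set.Icc 0 T, ∀ k, d / 2 < x (k + 1) t - x k t := by
    by_contra hcon
    have hbad : ∃ t ∈ Set.Icc 0 T, ∃ k ∈ Finset.range N, x ((k : ℤ) + 1) t - x k t ≤ d / 2 := by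
      by_contra hcon'
      push Not at hcon'
      exact hcon fun t ht => hy₀.forall_of_range hL (hshift t ht.1) (hcon' t ht)
    set S := ⋃ k ∈ Finset.range N, {t ∈ Set.Icc 0 T | x ((k : ℤ) + 1) t - x k t ≤ d / 2} with hS
    have hScomp : IsCompact S := by
      refine (Finset.range N).isCompact_biUnion fun k _ => ?_
      exact isCompact_Icc.of_isClosed_subset
        (((hcont (k + 1)).sub (hcont k)).preimage_isClosed_of_isClosed isClosed_Icc isClosed_Iic)
        (fun t ht => ht.1)
    have hSne : S.Nonempty := by
      obtain ⟨t, ht, k, hk, hle⟩ := hbad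
      exact ⟨t, Set.mem_biUnion hk ⟨ht, hle⟩⟩
    obtain ⟨t₁, ht₁, hleast⟩ := hScomp.exists_isLeast hSne
    obtain ⟨k, hk, ht₁T, hkle⟩ : ∃ k ∈ Finset.range N, t₁ ∈ Set.Icc 0 T ∧
        x ((k : ℤ) + 1) t₁ - x k t₁ ≤ d / 2 := by
      simp only [hS, Set.mem_iUnion, exists_prop] at ht₁
      exact ht₁
    -- Before t₁ the truncation is inactive, so the curves solve the original system on [0, s] and
    -- the a priori bound improves d/2 to d.
    have hbefore : ∀ s ∈ Set.Ico 0 t₁, d ≤ x ((k : ℤ) + 1) s - x k s := by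
      intro s hs
      have hsT : s ∈ Set.Icc 0 T := ⟨hs.1, hs.2.le.trans ht₁T.2⟩
      have hp : IsParticles K φ L ρ₀ s N x := by
        refine hpart s hsT fun t ht => hy₀.forall_of_range hL (hshift t ht.1) fun j hj => ?_
        by_contra hle
        have := hleast (show t ∈ S from
          Set.mem_biUnion hj ⟨⟨ht.1, ht.2.trans hsT.2⟩, not_lt.1 hle⟩)
        linarith [ht.2, hs.2]
      have hs' : s ∈ Set.Icc 0 s := Set.right_mem_Icc.2 hs.1
      exact hgap_of (hp.config hs') k ((hapr N hN s hsT x hp).1 s hs' k)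
    rcases ht₁T.1.eq_or_lt with h0 | h0
    · have h₁ : d ≤ y₀ (k + 1) - y₀ k :=
        hgap_of hy₀ k ((hD.cellDensity_initial hL hy₀ hinit k).2.trans hMR)
      rw [← h0, hx0, hx0] at hkle
      linarith
    -- Between s and t₁ each end point moves by at most d/8, so a cell of length d at time s cannot
    -- have shrunk to d/2.
    · set s := max 0 (t₁ - d / (8 * (B + 1))) with hs
      have hpos : 0 < d / (8 * (B + 1)) := by positivity
      have hslt : s < t₁ := max_lt h0 (by linarith)
      have hs0 : 0 ≤ s := le_max_left _ _
      have hss : t₁ - s ≤ d / (8 * (B + 1)) := by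
        have : t₁ - d / (8 * (B + 1)) ≤ s := le_max_right _ _
        linarith
      have h₁ := hbefore s ⟨hs0, hslt⟩
      have h₂ := abs_le.1 (hxlip (k + 1) s t₁ hs0 h0.le)
      have h₃ := abs_le.1 (hxlip k s t₁ hs0 h0.le)
      have h₄ : B * |s - t₁| ≤ d / 8 := by
        rw [abs_sub_comm, abs_of_pos (by linarith)]
        calc B * (t₁ - s) ≤ (B + 1) * (d / (8 * (B + 1))) := by gcongr; linarith
          _ = d / 8 := by field_simp
      linarith [h₂.1, h₂.2, h₃.1, h₃.2]
  exact ⟨x, hpart T (Set.right_mem_Icc.2 hT) hgood⟩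

/-! ### Integrals of the discrete density -/

theorem sum_range_add_eq {g : ℤ → ℝ} {N : ℕ} (hg : ∀ k, g (k + N) = g k) (p : ℤ) :
    ∑ i ∈ Finset.range N, g (p + i) = ∑ i ∈ Finset.range N, g i := by
  have hper : ∀ p k : ℤ, g (p + (k + N)) = g (p + k) := fun p k => by rw [← add_assoc, hg]
  induction p with
  | zero => simp
  | succ n ih =>
    rw [← ih, ← sum_range_shift (g := fun k => g (n + k)) (hper n)]
    exact Finset.sum_congr rfl fun i _ => by congr 1; ring
  | pred n ih =>
    rw [← ih, ← sum_range_shift_neg (g := fun k => g (-n + k)) (hper (-n))]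
    exact Finset.sum_congr rfl fun i _ => by congr 1; ring

theorem sum_range_eq_add_sum_Ioo (f : ℤ → ℝ) (k : ℤ) {N : ℕ} (hN : 0 < N) :
    ∑ i ∈ Finset.range N, f (k + i) = f k + ∑ j ∈ Finset.Ioo k (k + N), f j := by
  have h₁ : ∑ i ∈ Finset.range N, f (k + i) = ∑ j ∈ Finset.Ico k (k + N), f j := by
    refine Finset.sum_nbij' (fun i => k + i) (fun j => (j - k).toNat) ?_ ?_ ?_ ?_ ?_
    · intro i hi
      rw [Finset.mem_range] at hi
      rw [Finset.mem_Ico]; omega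
    · intro j hj
      rw [Finset.mem_Ico] at hj
      rw [Finset.mem_range]; omega
    · intro i _
      simp
    · intro j hj
      rw [Finset.mem_Ico] at hj
      omega
    · intro i _; rfl
  have h₂ : Finset.Ico k (k + N) = insert k (Finset.Ioo k (k + N)) := by
    ext j
    simp only [Finset.mem_insert, Finset.mem_Ioo, Finset.mem_Ico]; omega
  rw [h₁, h₂, Finset.sum_insert (by simp)]

theorem intervalIntegrable_of_abs_le {f : ℝ → ℝ} {C : ℝ} (hf : Measurable f)
    (hC : ∀ z, |f z| ≤ C) (a b : ℝ) : IntervalIntegrable f volume a b := by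
  refine (intervalIntegrable_const (c := C)).mono_fun hf.aestronglyMeasurable
    (Eventually.of_forall fun z => ?_)
  exact (hC z).trans (le_abs_self C)

theorem abs_integral_le_of_abs_le {f : ℝ → ℝ} {a b C : ℝ} (hab : a ≤ b)
    (h : ∀ z ∈ Set.Ioo a b, |f z| ≤ C) : |∫ z in a..b, f z| ≤ C * (b - a) := by
  have := intervalIntegral.norm_integral_le_of_norm_le_const_ae (f := f) (a := a) (b := b) (C := C)
    (by
      rw [Set.uIoc_of_le hab]
      filter_upwards [compl_mem_ae_iff.2 (measure_singleton (μ := volume) b)] with z hz hmem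
      exact h z ⟨hmem.1, lt_of_le_of_ne hmem.2 hz⟩)
  rwa [Real.norm_eq_abs, abs_of_nonneg (by linarith : (0 : ℝ) ≤ b - a)] at this

namespace IsConfig

variable {K φ : ℝ → ℝ} {L c R M : ℝ} {N : ℕ} {y : ℤ → ℝ}

theorem abs_density_le (hy : IsConfig L N y) (hL : 0 < L) (hc : 0 < c)
    (hR : ∀ k, cellDensity c N y k ≤ R) (z : ℝ) : |density L c N y z| ≤ R := by
  rw [abs_of_nonneg (hy.density_nonneg hL hc z)]
  exact hy.density_le hL hR z

theorem intervalIntegrable_density (hy : IsConfig L N y) (hL : 0 < L) (hc : 0 < c)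
    (hR : ∀ k, cellDensity c N y k ≤ R) (a b : ℝ) :
    IntervalIntegrable (density L c N y) volume a b :=
  intervalIntegrable_of_abs_le (measurable_density_right L c N y) (hy.abs_density_le hL hc hR) a b

theorem integral_density_cell (hy : IsConfig L N y) (hL : 0 < L) (k : ℤ) :
    ∫ z in (y k)..(y (k + 1)), density L c N y z = c / N := by
  rw [hy.integral_cell hL (fun r _ => r), intervalIntegral.integral_const, smul_eq_mul, mul_comm,
    hy.cellDensity_mul_gap hL]

theorem integral_density_span (hy : IsConfig L N y) (hL : 0 < L) (hc : 0 < c)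
    (hR : ∀ k, cellDensity c N y k ≤ R) (k : ℤ) :
    ∫ z in (y 0)..(y k), density L c N y z = k * (c / N) := by
  have hi := hy.intervalIntegrable_density hL hc hR
  induction k with
  | zero => simp
  | succ n ih =>
    rw [← intervalIntegral.integral_add_adjacent_intervals (hi _ (y n)) (hi _ _), ih,
      hy.integral_density_cell hL]
    push_cast; ring
  | pred n ih =>
    have := hy.integral_density_cell (c := c) hL (-(n : ℤ) - 1)
    rw [sub_add_cancel] at this
    rw [← intervalIntegral.integral_add_adjacent_intervals (hi _ (y (-n))) (hi _ _), ih,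
      intervalIntegral.integral_symm, this]
    push_cast; ring

theorem mass_density (hy : IsConfig L N y) (hL : 0 < L) (hc : 0 < c)
    (hR : ∀ k, cellDensity c N y k ≤ R) : mass L (density L c N y) = c := by
  have hN' : (0 : ℝ) < N := by exact_mod_cast hy.pos hL
  rw [mass, hy.integral_period (hy.density_periodic hL) (hy.intervalIntegrable_density hL hc hR)]
  simp only [hy.integral_density_cell hL, Finset.sum_const, Finset.card_range, nsmul_eq_mul]
  field_simp

/-- Quadrature: the empirical measure is close to the discrete density. -/
theorem abs_sum_sub_integral_le (hy : IsConfig L N y) (hL : 0 < L) (hc : 0 < c)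
    (hR : ∀ k, cellDensity c N y k ≤ R) {g : ℝ → ℝ} {Λ : ℝ} (hper : Function.Periodic g L)
    (hg : ∀ z w, |g z - g w| ≤ Λ * |z - w|) :
    |c / N * ∑ k ∈ Finset.range N, g (y k)
      - ∫ z in (-(L / 2))..(L / 2), density L c N y z * g z| ≤ Λ * (c / N) * L := by
  have hN' : (0 : ℝ) < N := by exact_mod_cast hy.pos hL
  have hΛ : 0 ≤ Λ := by
    have := (abs_nonneg _).trans (hg 1 0)
    simpa using this
  have hgc : Continuous g := by
    have : LipschitzWith Λ.toNNReal g := LipschitzWith.of_dist_le_mul fun z w => by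
      rw [Real.coe_toNNReal _ hΛ]; exact hg z w
    exact this.continuous
  have hi : ∀ a b, IntervalIntegrable (fun z => density L c N y z * g z) volume a b :=
    fun a b => (hy.intervalIntegrable_density hL hc hR a b).mul_continuousOn hgc.continuousOn
  rw [hy.integral_period (f := fun z => density L c N y z * g z)
    ((hy.density_periodic hL).mul hper) hi, Finset.mul_sum,
    ← Finset.sum_sub_distrib]
  have hterm : ∀ k ∈ Finset.range N, |c / N * g (y k)
      - ∫ z in (y k)..(y (k + 1)), density L c N y z * g z|
      ≤ Λ * (c / N) * (y (k + 1) - y k) := by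
    intro k _
    have hgap := hy.ordered k
    have hρ := hy.cellDensity_pos hL hc k
    have h₁ : c / N * g (y k) - ∫ z in (y k)..(y (k + 1)), density L c N y z * g z
        = cellDensity c N y k * ∫ z in (y k)..(y (k + 1)), (g (y k) - g z) := by
      rw [hy.integral_cell hL (fun r z => r * g z), intervalIntegral.integral_const_mul,
        intervalIntegral.integral_sub intervalIntegrable_const (hgc.intervalIntegrable _ _),
        intervalIntegral.integral_const, smul_eq_mul, ← hy.cellDensity_mul_gap hL k]
      ring
    rw [h₁, abs_mul, abs_of_pos hρ]
    have h₂ : |∫ z in (y k)..(y (k + 1)), (g (y k) - g z)|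
        ≤ Λ * (y (k + 1) - y k) * (y (k + 1) - y k) := by
      refine abs_integral_le_of_abs_le hgap.le fun z hz => (hg _ _).trans ?_
      rw [abs_sub_comm, abs_of_pos (by linarith [hz.1])]
      gcongr
      exact hz.2.le
    calc cellDensity c N y k * |∫ z in (y k)..(y (k + 1)), (g (y k) - g z)|
        ≤ cellDensity c N y k * (Λ * (y (k + 1) - y k) * (y (k + 1) - y k)) := by gcongr
      _ = Λ * (c / N) * (y (k + 1) - y k) := by rw [← hy.cellDensity_mul_gap hL k]; ring
  refine (Finset.abs_sum_le_sum_abs _ _).trans ((Finset.sum_le_sum hterm).trans (le_of_eq ?_))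
  rw [← Finset.mul_sum, hy.sum_gap]

end IsConfig

/-! ### The convolution -/

section Conv

variable {K r : ℝ → ℝ} {L M R c : ℝ} {N : ℕ} {y : ℤ → ℝ}

theorem measurable_kernel_comp (K : ℝ → ℝ) (L x : ℝ) :
    Measurable (fun z => deriv K (rep L (x - z))) :=
  (measurable_deriv K).comp ((measurable_rep L).comp (measurable_const.sub measurable_id))

theorem KernelBound.abs_mul_le (hM : KernelBound K M) (hr : ∀ z, |r z| ≤ R) (x z : ℝ) :
    |deriv K (rep L (x - z)) * r z| ≤ M * R := by
  rw [abs_mul]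
  exact mul_le_mul (hM.abs_deriv_le _) (hr z) (abs_nonneg _) hM.pos.le

theorem KernelBound.intervalIntegrable_conv (hM : KernelBound K M) (hrm : Measurable r)
    (hr : ∀ z, |r z| ≤ R) (x a b : ℝ) :
    IntervalIntegrable (fun z => deriv K (rep L (x - z)) * r z) volume a b :=
  intervalIntegrable_of_abs_le ((measurable_kernel_comp K L x).mul hrm) (hM.abs_mul_le hr x) a b

/-- Over the window (x, x + L) the difference x - z runs through (-L, 0). The jump of the kernel at
0 then sits at the ends and only the antipodal one is interior. -/
theorem conv_eq_integral (hL : 0 < L) (hper : Function.Periodic r L) (x : ℝ) :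
    conv K L r x = ∫ z in x..(x + L), deriv K (rep L (x - z)) * r z := by
  have hp : Function.Periodic (fun z => deriv K (rep L (x - z)) * r z) L := by
    intro z
    simp only [hper z]
    rw [show x - (z + L) = x - z - L by ring, rep_sub_period hL]
  have := hp.intervalIntegral_add_eq (-(L / 2)) x
  rw [← this, conv]
  congr 1; ring

theorem KernelBound.abs_conv_le (hM : KernelBound K M) (hL : 0 < L) (hr : ∀ z, |r z| ≤ R) (x : ℝ) :
    |conv K L r x| ≤ M * R * L := by
  have := abs_integral_le_of_abs_le (f := fun z => deriv K (rep L (x - z)) * r z)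
    (a := -(L / 2)) (b := L / 2) (by linarith) (fun z _ => hM.abs_mul_le hr x z)
  rwa [show L / 2 - -(L / 2) = L by ring] at this

/-- The kernel jumps, but r is bounded: shifting by h changes the integrand by a jump only on sets
of measure h. In L + 4, the L is the Lipschitz part, two units are the non-overlapping ends and two
the antipodal jump. -/
theorem KernelBound.conv_lipschitz (hM : KernelBound K M) (hL : 0 < L) (hrm : Measurable r)
    (hper : Function.Periodic r L) (hr : ∀ z, |r z| ≤ R) (x x' : ℝ) :
    |conv K L r x - conv K L r x'| ≤ M * R * (L + 4) * |x - x'| := by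
  have hR : 0 ≤ R := (abs_nonneg _).trans (hr 0)
  have hMp := hM.pos
  wlog hxx : x ≤ x' generalizing x x'
  · have := this x' x (by linarith)
    rwa [abs_sub_comm, abs_sub_comm x'] at this
  have habs : |x - x'| = x' - x := by rw [abs_sub_comm, abs_of_nonneg (by linarith)]
  rw [habs]
  set h := x' - x with hh
  have hh0 : 0 ≤ h := by rw [hh]; linarith
  -- For shifts longer than a period the windows need not overlap, and the uniform bound on the
  -- convolution suffices.
  rcases le_or_gt L h with hlarge | hsmall
  · have h₁ := abs_le.1 (hM.abs_conv_le hL hr x)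
    have h₂ := abs_le.1 (hM.abs_conv_le hL hr x')
    have hMR : 0 ≤ M * R := by positivity
    have h₃ : M * R * L ≤ M * R * h := by gcongr
    have h₄ : 0 ≤ M * R * L * h := by positivity
    rw [abs_le]
    constructor <;> nlinarith [h₁.1, h₁.2, h₂.1, h₂.2]
  · have hi := fun x => hM.intervalIntegrable_conv (L := L) hrm hr x
    have e₁ : conv K L r x - conv K L r x'
        = (∫ z in x..x', deriv K (rep L (x - z)) * r z)
          + (∫ z in x'..(x + L),
              (deriv K (rep L (x - z)) * r z - deriv K (rep L (x' - z)) * r z))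
          - ∫ z in (x + L)..(x' + L), deriv K (rep L (x' - z)) * r z := by
      rw [conv_eq_integral hL hper, conv_eq_integral hL hper,
        intervalIntegral.integral_sub (hi _ _ _) (hi _ _ _),
        ← intervalIntegral.integral_add_adjacent_intervals (hi x x x') (hi x x' (x + L)),
        ← intervalIntegral.integral_add_adjacent_intervals (hi x' x' (x + L)) (hi x' (x + L) _)]
      ring
    have b₁ : |∫ z in x..x', deriv K (rep L (x - z)) * r z| ≤ M * R * h :=
      abs_integral_le_of_abs_le hxx fun z _ => hM.abs_mul_le hr x z
    have b₃ : |∫ z in (x + L)..(x' + L), deriv K (rep L (x' - z)) * r z| ≤ M * R * h := by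
      have := abs_integral_le_of_abs_le (f := fun z => deriv K (rep L (x' - z)) * r z)
        (a := x + L) (b := x' + L) (by linarith) (fun z _ => hM.abs_mul_le hr x' z)
      rwa [show x' + L - (x + L) = h by rw [hh]; ring] at this
    -- The points z for which -L/2 lies between x - z and x' - z.
    set S := Set.Icc (x + L / 2) (x' + L / 2) with hS
    have hSi : Integrable (S.indicator (fun _ => 2 * M * R)) (volume : Measure ℝ) :=
      (integrable_indicator_iff measurableSet_Icc).2 (integrableOn_const (by simp))
    have b₂ : |∫ z in x'..(x + L),
        (deriv K (rep L (x - z)) * r z - deriv K (rep L (x' - z)) * r z)|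
        ≤ M * R * h * L + 2 * M * R * h := by
      have hxL : x' ≤ x + L := by linarith
      have hle : ∀ z ∈ Set.Ioo x' (x + L),
          |deriv K (rep L (x - z)) * r z - deriv K (rep L (x' - z)) * r z|
            ≤ M * R * h + S.indicator (fun _ => 2 * M * R) z := by
        intro z hz
        rw [← sub_mul, abs_mul]
        have hs := hM.deriv_mem_slopes (L := L) (x - z)
        have hs' := hM.deriv_mem_slopes (L := L) (x' - z)
        by_cases hzS : z ∈ S
        · rw [Set.indicator_of_mem hzS]
          have h₁ := hM.slopes_sub_le_two hs hs'
          have : |deriv K (rep L (x - z)) - deriv K (rep L (x' - z))| * |r z| ≤ 2 * M * R :=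
            mul_le_mul h₁ (hr z) (abs_nonneg _) (by positivity)
          have : 0 ≤ M * R * h := by positivity
          linarith
        · rw [Set.indicator_of_notMem hzS, add_zero]
          have h₁ := hM.slopes_sub_le hL (a := x - z) (b := x' - z) (by linarith [hz.2])
            (by linarith) (by linarith [hz.1])
            (fun hcon => hzS ⟨by linarith [hcon.1], by linarith [hcon.2]⟩) hs hs'
          rw [show x' - z - (x - z) = h by rw [hh]; ring] at h₁
          calc |deriv K (rep L (x - z)) - deriv K (rep L (x' - z))| * |r z| ≤ M * h * R :=
                mul_le_mul h₁ (hr z) (abs_nonneg _) (by positivity)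
            _ = M * R * h := by ring
      have hint : IntervalIntegrable (fun z => M * R * h + S.indicator (fun _ => 2 * M * R) z)
          volume x' (x + L) := intervalIntegrable_const.add hSi.intervalIntegrable
      have h₁ : |∫ z in x'..(x + L),
          (deriv K (rep L (x - z)) * r z - deriv K (rep L (x' - z)) * r z)|
          ≤ ∫ z in x'..(x + L), (M * R * h + S.indicator (fun _ => 2 * M * R) z) := by
        refine (intervalIntegral.abs_integral_le_integral_abs hxL).trans ?_
        refine intervalIntegral.integral_mono_ae_restrict hxL ((hi _ _ _).sub (hi _ _ _)).abs hint
          (ae_restrict_Icc_of_Ioo (Eventually.of_forall hle))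
      refine h₁.trans ?_
      rw [intervalIntegral.integral_add intervalIntegrable_const hSi.intervalIntegrable,
        intervalIntegral.integral_const, smul_eq_mul]
      have h₂ : ∫ z in x'..(x + L), S.indicator (fun _ => 2 * M * R) z ≤ 2 * M * R * h := by
        rw [intervalIntegral.integral_of_le hxL]
        refine (setIntegral_le_integral hSi (Eventually.of_forall fun z => ?_)).trans (le_of_eq ?_)
        · exact Set.indicator_nonneg (fun _ _ => by positivity) z
        · rw [integral_indicator_const _ measurableSet_Icc, Real.volume_real_Icc_of_le
            (by linarith), smul_eq_mul, hh]
          ring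
      have h₃ : (x + L - x') * (M * R * h) ≤ M * R * h * L := by
        rw [mul_comm]
        gcongr
        linarith
      linarith
    rw [e₁]
    rw [abs_le] at *
    constructor <;> linarith [b₁.1, b₁.2, b₂.1, b₂.2, b₃.1, b₃.2]

/-- The drift of a particle is close to the convolution with the discrete density. -/
theorem IsDrift.abs_sub_conv_le (hM : KernelBound K M) (hL : 0 < L) (hc : 0 < c)
    (hy : IsConfig L N y) (hR : ∀ k, cellDensity c N y k ≤ R) {k : ℤ} {v : ℝ}
    (h : IsDrift K L c N y k v) :
    |v - conv K L (density L c N y) (y k)| ≤ c / N * (M * L + 5 * M) := by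
  obtain ⟨s, hs, rfl⟩ := h
  have hN := hy.pos hL
  have hN' : (0 : ℝ) < N := by exact_mod_cast hN
  have hMp := hM.pos
  have hcN : 0 < c / N := by positivity
  set I := Finset.Ioo k (k + (N : ℤ)) with hI
  set κ : ℝ → ℝ := fun z => deriv K (rep L (y k - z)) with hκ
  have hκm : Measurable κ := measurable_kernel_comp K L (y k)
  have hκi : ∀ a b, IntervalIntegrable κ volume a b := fun a b =>
    intervalIntegrable_of_abs_le hκm (fun z => hM.abs_deriv_le _) a b
  have hi := hM.intervalIntegrable_conv (L := L) (measurable_density_right L c N y)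
    (hy.abs_density_le hL hc hR) (y k)
  have hcell : ∀ j, ∫ z in (y j)..(y (j + 1)), κ z * density L c N y z
      = cellDensity c N y j * ∫ z in (y j)..(y (j + 1)), κ z := by
    intro j
    rw [hy.integral_cell hL (fun r z => κ z * r), intervalIntegral.integral_mul_const, mul_comm]
  have e₁ : conv K L (density L c N y) (y k)
      = cellDensity c N y k * (∫ z in (y k)..(y (k + 1)), κ z)
        + ∑ j ∈ I, cellDensity c N y j * ∫ z in (y j)..(y (j + 1)), κ z := by
    rw [conv_eq_integral hL (hy.density_periodic hL), ← hy.lift,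
      IsConfig.integral_span y hi k N,
      sum_range_eq_add_sum_Ioo (fun j => ∫ z in (y j)..(y (j + 1)), κ z * density L c N y z) k hN,
      hcell]
    exact congrArg _ (Finset.sum_congr rfl fun j _ => hcell j)
  -- The cell starting at particle k has no counterpart in the drift, since there is no
  -- self-interaction. It contributes one of the 5M.
  have hfirst : |cellDensity c N y k * ∫ z in (y k)..(y (k + 1)), κ z| ≤ c / N * M := by
    have h₁ := abs_integral_le_of_abs_le (f := κ) (hy.ordered k).le
      (fun z _ => hM.abs_deriv_le _)
    rw [abs_mul, abs_of_pos (hy.cellDensity_pos hL hc k)]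
    calc cellDensity c N y k * |∫ z in (y k)..(y (k + 1)), κ z|
        ≤ cellDensity c N y k * (M * (y (k + 1) - y k)) :=
          mul_le_mul_of_nonneg_left h₁ (hy.cellDensity_pos hL hc k).le
      _ = c / N * M := by rw [← hy.cellDensity_mul_gap hL k]; ring
  -- Cells containing the point antipodal to yₖ. There are at most two, namely when that point is
  -- itself a particle, and they give the remaining 4M.
  set B := I.filter (fun j => y k - y (j + 1) ≤ -(L / 2) ∧ -(L / 2) ≤ y k - y j) with hB
  have hcard : B.card ≤ 2 := by
    refine card_le_two_of_le_add_one fun i hi j hj => ?_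
    by_contra hlt
    have hi' := (Finset.mem_filter.1 hi).2
    have hj' := (Finset.mem_filter.1 hj).2
    have h₃ := hy.strictMono (show i + 1 < j by omega)
    linarith [hi'.1, hi'.2, hj'.1, hj'.2]
  have hterm : ∀ j ∈ I, |c / N * s j - cellDensity c N y j * ∫ z in (y j)..(y (j + 1)), κ z|
      ≤ c / N * (M * (y (j + 1) - y j)
        + (if y k - y (j + 1) ≤ -(L / 2) ∧ -(L / 2) ≤ y k - y j then 2 * M else 0)) := by
    intro j hj
    have hgap := hy.ordered j
    have hρ := hy.cellDensity_pos hL hc j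
    have hmem := hy.sub_mem_Ioo hj
    have h₁ : c / N * s j - cellDensity c N y j * ∫ z in (y j)..(y (j + 1)), κ z
        = cellDensity c N y j * ∫ z in (y j)..(y (j + 1)), (s j - κ z) := by
      rw [intervalIntegral.integral_sub intervalIntegrable_const (hκi _ _),
        intervalIntegral.integral_const, smul_eq_mul, ← hy.cellDensity_mul_gap hL j]
      ring
    rw [h₁, abs_mul, abs_of_pos hρ, ← hy.cellDensity_mul_gap hL j, mul_assoc]
    refine mul_le_mul_of_nonneg_left ?_ hρ.le
    rw [mul_comm]
    refine abs_integral_le_of_abs_le hgap.le fun z hz => ?_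
    have hs' : κ z ∈ slopes K L (y k - z) := hM.deriv_mem_slopes _
    have hMg : 0 ≤ M * (y (j + 1) - y j) := mul_nonneg hMp.le (by linarith)
    split_ifs with hbad
    · have := hM.slopes_sub_le_two (hs j hj) hs'
      linarith
    · have hlast : y (j + 1) ≤ y k + L := by
        rw [← hy.lift]
        refine hy.strictMono.monotone ?_
        rw [hI, Finset.mem_Ioo] at hj
        omega
      have := hM.slopes_sub_le hL (a := y k - z) (b := y k - y j) (by linarith [hz.2])
        (by linarith [hz.1]) hmem.2
        (fun hcon => hbad ⟨by linarith [hcon.1, hz.2], hcon.2⟩) hs' (hs j hj)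
      rw [abs_sub_comm, add_zero]
      refine this.trans (mul_le_mul_of_nonneg_left ?_ hMp.le)
      linarith [hz.2]
  have hgaps : ∑ j ∈ I, (y (j + 1) - y j) ≤ L := by
    have h₁ := sum_range_eq_add_sum_Ioo (fun j => y (j + 1) - y j) k hN
    have h₂ := sum_range_add_eq (g := fun j => y (j + 1) - y j) (N := N) (fun j => hy.gap_add j) k
    rw [h₂, hy.sum_gap] at h₁
    have := hy.ordered k
    linarith
  have hsum : |∑ j ∈ I, (c / N * s j - cellDensity c N y j * ∫ z in (y j)..(y (j + 1)), κ z)|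
      ≤ c / N * (M * L + 4 * M) := by
    refine (Finset.abs_sum_le_sum_abs _ _).trans ((Finset.sum_le_sum hterm).trans ?_)
    rw [← Finset.mul_sum, Finset.sum_add_distrib, ← Finset.sum_filter, ← hB, ← Finset.mul_sum,
      Finset.sum_const, nsmul_eq_mul]
    have h₂ : (B.card : ℝ) ≤ 2 := by exact_mod_cast hcard
    have h₃ : (B.card : ℝ) * (2 * M) ≤ 4 * M := by nlinarith
    gcongr
  rw [e₁, Finset.mul_sum]
  rw [Finset.sum_sub_distrib] at hsum
  rw [_root_.abs_le] at *
  constructor <;> linarith [hfirst.1, hfirst.2, hsum.1, hsum.2]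

end Conv

/-! ### Regularity in time -/

/-- Young's inequality with a free parameter: a small l makes the contribution of the dissipation
small, and the large constant 1/(2l) is then multiplied by a short time. -/
theorem sqrt_le_of_pos {a l : ℝ} (ha : 0 ≤ a) (hl : 0 < l) : √a ≤ 1 / (2 * l) + l / 2 * a := by
  have h := Real.sq_sqrt ha
  have h₁ : 0 ≤ (l * √a - 1) ^ 2 / (2 * l) := by positivity
  have h₂ : (l * √a - 1) ^ 2 / (2 * l) = l / 2 * √a ^ 2 - √a + 1 / (2 * l) := by
    field_simp
    ring
  rw [h₂, h] at h₁
  linarith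

/-- The factor N/c in the velocity cancels the weight c/N of a particle, so the mean displacement is
driven by the variation of φ(ρ), hence by √D. Taking l small and then t - s small gives
equicontinuity in time, uniformly in N. -/
theorem IsParticles.sum_abs_sub_le {K W φ ρ₀ : ℝ → ℝ} {L T M C : ℝ} {N : ℕ} {x : ℤ → ℝ → ℝ}
    (h : IsParticles K φ L ρ₀ T N x) (hM : KernelBound K M) (hφ : IsDiffusion W φ) (hL : 0 < L)
    (hc : 0 < mass L ρ₀)
    (hC : ∫ t in (0 : ℝ)..T, dissipation φ (mass L ρ₀) N (fun k => x k t) ≤ C)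
    {s t : ℝ} (hs : 0 ≤ s) (hst : s ≤ t) (ht : t ≤ T) {l : ℝ} (hl : 0 < l) :
    mass L ρ₀ / N * ∑ k ∈ Finset.range N, |x k t - x k s|
      ≤ (mass L ρ₀ ^ 2 * M + 1 / (2 * l)) * (t - s) + l / 2 * C := by
  set c := mass L ρ₀ with hcdef
  have hT : 0 ≤ T := hs.trans (hst.trans ht)
  have hN : 0 < N := (h.config (Set.left_mem_Icc.2 hT)).pos hL
  have hN' : (0 : ℝ) < N := by exact_mod_cast hN
  have hsub : Set.Icc s t ⊆ Set.Icc 0 T := Set.Icc_subset_Icc hs ht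
  have hii : ∀ k, IntervalIntegrable (fun r => |increment φ c N (fun i => x i r) k|) volume s t := by
    intro k
    refine ContinuousOn.intervalIntegrable ?_
    rw [Set.uIcc_of_le hst]
    exact (h.continuousOn_increment hφ hL hT hc k).abs.mono hsub
  have hdi : ∀ a b, a ∈ Set.Icc 0 T → b ∈ Set.Icc 0 T →
      IntervalIntegrable (fun r => dissipation φ c N (fun k => x k r)) volume a b := by
    intro a b ha hb
    refine ContinuousOn.intervalIntegrable ?_
    exact (h.continuousOn_dissipation hφ hL hT hc).mono (Set.uIcc_subset_Icc ha hb)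
  have hk : ∀ k ∈ Finset.range N, |x k t - x k s|
      ≤ ∫ r in s..t, (c * M + N / c * |increment φ c N (fun i => x i r) k|) := by
    intro k _
    refine abs_sub_le_integral_of_abs_deriv_le hst
      ((h.absolutelyContinuous k).mono (by rwa [Set.uIcc_of_le hst, Set.uIcc_of_le hT]))
      (intervalIntegrable_const.add ((hii k).const_mul _)) ?_
    filter_upwards [h.ae_hasDerivAt] with r hr hmem
    obtain ⟨v, hv, hder⟩ := hr ⟨hs.trans_lt hmem.1, hmem.2.trans_le ht⟩ k
    rw [hder.deriv]
    refine (abs_sub _ _).trans ?_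
    rw [abs_neg, abs_mul, abs_of_pos (div_pos hN' hc)]
    exact add_le_add (hv.abs_le hM hc) le_rfl
  calc c / N * ∑ k ∈ Finset.range N, |x k t - x k s|
      ≤ c / N * ∑ k ∈ Finset.range N,
          ∫ r in s..t, (c * M + N / c * |increment φ c N (fun i => x i r) k|) := by
        gcongr with k hk'
        exact hk k hk'
    _ = ∫ r in s..t, (c ^ 2 * M + ∑ k ∈ Finset.range N, |increment φ c N (fun i => x i r) k|) := by
        rw [← intervalIntegral.integral_finsetSum fun (k : ℕ) _ =>
          intervalIntegrable_const.add ((hii k).const_mul _),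
          ← intervalIntegral.integral_const_mul]
        refine intervalIntegral.integral_congr fun r _ => ?_
        simp only [Finset.sum_add_distrib, Finset.sum_const, Finset.card_range, nsmul_eq_mul,
          ← Finset.mul_sum]
        field_simp
    _ ≤ ∫ r in s..t, ((c ^ 2 * M + 1 / (2 * l)) + l / 2 * dissipation φ c N (fun k => x k r)) := by
        refine intervalIntegral.integral_mono_on hst ?_ ?_ fun r _ => ?_
        · refine intervalIntegrable_const.add ?_
          have := IntervalIntegrable.sum (Finset.range N)
            (f := fun (k : ℕ) r => |increment φ c N (fun i => x i r) k|) fun k _ => hii k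
          simpa [Finset.sum_fn] using this
        · exact intervalIntegrable_const.add
            ((hdi s t (hsub (Set.left_mem_Icc.2 hst)) (hsub (Set.right_mem_Icc.2 hst))).const_mul _)
        · have h₁ := sum_abs_increment_le φ c N (fun i => x i r)
          have h₂ := sqrt_le_of_pos (dissipation_nonneg φ c N (fun i => x i r)) hl
          linarith
    _ ≤ (c ^ 2 * M + 1 / (2 * l)) * (t - s) + l / 2 * C := by
        rw [intervalIntegral.integral_add intervalIntegrable_const
          ((hdi s t (hsub (Set.left_mem_Icc.2 hst)) (hsub (Set.right_mem_Icc.2 hst))).const_mul _),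
          intervalIntegral.integral_const, intervalIntegral.integral_const_mul, smul_eq_mul,
          mul_comm (t - s)]
        have : ∫ r in s..t, dissipation φ c N (fun k => x k r)
            ≤ ∫ r in (0 : ℝ)..T, dissipation φ c N (fun k => x k r) :=
          intervalIntegral.integral_mono_interval hs hst ht
            (Eventually.of_forall fun r => dissipation_nonneg φ c N _)
            (hdi 0 T (Set.left_mem_Icc.2 hT) (Set.right_mem_Icc.2 hT))
        gcongr
        exact this.trans hC

/-! ### Distribution functions -/

section Distribution

variable {L c R : ℝ} {N : ℕ} {y y' : ℤ → ℝ}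

namespace IsConfig

theorem integral_density_le (hy : IsConfig L N y) (hL : 0 < L) (hc : 0 < c)
    (hR : ∀ k, cellDensity c N y k ≤ R) {a b : ℝ} (hab : a ≤ b) :
    ∫ z in a..b, density L c N y z ≤ R * (b - a) := by
  have := abs_integral_le_of_abs_le hab (fun z _ => hy.abs_density_le hL hc hR z)
  exact (le_abs_self _).trans this

theorem integral_density_nonneg (hy : IsConfig L N y) (hL : 0 < L) (hc : 0 < c) {a b : ℝ}
    (hab : a ≤ b) : 0 ≤ ∫ z in a..b, density L c N y z :=
  intervalIntegral.integral_nonneg hab fun z _ => hy.density_nonneg hL hc z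

/-- The difference of the distribution functions is controlled by the mean displacement. -/
theorem distribution_sub_le (hy : IsConfig L N y) (hy' : IsConfig L N y') (hL : 0 < L) (hc : 0 < c)
    (hR : ∀ k, cellDensity c N y k ≤ R) (hR' : ∀ k, cellDensity c N y' k ≤ R) (hR0 : 0 < R)
    {z : ℝ}
    (hlt : ∫ w in (y' 0)..z, density L c N y' w < ∫ w in (y 0)..z, density L c N y w) :
    (min ((∫ w in (y 0)..z, density L c N y w) - ∫ w in (y' 0)..z, density L c N y' w) c - c / N)
      * ((∫ w in (y 0)..z, density L c N y w) - ∫ w in (y' 0)..z, density L c N y' w)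
      ≤ R * (c / N * ∑ k ∈ Finset.range N, |y' k - y k|) := by
  set a := ∫ w in (y 0)..z, density L c N y w with ha
  set b := ∫ w in (y' 0)..z, density L c N y' w with hb
  have hN := hy.pos hL
  have hN' : (0 : ℝ) < N := by exact_mod_cast hN
  have hq : 0 < c / N := by positivity
  have hD : 0 < a - b := by linarith
  have hi := hy.intervalIntegrable_density hL hc hR
  have hi' := hy'.intervalIntegrable_density hL hc hR'
  -- A particle whose label mass k c/N lies between b and a crosses z: yₖ ≤ z ≤ y'ₖ. The masses a -
  -- k c/N and k c/N - b lie in between, and a density at most R forces the distance.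
  have hlabel : ∀ k : ℤ, b < k * (c / N) → k * (c / N) < a → (a - b) / R ≤ |y' k - y k| := by
    intro k hbk hka
    have h₁ := hy.integral_density_span hL hc hR k
    have h₂ := hy'.integral_density_span hL hc hR' k
    have e₁ := intervalIntegral.integral_add_adjacent_intervals (hi (y 0) (y k)) (hi (y k) z)
    have e₂ := intervalIntegral.integral_add_adjacent_intervals (hi' (y' 0) z) (hi' z (y' k))
    rw [h₁, ← ha] at e₁
    rw [h₂, ← hb] at e₂
    have hyk : y k ≤ z := by
      by_contra hcon
      have := hy.integral_density_nonneg hL hc (not_le.1 hcon).le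
      rw [intervalIntegral.integral_symm] at this
      linarith
    have hyk' : z ≤ y' k := by
      by_contra hcon
      have := hy'.integral_density_nonneg hL hc (not_le.1 hcon).le
      rw [intervalIntegral.integral_symm] at this
      linarith
    have h₃ := hy.integral_density_le hL hc hR hyk
    have h₄ := hy'.integral_density_le hL hc hR' hyk'
    rw [abs_of_nonneg (by linarith), div_le_iff₀ hR0]
    linarith
  set D' := min (a - b) c with hD'
  -- p is the first label above b, followed by n admissible consecutive labels. Capping by c in D'
  -- keeps n ≤ N, so that no particle is counted twice.
  set p : ℤ := ⌊b / (c / N)⌋ + 1 with hp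
  set n : ℕ := ⌈D' / (c / N) - 1⌉₊ with hn
  have hD'N : D' / (c / N) ≤ N := by
    rw [div_le_iff₀ hq, mul_div_cancel₀ _ hN'.ne']
    exact min_le_right _ _
  have hnN : n ≤ N := by
    rw [hn, Nat.ceil_le]
    linarith
  have hper : ∀ k : ℤ, |y' (k + N) - y (k + N)| = |y' k - y k| := by
    intro k; rw [hy.lift, hy'.lift]; congr 1; ring
  have hsum := sum_range_add_eq (g := fun k => |y' k - y k|) hper p
  have hge : ∀ i ∈ Finset.range n, (a - b) / R ≤ |y' (p + i) - y (p + i)| := by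
    intro i hi
    have hi' : (i : ℝ) < D' / (c / N) - 1 := Nat.lt_ceil.1 (Finset.mem_range.1 hi)
    have hfl := Int.floor_le (b / (c / N))
    have hfl' := Int.lt_floor_add_one (b / (c / N))
    refine hlabel (p + i) ?_ ?_
    · rw [← div_lt_iff₀ hq, hp]
      push_cast
      have : (0 : ℝ) ≤ i := Nat.cast_nonneg i
      linarith
    · rw [← lt_div_iff₀ hq, hp]
      push_cast
      have h₁ : D' / (c / N) ≤ (a - b) / (c / N) := by gcongr; exact min_le_left _ _
      rw [sub_div] at h₁
      linarith
  have hlow : (n : ℝ) * ((a - b) / R) ≤ ∑ k ∈ Finset.range N, |y' k - y k| := by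
    rw [← hsum]
    have h₁ := Finset.card_nsmul_le_sum _ _ _ hge
    rw [Finset.card_range, nsmul_eq_mul] at h₁
    exact h₁.trans (Finset.sum_le_sum_of_subset_of_nonneg (Finset.range_mono hnN)
      fun _ _ _ => abs_nonneg _)
  have hnle : D' / (c / N) - 1 ≤ n := Nat.le_ceil _
  have hstep : (D' / (c / N) - 1) * ((a - b) / R) ≤ ∑ k ∈ Finset.range N, |y' k - y k| :=
    (mul_le_mul_of_nonneg_right hnle (by positivity)).trans hlow
  calc (D' - c / N) * (a - b) = R * (c / N * ((D' / (c / N) - 1) * ((a - b) / R))) := by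
        field_simp
    _ ≤ R * (c / N * ∑ k ∈ Finset.range N, |y' k - y k|) := by gcongr

/-- If the mean displacement is small, so is the change of the distribution function. -/
theorem abs_distribution_sub_le (hy : IsConfig L N y) (hy' : IsConfig L N y') (hL : 0 < L)
    (hc : 0 < c) (hR : ∀ k, cellDensity c N y k ≤ R) (hR' : ∀ k, cellDensity c N y' k ≤ R)
    (hR0 : 0 < R) {η : ℝ} (hη : 0 < η) (hN : c / N ≤ min η c / 2)
    (hsmall : c / N * ∑ k ∈ Finset.range N, |y' k - y k| < min η c * η / (2 * R)) (z : ℝ) :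
    |(∫ w in (y 0)..z, density L c N y w) - ∫ w in (y' 0)..z, density L c N y' w| ≤ η := by
  have key : ∀ y y' : ℤ → ℝ, IsConfig L N y → IsConfig L N y' →
      (∀ k, cellDensity c N y k ≤ R) → (∀ k, cellDensity c N y' k ≤ R) →
      c / N * ∑ k ∈ Finset.range N, |y' k - y k| < min η c * η / (2 * R) →
      (∫ w in (y 0)..z, density L c N y w) - ∫ w in (y' 0)..z, density L c N y' w ≤ η := by
    intro y y' hy hy' hR hR' hsmall
    by_contra hcon
    rw [not_le] at hcon
    have h₁ := hy.distribution_sub_le hy' hL hc hR hR' hR0 (z := z) (by linarith)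
    set D := (∫ w in (y 0)..z, density L c N y w) - ∫ w in (y' 0)..z, density L c N y' w with hD
    have h₂ : min η c ≤ min D c := min_le_min_right c hcon.le
    have h₃ : 0 < min η c := lt_min hη hc
    have h₄ : min η c / 2 * η ≤ (min D c - c / N) * D := by
      refine mul_le_mul (by linarith) hcon.le hη.le (by linarith)
    rw [lt_div_iff₀ (by positivity)] at hsmall
    linarith
  rw [abs_le]
  have h₁ := key y y' hy hy' hR hR' hsmall
  have h₂ := key y' y hy' hy hR' hR (by simpa only [abs_sub_comm] using hsmall)
  constructor <;> linarith

end IsConfig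

end Distribution

/-! ### Compactness -/

/-- The Arzelà–Ascoli theorem for asymptotically equicontinuous sequences. -/
theorem exists_subseq_uniformCauchy {X : Type*} [PseudoMetricSpace X] [CompactSpace X]
    {f : ℕ → X → ℝ} {B : ℝ} (hB : ∀ n x, |f n x| ≤ B)
    (hf : ∀ η > 0, ∃ δ > 0, ∃ n₀, ∀ n ≥ n₀, ∀ x y, dist x y < δ → |f n x - f n y| ≤ η) :
    ∃ m : ℕ → ℕ, StrictMono m ∧
      ∀ η > 0, ∃ i₀, ∀ i ≥ i₀, ∀ j ≥ i₀, ∀ x, |f (m i) x - f (m j) x| ≤ η := by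
  obtain ⟨D, hDc, hDd⟩ := TopologicalSpace.exists_countable_dense X
  have : Countable D := hDc
  -- Convergence on a countable dense set comes from compactness of a countable product of
  -- intervals; asymptotic equicontinuity extends it to all points.
  obtain ⟨g, _, m, hm, hlim⟩ := (isCompact_univ_pi (fun _ : D => isCompact_Icc (a := -B) (b := B))).tendsto_subseq
    (x := fun n (d : D) => f n d) (fun n d _ => abs_le.1 (hB n d))
  refine ⟨m, hm, fun η hη => ?_⟩
  obtain ⟨δ, hδ, n₀, hn₀⟩ := hf (η / 3) (by linarith)
  obtain ⟨J, hJ⟩ := isCompact_univ.elim_finite_subcover (fun d : D => Metric.ball (d : X) δ)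
    (fun d => Metric.isOpen_ball) (fun x _ => by
      obtain ⟨d, hd, hdist⟩ := Metric.dense_iff.1 hDd x δ hδ
      exact Set.mem_iUnion.2 ⟨⟨d, hdist⟩, by rw [Metric.mem_ball] at *; rwa [dist_comm]⟩)
  have hJ' : ∀ᶠ i in atTop, ∀ d ∈ J, |f (m i) d - g d| < η / 6 := by
    rw [Finset.eventually_all]
    intro d _
    have := Metric.tendsto_nhds.1 ((continuous_apply d).continuousAt.tendsto.comp hlim) (η / 6)
      (by linarith)
    simpa [Real.dist_eq] using this
  obtain ⟨i₀, hi₀⟩ := eventually_atTop.1 hJ'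
  refine ⟨max i₀ n₀, fun i hi j hj x => ?_⟩
  obtain ⟨d, hd, hxd⟩ : ∃ d ∈ J, x ∈ Metric.ball (d : X) δ := by
    have := hJ (Set.mem_univ x)
    simpa using this
  rw [Metric.mem_ball] at hxd
  have hi' : n₀ ≤ m i := ((le_max_right _ _).trans hi).trans (hm.id_le i)
  have hj' : n₀ ≤ m j := ((le_max_right _ _).trans hj).trans (hm.id_le j)
  have h₁ := abs_le.1 (hn₀ (m i) hi' x d hxd)
  have h₂ := abs_le.1 (hn₀ (m j) hj' x d hxd)
  have h₃ := abs_lt.1 (hi₀ i ((le_max_left _ _).trans hi) d hd)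
  have h₄ := abs_lt.1 (hi₀ j ((le_max_left _ _).trans hj) d hd)
  rw [abs_le]
  constructor <;> linarith [h₁.1, h₁.2, h₂.1, h₂.2, h₃.1, h₃.2, h₄.1, h₄.2]

/-- A quantitative form of strict monotonicity: by compactness φ increases by at least μ > 0 over
every step δ starting in [0, R]. It allows differences of densities to be tested against differences
of φ, even where φ' vanishes. -/
theorem IsDiffusion.exists_abs_sub_le {W φ : ℝ → ℝ} (hφ : IsDiffusion W φ) {R δ : ℝ} (hR : 0 < R)
    (hδ : 0 < δ) : ∃ κ > 0, ∀ a ∈ Set.Icc 0 R, ∀ b ∈ Set.Icc 0 R,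
      |a - b| ≤ δ + κ * ((φ a - φ b) * (a - b)) := by
  have hcont : ContinuousOn (fun b => φ (b + δ) - φ b) (Set.Icc 0 R) := by
    refine ContinuousOn.sub (hφ.contDiffOn.continuousOn.comp (by fun_prop) fun b hb => ?_)
      (hφ.contDiffOn.continuousOn.mono fun b hb => hb.1)
    exact Set.mem_Ici.2 (by linarith [hb.1])
  obtain ⟨b₀, hb₀, hmin⟩ := isCompact_Icc.exists_isMinOn (Set.nonempty_Icc.2 hR.le) hcont
  set μ := φ (b₀ + δ) - φ b₀ with hμ
  have hμ0 : 0 < μ := sub_pos.2 (hφ.strictMonoOn hb₀.1 (Set.mem_Ici.2 (by linarith [hb₀.1]))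
    (by linarith))
  refine ⟨1 / μ, by positivity, ?_⟩
  have key : ∀ a ∈ Set.Icc 0 R, ∀ b ∈ Set.Icc 0 R, b ≤ a →
      a - b ≤ δ + 1 / μ * ((φ a - φ b) * (a - b)) := by
    intro a ha b hb hba
    have hmono : φ b ≤ φ a := hφ.strictMonoOn.monotoneOn hb.1 ha.1 hba
    rcases le_or_gt (a - b) δ with h | h
    · have : 0 ≤ 1 / μ * ((φ a - φ b) * (a - b)) :=
        mul_nonneg (by positivity) (mul_nonneg (by linarith) (by linarith))
      linarith
    · have h₁ : μ ≤ φ (b + δ) - φ b := hmin hb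
      have h₂ : φ (b + δ) ≤ φ a :=
        hφ.strictMonoOn.monotoneOn (Set.mem_Ici.2 (by linarith [hb.1])) ha.1 (by linarith)
      have h₃ : a - b ≤ 1 / μ * ((φ a - φ b) * (a - b)) := by
        rw [div_mul_eq_mul_div, one_mul, le_div_iff₀ hμ0, mul_comm]
        gcongr
        linarith
      linarith
  intro a ha b hb
  rcases le_total b a with h | h
  · rw [abs_of_nonneg (by linarith)]
    exact key a ha b hb h
  · rw [abs_sub_comm, abs_of_nonneg (by linarith)]
    have := key b hb a ha h
    rwa [show (φ a - φ b) * (a - b) = (φ b - φ a) * (b - a) by ring]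

section Comparison

variable {W φ : ℝ → ℝ} {L c R : ℝ} {N N' : ℕ} {y y' : ℤ → ℝ}

/-- Summation by parts against a periodic function. -/
theorem IsConfig.integral_map_density_mul (hy : IsConfig L N y) (hL : 0 < L)
    {r : ℝ → ℝ} (hper : Function.Periodic r L)
    (hint : ∀ a b, IntervalIntegrable (fun z => φ (density L c N y z) * r z) volume a b)
    {G : ℝ → ℝ} (hG : ∀ a b, ∫ z in a..b, r z = G b - G a) (hGper : Function.Periodic G L) :
    ∫ z in (-(L / 2))..(L / 2), φ (density L c N y z) * r z
      = -∑ k ∈ Finset.range N, increment φ c N y k * G (y k) := by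
  have hpd : Function.Periodic (fun z => φ (density L c N y z) * r z) L := by
    intro z; simp only [hy.density_periodic hL z, hper z]
  rw [hy.integral_period hpd hint]
  have h₁ : ∀ k : ℕ, ∫ z in (y k)..(y (k + 1)), φ (density L c N y z) * r z
      = φ (cellDensity c N y k) * G (y (k + 1)) - φ (cellDensity c N y k) * G (y k) := by
    intro k
    rw [hy.integral_cell hL (fun ρ z => φ ρ * r z), intervalIntegral.integral_const_mul, hG]
    ring
  have hshift := sum_range_shift_neg (N := N)
    (g := fun k => φ (cellDensity c N y k) * G (y (k + 1))) (fun k => by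
      simp only [hy.cellDensity_add]
      rw [show k + (N : ℤ) + 1 = k + 1 + N by ring, hy.lift, hGper])
  simp only [sub_add_cancel] at hshift
  rw [Finset.sum_congr rfl fun k _ => h₁ k, Finset.sum_sub_distrib, ← hshift,
    ← Finset.sum_sub_distrib, ← Finset.sum_neg_distrib]
  refine Finset.sum_congr rfl fun k _ => ?_
  rw [increment]; ring

theorem IsConfig.abs_integral_map_density_mul_le (hy : IsConfig L N y) (hL : 0 < L)
    {r : ℝ → ℝ} (hper : Function.Periodic r L)
    (hint : ∀ a b, IntervalIntegrable (fun z => φ (density L c N y z) * r z) volume a b)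
    {G : ℝ → ℝ} {g : ℝ} (hG : ∀ a b, ∫ z in a..b, r z = G b - G a)
    (hGper : Function.Periodic G L) (hg : ∀ z, |G z| ≤ g) :
    |∫ z in (-(L / 2))..(L / 2), φ (density L c N y z) * r z| ≤ g * √(dissipation φ c N y) := by
  have hg0 : 0 ≤ g := (abs_nonneg _).trans (hg 0)
  rw [hy.integral_map_density_mul hL hper hint hG hGper, abs_neg]
  calc |∑ k ∈ Finset.range N, increment φ c N y k * G (y k)|
      ≤ ∑ k ∈ Finset.range N, |increment φ c N y k| * g := by
        refine (Finset.abs_sum_le_sum_abs _ _).trans (Finset.sum_le_sum fun k _ => ?_)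
        rw [abs_mul]
        exact mul_le_mul_of_nonneg_left (hg _) (abs_nonneg _)
    _ ≤ g * √(dissipation φ c N y) := by
        rw [← Finset.sum_mul, mul_comm]
        exact mul_le_mul_of_nonneg_left (sum_abs_increment_le φ c N y) hg0

theorem IsDiffusion.measurable_comp (hφ : IsDiffusion W φ) {X : Type*} [MeasurableSpace X]
    {u : X → ℝ} (hu : Measurable u) (hu0 : ∀ p, 0 ≤ u p) : Measurable (fun p => φ (u p)) := by
  have hc : Continuous (fun r : ℝ => φ (max r 0)) :=
    hφ.contDiffOn.continuousOn.comp_continuous (by fun_prop) fun r => le_max_right r 0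
  have : (fun p => φ (u p)) = (fun r : ℝ => φ (max r 0)) ∘ u := by
    funext p; simp [max_eq_left (hu0 p)]
  rw [this]
  exact hc.measurable.comp hu

theorem IsDiffusion.abs_map_le (hφ : IsDiffusion W φ) {r : ℝ} (hr : 0 ≤ r) (hrR : r ≤ R) :
    |φ r| ≤ φ R := by
  rw [abs_of_nonneg (hφ.map_nonneg hr)]
  exact hφ.strictMonoOn.monotoneOn hr (hr.trans hrR) hrR

/-- Two discrete densities with close distribution functions are close in `L¹`. -/
theorem integral_abs_density_sub_le (hφ : IsDiffusion W φ) (hy : IsConfig L N y)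
    (hy' : IsConfig L N' y') (hL : 0 < L) (hc : 0 < c) (hR : ∀ k, cellDensity c N y k ≤ R)
    (hR' : ∀ k, cellDensity c N' y' k ≤ R) {δ κ g : ℝ} (hκ : 0 < κ)
    (hδκ : ∀ a ∈ Set.Icc 0 R, ∀ b ∈ Set.Icc 0 R, |a - b| ≤ δ + κ * ((φ a - φ b) * (a - b)))
    (hg : ∀ z ∈ Set.Icc (-(L / 2)) (L / 2), |(∫ w in (-(L / 2))..z, density L c N y w)
      - ∫ w in (-(L / 2))..z, density L c N' y' w| ≤ g) :
    ∫ z in (-(L / 2))..(L / 2), |density L c N y z - density L c N' y' z|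
      ≤ δ * L + κ * g * (√(dissipation φ c N y) + √(dissipation φ c N' y')) := by
  set ρ := density L c N y with hρ
  set ρ' := density L c N' y' with hρ'
  have hm : Measurable ρ := measurable_density_right L c N y
  have hm' : Measurable ρ' := measurable_density_right L c N' y'
  have hρ0 := hy.density_nonneg (c := c) hL hc
  have hρ0' := hy'.density_nonneg (c := c) hL hc
  have hρR := hy.density_le (c := c) hL hR
  have hρR' := hy'.density_le (c := c) hL hR'
  have hi := hy.intervalIntegrable_density hL hc hR
  have hi' := hy'.intervalIntegrable_density hL hc hR'
  set r : ℝ → ℝ := fun z => ρ z - ρ' z with hr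
  have hrm : Measurable r := hm.sub hm'
  have hrR : ∀ z, |r z| ≤ R := fun z =>
    abs_sub_le_of_mem_Icc (hρ0 z) (hρR z) (hρ0' z) (hρR' z)
  have hri : ∀ a b, IntervalIntegrable r volume a b := fun a b => (hi a b).sub (hi' a b)
  have hrper : Function.Periodic r L := fun z => by
    simp only [hr, hρ, hρ', hy.density_periodic hL z, hy'.density_periodic hL z]
  set G : ℝ → ℝ := fun z => ∫ w in (-(L / 2))..z, r w with hGdef
  have hG : ∀ a b, ∫ z in a..b, r z = G b - G a := fun a b => by
    simp only [hGdef]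
    rw [← intervalIntegral.integral_add_adjacent_intervals (hri (-(L / 2)) a) (hri a b)]
    ring
  -- Equal total masses make the primitive G periodic, so summation by parts on the circle leaves no
  -- boundary term.
  have hzero : ∫ z in (-(L / 2))..(L / 2), r z = 0 := by
    have h₁ := hy.mass_density hL hc hR
    have h₂ := hy'.mass_density hL hc hR'
    rw [mass] at h₁ h₂
    simp only [hr]
    rw [intervalIntegral.integral_sub (hi _ _) (hi' _ _), h₁, h₂, sub_self]
  have hGper : Function.Periodic G L := by
    intro z
    have h₁ := hG z (z + L)
    have h₂ := hrper.intervalIntegral_add_eq z (-(L / 2))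
    rw [show -(L / 2) + L = L / 2 by ring, hzero] at h₂
    linarith
  have hGg : ∀ z, |G z| ≤ g := by
    intro z
    obtain ⟨w, hw, hwz⟩ := hGper.exists_mem_Ico hL z (-(L / 2))
    rw [hwz]
    have := hg w ⟨hw.1, by linarith [hw.2]⟩
    simp only [hGdef, hr]
    rwa [intervalIntegral.integral_sub (hi _ _) (hi' _ _)]
  have hprod : ∀ {u : ℝ → ℝ}, Measurable u → (∀ z, 0 ≤ u z) → (∀ z, u z ≤ R) →
      ∀ a b, IntervalIntegrable (fun z => φ (u z) * r z) volume a b := by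
    intro u hu hu0 huR
    refine intervalIntegrable_of_abs_le (C := φ R * R) ((hφ.measurable_comp hu hu0).mul hrm)
      fun z => ?_
    rw [abs_mul]
    exact mul_le_mul (hφ.abs_map_le (hu0 z) (huR z)) (hrR z) (abs_nonneg _)
      (hφ.map_nonneg ((hu0 z).trans (huR z)))
  have hp := hprod hm hρ0 hρR
  have hp' := hprod hm' hρ0' hρR'
  have b₁ := hy.abs_integral_map_density_mul_le hL hrper hp hG hGper hGg
  have b₂ := hy'.abs_integral_map_density_mul_le hL hrper hp' hG hGper hGg
  have hab : -(L / 2) ≤ L / 2 := by linarith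
  calc ∫ z in (-(L / 2))..(L / 2), |ρ z - ρ' z|
      ≤ ∫ z in (-(L / 2))..(L / 2), (δ + κ * (φ (ρ z) * r z - φ (ρ' z) * r z)) := by
        refine intervalIntegral.integral_mono_on hab (hri _ _).abs
          (intervalIntegrable_const.add (((hp _ _).sub (hp' _ _)).const_mul _)) fun z _ => ?_
        rw [← sub_mul]
        exact hδκ _ ⟨hρ0 z, hρR z⟩ _ ⟨hρ0' z, hρR' z⟩
    _ = δ * L + κ * ((∫ z in (-(L / 2))..(L / 2), φ (ρ z) * r z)
          - ∫ z in (-(L / 2))..(L / 2), φ (ρ' z) * r z) := by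
        rw [intervalIntegral.integral_add intervalIntegrable_const
          (((hp _ _).sub (hp' _ _)).const_mul _), intervalIntegral.integral_const,
          intervalIntegral.integral_const_mul, intervalIntegral.integral_sub (hp _ _) (hp' _ _),
          smul_eq_mul]
        ring
    _ ≤ δ * L + κ * g * (√(dissipation φ c N y) + √(dissipation φ c N' y')) := by
        rw [mul_assoc]
        gcongr
        rw [mul_add]
        linarith [(abs_le.1 b₁).2, (abs_le.1 b₂).1]

end Comparison

/-! ### Extension of the particle paths to all times -/

/-- Nothing is known about the curves outside [0, T]. Freezing them there gives continuous paths,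
hence jointly measurable densities and bounds valid at all times. -/
theorem IsParticles.exists_extension {K W φ ρ₀ : ℝ → ℝ} {L T M : ℝ} {N : ℕ} {x : ℤ → ℝ → ℝ}
    (h : IsParticles K φ L ρ₀ T N x) (hM : KernelBound K M) (hφ : IsDiffusion W φ) (hL : 0 < L)
    (hT : 0 ≤ T) (hc : 0 < mass L ρ₀) :
    ∃ x' : ℤ → ℝ → ℝ, IsParticles K φ L ρ₀ T N x' ∧ (∀ k, Continuous (x' k)) ∧
      (∀ t, ∃ s ∈ Set.Icc 0 T, ∀ k, x' k t = x' k s) ∧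
      ∀ t ∈ Set.Icc 0 T, ∀ k, x' k t = x k t := by
  have hproj : ∀ t ∈ Set.Icc 0 T, (Set.projIcc 0 T hT t : ℝ) = t := fun t ht => by
    rw [Set.projIcc_of_mem hT ht]
  set x' : ℤ → ℝ → ℝ := fun k t => x k (Set.projIcc 0 T hT t) with hx'
  have heq : ∀ t ∈ Set.Icc 0 T, ∀ k, x' k t = x k t := fun t ht k => by
    simp only [hx', hproj t ht]
  have hconf : ∀ t ∈ Set.Icc 0 T, (fun k => x' k t) = fun k => x k t := fun t ht =>
    funext fun k => heq t ht k
  have h0 : (0 : ℝ) ∈ Set.Icc 0 T := Set.left_mem_Icc.2 hT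
  obtain ⟨C, _, hlip⟩ := h.exists_lipschitz hM hφ hL hT hc
  refine ⟨x', ⟨?_, ?_, ?_, ?_, ?_⟩, ?_, ?_, heq⟩
  · intro t ht k; rw [heq t ht, heq t ht, h.lift t ht]
  · intro t ht k; rw [heq t ht, heq t ht]; exact h.ordered t ht k
  · intro k hk; rw [heq 0 h0]; exact h.initial k hk
  · intro k
    refine absolutelyContinuousOnInterval_of_abs_sub_le (C := C) hT fun s hs t ht => ?_
    rw [heq s hs, heq t ht]
    exact hlip k s hs t ht
  · filter_upwards [h.ode] with t ht hmem k
    have hmem' : t ∈ Set.Icc 0 T := Set.Ioo_subset_Icc_self hmem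
    obtain ⟨s, hs, hder⟩ := ht hmem k
    refine ⟨s, ?_, ?_⟩
    · intro j hj
      rw [heq t hmem', heq t hmem']
      exact hs j hj
    · rw [hconf t hmem']
      refine hder.congr_of_eventuallyEq ?_
      filter_upwards [Ioo_mem_nhds hmem.1 hmem.2] with r hr
      exact heq r (Set.Ioo_subset_Icc_self hr) k
  · intro k
    exact (h.continuousOn hT k).comp_continuous (continuous_subtype_val.comp continuous_projIcc)
      fun t => (Set.projIcc 0 T hT t).2
  · intro t
    refine ⟨Set.projIcc 0 T hT t, (Set.projIcc 0 T hT t).2, fun k => ?_⟩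
    rw [heq _ (Set.projIcc 0 T hT t).2]

/-! ### Test functions -/

/-- The partial derivatives of a function of two variables, in the direction `e`. -/
noncomputable def partialDeriv (e : ℝ × ℝ) (g : ℝ × ℝ → ℝ) (p : ℝ × ℝ) : ℝ := fderiv ℝ g p e

section Partial

variable {g : ℝ × ℝ → ℝ} {L : ℝ}

theorem contDiff_partialDeriv (hg : ContDiff ℝ ∞ g) (e : ℝ × ℝ) :
    ContDiff ℝ ∞ (partialDeriv e g) := by
  unfold partialDeriv
  exact (hg.fderiv_right (by simp)).clm_apply contDiff_const

theorem hasDerivAt_partial_fst (hg : ContDiff ℝ ∞ g) (t z : ℝ) :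
    HasDerivAt (fun s => g (s, z)) (partialDeriv (1, 0) g (t, z)) t := by
  have h₁ : HasFDerivAt g (fderiv ℝ g (t, z)) (t, z) :=
    (hg.differentiable (by simp) _).hasFDerivAt
  exact h₁.comp_hasDerivAt t ((hasDerivAt_id' t).prodMk (hasDerivAt_const t z))

theorem hasDerivAt_partial_snd (hg : ContDiff ℝ ∞ g) (t z : ℝ) :
    HasDerivAt (fun w => g (t, w)) (partialDeriv (0, 1) g (t, z)) z := by
  have h₁ : HasFDerivAt g (fderiv ℝ g (t, z)) (t, z) :=
    (hg.differentiable (by simp) _).hasFDerivAt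
  exact h₁.comp_hasDerivAt z ((hasDerivAt_const z t).prodMk (hasDerivAt_id' z))

theorem hasDerivAt_along (hg : ContDiff ℝ ∞ g) {x : ℝ → ℝ} {v t : ℝ} (hx : HasDerivAt x v t) :
    HasDerivAt (fun s => g (s, x s))
      (partialDeriv (1, 0) g (t, x t) + v * partialDeriv (0, 1) g (t, x t)) t := by
  have h₁ : HasFDerivAt g (fderiv ℝ g (t, x t)) (t, x t) :=
    (hg.differentiable (by simp) _).hasFDerivAt
  refine (h₁.comp_hasDerivAt t ((hasDerivAt_id' t).prodMk hx)).congr_deriv ?_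
  have : ((1 : ℝ), v) = (1, 0) + v • ((0 : ℝ), (1 : ℝ)) := by ext <;> simp
  rw [this, map_add, map_smul, smul_eq_mul]
  rfl

theorem partialDeriv_periodic (hg : ContDiff ℝ ∞ g)
    (hper : ∀ t, Function.Periodic (fun z => g (t, z)) L) (e : ℝ × ℝ) (t : ℝ) :
    Function.Periodic (fun z => partialDeriv e g (t, z)) L := by
  intro z
  have h₁ : HasFDerivAt g (fderiv ℝ g (t, z + L)) ((t, z) + (0, L)) := by
    have := (hg.differentiable (by simp) (t, z + L)).hasFDerivAt
    simpa using this
  have h₂ : HasFDerivAt (fun p : ℝ × ℝ => g (p + (0, L))) (fderiv ℝ g (t, z + L)) (t, z) :=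
    (hasFDerivAt_comp_add_right (0, L)).2 h₁
  have h₃ : (fun p : ℝ × ℝ => g (p + (0, L))) = g := by
    funext p
    have : p + (0, L) = (p.1, p.2 + L) := by ext <;> simp
    rw [this]
    exact hper p.1 p.2
  rw [h₃] at h₂
  simp only [partialDeriv, h₂.fderiv]

theorem exists_bound_of_periodic (hg : Continuous g) (hL : 0 < L)
    (hper : ∀ t, Function.Periodic (fun z => g (t, z)) L) (T : ℝ) :
    ∃ B, 0 ≤ B ∧ ∀ t ∈ Set.Icc 0 T, ∀ z, |g (t, z)| ≤ B := by
  obtain ⟨B, hB⟩ := ((isCompact_Icc (a := (0 : ℝ)) (b := T)).prod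
    (isCompact_Icc (a := (0 : ℝ)) (b := L))).exists_bound_of_continuousOn hg.continuousOn
  refine ⟨|B|, abs_nonneg _, fun t ht z => ?_⟩
  obtain ⟨w, hw, hwz⟩ := (hper t).exists_mem_Ico₀ hL z
  have := hB (t, w) ⟨ht, Set.Ico_subset_Icc_self hw⟩
  have hwz : g (t, z) = g (t, w) := hwz
  rw [hwz]
  exact this.trans (le_abs_self B)

theorem abs_sub_le_of_partial_snd (hg : ContDiff ℝ ∞ g) {B t : ℝ}
    (hB : ∀ z, |partialDeriv (0, 1) g (t, z)| ≤ B) (z w : ℝ) :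
    |g (t, z) - g (t, w)| ≤ B * |z - w| := by
  have := convex_univ.norm_image_sub_le_of_norm_hasDerivWithin_le
    (f := fun z => g (t, z)) (f' := fun z => partialDeriv (0, 1) g (t, z)) (C := B)
    (fun z _ => (hasDerivAt_partial_snd hg t z).hasDerivWithinAt) (fun z _ => hB z)
    (Set.mem_univ w) (Set.mem_univ z)
  simpa [Real.norm_eq_abs] using this

theorem abs_sub_le_of_partial_fst (hg : ContDiff ℝ ∞ g) {B T z : ℝ}
    (hB : ∀ t ∈ Set.Icc 0 T, |partialDeriv (1, 0) g (t, z)| ≤ B) {s t : ℝ}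
    (hs : s ∈ Set.Icc 0 T) (ht : t ∈ Set.Icc 0 T) :
    |g (s, z) - g (t, z)| ≤ B * |s - t| := by
  have := (convex_Icc 0 T).norm_image_sub_le_of_norm_hasDerivWithin_le
    (f := fun s => g (s, z)) (f' := fun s => partialDeriv (1, 0) g (s, z)) (C := B)
    (fun s _ => (hasDerivAt_partial_fst hg s z).hasDerivWithinAt) (fun s hs => hB s hs) ht hs
  simpa [Real.norm_eq_abs] using this

end Partial

/-- Bounds for a test function `ψ` with partial derivatives `ψt`, `ψx`, `ψxx`. -/
structure TestBound (L T : ℝ) (ψ ψt ψx ψxx : ℝ → ℝ → ℝ) (B : ℝ) : Prop where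
  nonneg : 0 ≤ B
  continuous_t : Continuous (Function.uncurry ψt)
  continuous_x : Continuous (Function.uncurry ψx)
  continuous_xx : Continuous (Function.uncurry ψxx)
  hasDerivAt_along : ∀ (x : ℝ → ℝ) (v t : ℝ), HasDerivAt x v t →
    HasDerivAt (fun s => ψ s (x s)) (ψt t (x t) + v * ψx t (x t)) t
  hasDerivAt_x : ∀ t z, HasDerivAt (ψx t) (ψxx t z) z
  periodic_t : ∀ t, Function.Periodic (ψt t) L
  periodic_x : ∀ t, Function.Periodic (ψx t) L
  periodic_xx : ∀ t, Function.Periodic (ψxx t) L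
  abs_t_le : ∀ t ∈ Set.Icc 0 T, ∀ z, |ψt t z| ≤ B
  abs_x_le : ∀ t ∈ Set.Icc 0 T, ∀ z, |ψx t z| ≤ B
  abs_xx_le : ∀ t ∈ Set.Icc 0 T, ∀ z, |ψxx t z| ≤ B
  lipschitz : ∀ s ∈ Set.Icc 0 T, ∀ t ∈ Set.Icc 0 T, ∀ z w,
    |ψ s z - ψ t w| ≤ B * |s - t| + B * |z - w|
  lipschitz_t : ∀ t ∈ Set.Icc 0 T, ∀ z w, |ψt t z - ψt t w| ≤ B * |z - w|
  lipschitz_x : ∀ t ∈ Set.Icc 0 T, ∀ z w, |ψx t z - ψx t w| ≤ B * |z - w|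
  start : ∀ z, ψ 0 z = 0
  final : ∀ z, ψ T z = 0

theorem IsTest.exists_bound {L T : ℝ} {ψ : ℝ → ℝ → ℝ} (hψ : IsTest L T ψ) (hL : 0 < L) :
    ∃ B, TestBound L T ψ (fun t x => deriv (fun s => ψ s x) t) (fun t x => deriv (ψ t) x)
      (fun t x => deriv (deriv (ψ t)) x) B := by
  set g := Function.uncurry ψ with hgdef
  have hg : ContDiff ℝ ∞ g := hψ.smooth
  set g₁ := partialDeriv (1, 0) g with hg₁
  set g₂ := partialDeriv (0, 1) g with hg₂
  set g₂₂ := partialDeriv (0, 1) g₂ with hg₂₂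
  -- The mixed derivative supplies the Lipschitz constant in space of the time derivative, as needed
  -- for quadrature.
  set g₁₂ := partialDeriv (0, 1) g₁ with hg₁₂
  have s₁ : ContDiff ℝ ∞ g₁ := contDiff_partialDeriv hg _
  have s₂ : ContDiff ℝ ∞ g₂ := contDiff_partialDeriv hg _
  have s₂₂ : ContDiff ℝ ∞ g₂₂ := contDiff_partialDeriv s₂ _
  have s₁₂ : ContDiff ℝ ∞ g₁₂ := contDiff_partialDeriv s₁ _
  have e₁ : (fun t x => deriv (fun s => ψ s x) t) = fun t x => g₁ (t, x) := by
    funext t x; exact (hasDerivAt_partial_fst hg t x).deriv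
  have e₂ : (fun t x => deriv (ψ t) x) = fun t x => g₂ (t, x) := by
    funext t x; exact (hasDerivAt_partial_snd hg t x).deriv
  have e₂₂ : (fun t x => deriv (deriv (ψ t)) x) = fun t x => g₂₂ (t, x) := by
    funext t x
    have : deriv (ψ t) = fun x => g₂ (t, x) := congrFun e₂ t
    rw [this]
    exact (hasDerivAt_partial_snd s₂ t x).deriv
  have p : ∀ t, Function.Periodic (fun z => g (t, z)) L := hψ.periodic
  have p₁ := partialDeriv_periodic hg p (1, 0)
  have p₂ := partialDeriv_periodic hg p (0, 1)
  have p₂₂ := partialDeriv_periodic s₂ p₂ (0, 1)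
  have p₁₂ := partialDeriv_periodic s₁ p₁ (0, 1)
  obtain ⟨B₁, hB₁, h₁⟩ := exists_bound_of_periodic s₁.continuous hL p₁ T
  obtain ⟨B₂, hB₂, h₂⟩ := exists_bound_of_periodic s₂.continuous hL p₂ T
  obtain ⟨B₃, hB₃, h₃⟩ := exists_bound_of_periodic s₂₂.continuous hL p₂₂ T
  obtain ⟨B₄, hB₄, h₄⟩ := exists_bound_of_periodic s₁₂.continuous hL p₁₂ T
  set B := B₁ + B₂ + B₃ + B₄ with hB
  have h₁' : ∀ t ∈ Set.Icc 0 T, ∀ z, |g₁ (t, z)| ≤ B := fun t ht z => by linarith [h₁ t ht z]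
  have h₂' : ∀ t ∈ Set.Icc 0 T, ∀ z, |g₂ (t, z)| ≤ B := fun t ht z => by linarith [h₂ t ht z]
  have h₃' : ∀ t ∈ Set.Icc 0 T, ∀ z, |g₂₂ (t, z)| ≤ B := fun t ht z => by linarith [h₃ t ht z]
  have h₄' : ∀ t ∈ Set.Icc 0 T, ∀ z, |g₁₂ (t, z)| ≤ B := fun t ht z => by linarith [h₄ t ht z]
  obtain ⟨a, b, ha, hb, hsupp⟩ := hψ.support
  rw [e₁, e₂, e₂₂]
  refine ⟨B, by positivity, s₁.continuous, s₂.continuous, s₂₂.continuous,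
    fun x v t hx => hasDerivAt_along hg hx, hasDerivAt_partial_snd s₂, p₁, p₂, p₂₂, h₁', h₂', h₃',
    ?_, ?_, ?_, ?_, ?_⟩
  · intro s hs t ht z w
    have b₁ := abs_sub_le_of_partial_fst hg (fun t ht => h₁' t ht z) hs ht
    have b₂ := abs_sub_le_of_partial_snd hg (h₂' t ht) z w
    exact (abs_sub_le _ (ψ t z) _).trans (add_le_add b₁ b₂)
  · exact fun t ht z w => abs_sub_le_of_partial_snd s₁ (h₄' t ht) z w
  · exact fun t ht z w => abs_sub_le_of_partial_snd s₂ (h₃' t ht) z w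
  · exact fun z => hsupp 0 (fun h => by linarith [h.1]) z
  · exact fun z => hsupp T (fun h => by linarith [h.2]) z

/-! ### The weak formulation for the discrete densities -/

/-- The integrand of the weak formulation at a fixed time. -/
noncomputable def weakIntegrand (K φ : ℝ → ℝ) (L : ℝ) (a b b' r : ℝ → ℝ) (z : ℝ) : ℝ :=
  r z * a z - r z * conv K L r z * b z + φ (r z) * b' z

section Pointwise

variable {K W φ : ℝ → ℝ} {L M c R B : ℝ} {N : ℕ} {y : ℤ → ℝ}

/-- Consistency: the time derivative of the tested empirical measure is close to the weak
formulation evaluated at the discrete density. -/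
theorem IsConfig.abs_consistency_le (hy : IsConfig L N y) (hM : KernelBound K M)
    (hφ : IsDiffusion W φ) (hL : 0 < L) (hc : 0 < c) (hR : ∀ k, cellDensity c N y k ≤ R)
    {a b b' : ℝ → ℝ} (ha : ∀ z w, |a z - a w| ≤ B * |z - w|)
    (hb : ∀ z w, |b z - b w| ≤ B * |z - w|) (hbB : ∀ z, |b z| ≤ B)
    (hap : Function.Periodic a L) (hbp : Function.Periodic b L) (hbp' : Function.Periodic b' L)
    (hac : Continuous a) (hbc' : Continuous b') (hder : ∀ z, HasDerivAt b (b' z) z)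
    {v : ℤ → ℝ} (hv : ∀ k, IsDrift K L c N y k (v k)) :
    |c / N * ∑ k ∈ Finset.range N,
        (a (y k) + (-v k - N / c * increment φ c N y k) * b (y k))
      - ∫ z in (-(L / 2))..(L / 2), weakIntegrand K φ L a b b' (density L c N y) z|
      ≤ c / N * (B * L + c * B * (M * L + 5 * M) + (M * R * (L + 4) * B + M * R * L * B) * L) := by
  have hN := hy.pos hL
  have hN' : (0 : ℝ) < N := by exact_mod_cast hN
  have hMp := hM.pos
  have hB0 : 0 ≤ B := (abs_nonneg _).trans (hbB 0)
  have hbc : Continuous b := continuous_iff_continuousAt.2 fun z => (hder z).continuousAt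
  set ρ := density L c N y with hρ
  have hm : Measurable ρ := measurable_density_right L c N y
  have hρ0 := hy.density_nonneg (c := c) hL hc
  have hρR := hy.density_le (c := c) hL hR
  have hρabs := hy.abs_density_le hL hc hR
  have hρper := hy.density_periodic (c := c) hL
  have hR0 : 0 ≤ R := (abs_nonneg _).trans (hρabs 0)
  have hi := hy.intervalIntegrable_density hL hc hR
  set g : ℝ → ℝ := fun z => conv K L ρ z * b z with hg
  have hclip := hM.conv_lipschitz hL hm hρper hρabs
  have hcabs := hM.abs_conv_le hL hρabs
  have hglip : ∀ z w, |g z - g w| ≤ (M * R * (L + 4) * B + M * R * L * B) * |z - w| := by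
    intro z w
    have e : g z - g w = (conv K L ρ z - conv K L ρ w) * b z + conv K L ρ w * (b z - b w) := by
      simp only [hg]; ring
    rw [e]
    refine (abs_add_le _ _).trans ?_
    rw [abs_mul, abs_mul, add_mul]
    refine add_le_add ?_ ?_
    · calc |conv K L ρ z - conv K L ρ w| * |b z| ≤ M * R * (L + 4) * |z - w| * B :=
            mul_le_mul (hclip z w) (hbB z) (abs_nonneg _) (by positivity)
        _ = M * R * (L + 4) * B * |z - w| := by ring
    · calc |conv K L ρ w| * |b z - b w| ≤ M * R * L * (B * |z - w|) :=
            mul_le_mul (hcabs w) (hb z w) (abs_nonneg _) (by positivity)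
        _ = M * R * L * B * |z - w| := by ring
  have hcper : Function.Periodic (conv K L ρ) L := by
    intro z
    simp only [conv]
    congr 1
    funext w
    rw [show z + L - w = z - w + L by ring, rep_add_period hL]
  have hgper : Function.Periodic g L := hcper.mul hbp
  have hgc : Continuous g := by
    have : LipschitzWith (M * R * (L + 4) * B + M * R * L * B).toNNReal g :=
      LipschitzWith.of_dist_le_mul fun z w => by
        rw [Real.coe_toNNReal _ (by positivity)]; exact hglip z w
    exact this.continuous
  have q₁ := hy.abs_sum_sub_integral_le hL hc hR hap ha
  have q₂ := hy.abs_sum_sub_integral_le hL hc hR hgper hglip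
  have hdrift : |c / N * ∑ k ∈ Finset.range N, (v k * b (y k) - g (y k))|
      ≤ c / N * (c * B * (M * L + 5 * M)) := by
    rw [abs_mul, abs_of_pos (div_pos hc hN')]
    refine mul_le_mul_of_nonneg_left ?_ (by positivity)
    refine (Finset.abs_sum_le_sum_abs _ _).trans ?_
    refine (Finset.sum_le_card_nsmul _ _ (c / N * (M * L + 5 * M) * B) fun k _ => ?_).trans
      (le_of_eq ?_)
    · have h₁ := (hv k).abs_sub_conv_le hM hL hc hy hR
      simp only [hg]
      rw [← sub_mul, abs_mul]
      exact mul_le_mul h₁ (hbB _) (abs_nonneg _) (by positivity)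
    · rw [Finset.card_range, nsmul_eq_mul]
      field_simp
  have hφi : ∀ p q, IntervalIntegrable (fun z => φ (ρ z) * b' z) volume p q := by
    intro p q
    refine IntervalIntegrable.mul_continuousOn ?_ hbc'.continuousOn
    exact intervalIntegrable_of_abs_le (hφ.measurable_comp hm hρ0)
      (fun z => hφ.abs_map_le (hρ0 z) (hρR z)) p q
  have hdiff := hy.integral_map_density_mul (φ := φ) hL hbp' hφi
    (fun p q => intervalIntegral.integral_eq_sub_of_hasDerivAt (fun z _ => hder z)
      (hbc'.intervalIntegrable p q)) hbp
  have hai : ∀ p q, IntervalIntegrable (fun z => ρ z * a z) volume p q := fun p q =>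
    (hi p q).mul_continuousOn hac.continuousOn
  have hgi : ∀ p q, IntervalIntegrable (fun z => ρ z * g z) volume p q := fun p q =>
    (hi p q).mul_continuousOn hgc.continuousOn
  have hsplit : ∫ z in (-(L / 2))..(L / 2), weakIntegrand K φ L a b b' ρ z
      = (∫ z in (-(L / 2))..(L / 2), ρ z * a z) - (∫ z in (-(L / 2))..(L / 2), ρ z * g z)
        + ∫ z in (-(L / 2))..(L / 2), φ (ρ z) * b' z := by
    rw [← intervalIntegral.integral_sub (hai _ _) (hgi _ _),
      ← intervalIntegral.integral_add ((hai _ _).sub (hgi _ _)) (hφi _ _)]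
    refine intervalIntegral.integral_congr fun z _ => ?_
    simp only [weakIntegrand, hg]
    ring
  -- Four pieces: quadrature of a, error of the drift against the convolution, quadrature of the
  -- convolution times b, and the diffusion. The last equals the diffusion integral exactly, by
  -- `hdiff`.
  have hexp : c / N * ∑ k ∈ Finset.range N,
        (a (y k) + (-v k - N / c * increment φ c N y k) * b (y k))
      = c / N * ∑ k ∈ Finset.range N, a (y k)
        - c / N * ∑ k ∈ Finset.range N, (v k * b (y k) - g (y k))
        - c / N * ∑ k ∈ Finset.range N, g (y k)
        - ∑ k ∈ Finset.range N, increment φ c N y k * b (y k) := by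
    simp only [Finset.mul_sum, ← Finset.sum_sub_distrib]
    refine Finset.sum_congr rfl fun k _ => ?_
    field_simp
    ring
  rw [hexp, hsplit, hdiff]
  rw [abs_le] at *
  constructor <;> linarith [q₁.1, q₁.2, q₂.1, q₂.2, hdrift.1, hdrift.2]

end Pointwise

/-- The tested empirical measure Ψ vanishes at both end times, so its derivative integrates to zero.
Only the O(1/N) consistency error remains. -/
theorem IsParticles.abs_weak_le {K W φ ρ₀ : ℝ → ℝ} {L T M R B : ℝ} {N : ℕ} {x : ℤ → ℝ → ℝ}
    (h : IsParticles K φ L ρ₀ T N x) (hM : KernelBound K M) (hφ : IsDiffusion W φ) (hL : 0 < L)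
    (hT : 0 ≤ T) (hc : 0 < mass L ρ₀)
    (hR : ∀ t ∈ Set.Icc 0 T, ∀ k, cellDensity (mass L ρ₀) N (fun i => x i t) k ≤ R)
    {ψ ψt ψx ψxx : ℝ → ℝ → ℝ} (hψ : TestBound L T ψ ψt ψx ψxx B)
    (hint : IntervalIntegrable (fun t => ∫ z in (-(L / 2))..(L / 2),
      weakIntegrand K φ L (ψt t) (ψx t) (ψxx t) (density L (mass L ρ₀) N (fun k => x k t)) z)
      volume 0 T) :
    |∫ t in (0 : ℝ)..T, ∫ z in (-(L / 2))..(L / 2),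
      weakIntegrand K φ L (ψt t) (ψx t) (ψxx t) (density L (mass L ρ₀) N (fun k => x k t)) z|
      ≤ mass L ρ₀ / N * (B * L + mass L ρ₀ * B * (M * L + 5 * M)
        + (M * R * (L + 4) * B + M * R * L * B) * L) * T := by
  set c := mass L ρ₀ with hcdef
  have hN : 0 < N := (h.config (Set.left_mem_Icc.2 hT)).pos hL
  have hN' : (0 : ℝ) < N := by exact_mod_cast hN
  obtain ⟨C, hC, hlip⟩ := h.exists_lipschitz hM hφ hL hT hc
  set Ψ : ℝ → ℝ := fun t => c / N * ∑ k ∈ Finset.range N, ψ t (x k t) with hΨ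
  have hAC : AbsolutelyContinuousOnInterval Ψ 0 T := by
    refine absolutelyContinuousOnInterval_of_abs_sub_le
      (C := c / N * (N * (B + B * C))) hT fun s hs t ht => ?_
    simp only [hΨ]
    rw [← mul_sub, abs_mul, abs_of_pos (div_pos hc hN'), ← Finset.sum_sub_distrib, mul_assoc]
    refine mul_le_mul_of_nonneg_left ?_ (by positivity)
    refine (Finset.abs_sum_le_sum_abs _ _).trans ?_
    refine (Finset.sum_le_card_nsmul _ _ ((B + B * C) * |s - t|) fun k _ => ?_).trans (le_of_eq ?_)
    · refine (hψ.lipschitz s hs t ht _ _).trans ?_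
      have := mul_le_mul_of_nonneg_left (hlip k s hs t ht) hψ.nonneg
      linarith
    · rw [Finset.card_range, nsmul_eq_mul]; ring
  have hzero : ∫ t in (0 : ℝ)..T, deriv Ψ t = 0 := by
    rw [hAC.integral_deriv_eq_sub]
    simp [hΨ, hψ.start, hψ.final]
  have hrew : ∀ a : ℝ, |a| = |(∫ t in (0 : ℝ)..T, deriv Ψ t) - a| := fun a => by
    rw [hzero, zero_sub, abs_neg]
  rw [hrew, ← intervalIntegral.integral_sub hAC.intervalIntegrable_deriv hint]
  have := intervalIntegral.norm_integral_le_of_norm_le_const_ae (a := 0) (b := T)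
    (f := fun t => deriv Ψ t - ∫ z in (-(L / 2))..(L / 2),
      weakIntegrand K φ L (ψt t) (ψx t) (ψxx t) (density L c N (fun k => x k t)) z)
    (C := c / N * (B * L + c * B * (M * L + 5 * M)
        + (M * R * (L + 4) * B + M * R * L * B) * L)) (by
    rw [Set.uIoc_of_le hT]
    filter_upwards [h.ae_hasDerivAt, compl_mem_ae_iff.2 (measure_singleton (μ := volume) T)]
      with t ht hne hmem
    have hmem₁ : t ∈ Set.Ioo 0 T := ⟨hmem.1, lt_of_le_of_ne hmem.2 hne⟩
    have hmem' : t ∈ Set.Icc 0 T := Set.Ioo_subset_Icc_self hmem₁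
    choose v hv hder using ht hmem₁
    have hΨd : HasDerivAt Ψ (c / N * ∑ k ∈ Finset.range N,
        (ψt t (x k t) + (-v k - N / c * increment φ c N (fun i => x i t) k) * ψx t (x k t))) t :=
      (HasDerivAt.fun_sum (u := Finset.range N) fun (k : ℕ) _ =>
        hψ.hasDerivAt_along (x k) _ t (hder k)).const_mul _
    rw [hΨd.deriv, Real.norm_eq_abs]
    exact (h.config hmem').abs_consistency_le hM hφ hL hc (hR t hmem') (hψ.lipschitz_t t hmem')
      (hψ.lipschitz_x t hmem') (hψ.abs_x_le t hmem') (hψ.periodic_t t) (hψ.periodic_x t)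
      (hψ.periodic_xx t) (hψ.continuous_t.comp (Continuous.prodMk_right t))
      (hψ.continuous_xx.comp (Continuous.prodMk_right t)) (hψ.hasDerivAt_x t) hv)
  rw [sub_zero, abs_of_nonneg hT] at this
  exact this

/-! ### Compactness of the discrete densities -/

section Compactness

variable {K W φ ρ₀ : ℝ → ℝ} {L T M R C : ℝ}

/-- Arzelà–Ascoli on [0, T] × [-L/2, L/2]. Equicontinuity in time holds only for large N, since the
displacement argument loses one label of mass c/N. -/
theorem exists_subseq_distribution_cauchy {N : ℕ → ℕ} {x : ℕ → ℤ → ℝ → ℝ}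
    (hx : ∀ i, IsParticles K φ L ρ₀ T (N i) (x i)) (hM : KernelBound K M) (hφ : IsDiffusion W φ)
    (hL : 0 < L) (hc : 0 < mass L ρ₀) (hR0 : 0 < R) (hC0 : 0 ≤ C)
    (hR : ∀ i, ∀ t ∈ Set.Icc 0 T, ∀ k,
      cellDensity (mass L ρ₀) (N i) (fun l => x i l t) k ≤ R)
    (hC : ∀ i, ∫ t in (0 : ℝ)..T, dissipation φ (mass L ρ₀) (N i) (fun k => x i k t) ≤ C)
    (hN : Tendsto N atTop atTop) :
    ∃ n : ℕ → ℕ, StrictMono n ∧ ∀ η > 0, ∃ i₀, ∀ i ≥ i₀, ∀ j ≥ i₀, ∀ t ∈ Set.Icc 0 T,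
      ∀ z ∈ Set.Icc (-(L / 2)) (L / 2),
        |(∫ w in (-(L / 2))..z, density L (mass L ρ₀) (N (n i)) (fun k => x (n i) k t) w)
          - ∫ w in (-(L / 2))..z, density L (mass L ρ₀) (N (n j)) (fun k => x (n j) k t) w|
          ≤ η := by
  set c := mass L ρ₀ with hcdef
  have hMp := hM.pos
  set F : ℕ → Set.Icc (0 : ℝ) T × Set.Icc (-(L / 2)) (L / 2) → ℝ := fun i p =>
    ∫ w in (-(L / 2))..p.2, density L c (N i) (fun k => x i k p.1) w with hF
  have hconf : ∀ i, ∀ t ∈ Set.Icc 0 T, IsConfig L (N i) (fun k => x i k t) := fun i t ht =>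
    (hx i).config ht
  have habs : ∀ i, ∀ t ∈ Set.Icc 0 T, ∀ a b, a ≤ b →
      |∫ w in a..b, density L c (N i) (fun k => x i k t) w| ≤ R * (b - a) :=
    fun i t ht a b hab => abs_integral_le_of_abs_le hab
      fun z _ => (hconf i t ht).abs_density_le hL hc (hR i t ht) z
  have hspace : ∀ i, ∀ t ∈ Set.Icc 0 T, ∀ a z z' : ℝ,
      |(∫ w in a..z, density L c (N i) (fun k => x i k t) w)
        - ∫ w in a..z', density L c (N i) (fun k => x i k t) w| ≤ R * |z - z'| := by
    intro i t ht a z z'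
    have hi := (hconf i t ht).intervalIntegrable_density hL hc (hR i t ht)
    rw [intervalIntegral.integral_interval_sub_left (hi _ _) (hi _ _)]
    rcases le_total z' z with h | h
    · rw [abs_of_nonneg (sub_nonneg.2 h)]
      exact habs i t ht z' z h
    · rw [intervalIntegral.integral_symm, abs_neg, abs_sub_comm z, abs_of_nonneg (sub_nonneg.2 h)]
      exact habs i t ht z z' h
  obtain ⟨n, hn, hcau⟩ := exists_subseq_uniformCauchy (f := F) (B := R * L)
    (fun i p => by
      refine (habs i p.1 p.1.2 _ _ p.2.2.1).trans ?_
      refine mul_le_mul_of_nonneg_left ?_ hR0.le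
      linarith [p.2.2.2])
    (fun η hη => by
      -- κ is the mean displacement below which the distribution functions move by at most η/4. Half
      -- of it is spent on l C/2 by the choice of l, the other half on A |t - s|.
      set κ := min (η / 4) c * (η / 4) / (2 * R) with hκ
      have hκ0 : 0 < κ := by
        have : 0 < min (η / 4) c := lt_min (by linarith) hc
        positivity
      set l := κ / (C + 1) with hl
      have hl0 : 0 < l := by positivity
      set A := c ^ 2 * M + 1 / (2 * l) with hA
      have hA0 : 0 < A := by positivity
      have hlarge : ∀ᶠ i in atTop, c / N i ≤ min (η / 4) c / 2 :=
        ((tendsto_const_nhds.div_atTop (tendsto_natCast_atTop_atTop.comp hN)).eventually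
          (eventually_lt_nhds (half_pos (lt_min (by linarith) hc)))).mono fun i hi => le_of_lt hi
      obtain ⟨n₀, hn₀⟩ := eventually_atTop.1 hlarge
      refine ⟨min (κ / (2 * A)) (η / (2 * R)), lt_min (by positivity) (by positivity), n₀,
        fun i hi p q hpq => ?_⟩
      obtain ⟨⟨s, hs⟩, ⟨z, hz⟩⟩ := p
      obtain ⟨⟨t, ht⟩, ⟨z', hz'⟩⟩ := q
      rw [Prod.dist_eq, max_lt_iff, lt_min_iff, lt_min_iff] at hpq
      have hst : |s - t| < κ / (2 * A) := hpq.1.1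
      have hzz : |z - z'| < η / (2 * R) := hpq.2.2
      have htime : c / N i * ∑ k ∈ Finset.range (N i), |x i k t - x i k s| < κ := by
        have key : ∀ s t, s ∈ Set.Icc 0 T → t ∈ Set.Icc 0 T → s ≤ t → |s - t| < κ / (2 * A) →
            c / N i * ∑ k ∈ Finset.range (N i), |x i k t - x i k s| < κ := by
          intro s t hs ht hle hst
          have h₁ := (hx i).sum_abs_sub_le hM hφ hL hc (hC i) hs.1 hle ht.2 hl0
          rw [abs_sub_comm, abs_of_nonneg (sub_nonneg.2 hle), lt_div_iff₀ (by positivity)] at hst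
          have h₂ : l / 2 * C ≤ κ / 2 := by
            have : l * (C + 1) = κ := by rw [hl]; field_simp
            nlinarith
          linarith
        rcases le_total s t with h | h
        · exact key s t hs ht h hst
        · have := key t s ht hs h (by rwa [abs_sub_comm])
          simpa only [abs_sub_comm] using this
      have hdist := (hconf i s hs).abs_distribution_sub_le (hconf i t ht) hL hc (hR i s hs)
        (hR i t ht) hR0 (η := η / 4) (by linarith) (hn₀ i hi) htime
      have hsp := hspace i s hs (-(L / 2)) z z'
      have hzz' : R * |z - z'| ≤ η / 2 := by
        rw [lt_div_iff₀ (by positivity)] at hzz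
        linarith
      -- The displacement estimate measures mass from particle 0, which moves. Subtracting the
      -- values at -L/2 and z' fixes the base point and uses the estimate twice, for η/4 + η/4,
      -- while the change from z to z' costs η/2.
      have hsplit : ∀ t ∈ Set.Icc 0 T, ∫ w in (-(L / 2))..z', density L c (N i) (fun k => x i k t) w
          = (∫ w in (x i 0 t)..z', density L c (N i) (fun k => x i k t) w)
            - ∫ w in (x i 0 t)..(-(L / 2)), density L c (N i) (fun k => x i k t) w := by
        intro t ht
        have hi := (hconf i t ht).intervalIntegrable_density hL hc (hR i t ht)
        rw [intervalIntegral.integral_interval_sub_left (hi _ _) (hi _ _)]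
      have d₁ := abs_le.1 (hdist z')
      have d₂ := abs_le.1 (hdist (-(L / 2)))
      have d₃ := abs_le.1 (hsp.trans hzz')
      simp only [hF]
      have e₁ := hsplit s hs
      have e₂ := hsplit t ht
      rw [abs_le]
      constructor <;> linarith [d₁.1, d₁.2, d₂.1, d₂.2, d₃.1, d₃.2])
  refine ⟨n, hn, fun η hη => ?_⟩
  obtain ⟨i₀, hi₀⟩ := hcau η hη
  exact ⟨i₀, fun i hi j hj t ht z hz => hi₀ i hi j hj (⟨t, ht⟩, ⟨z, hz⟩)⟩

/-- Integrates the comparison at fixed time. Since √D ≤ (1 + D)/2, the time integral of D suffices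
and no pointwise bound on the dissipation is needed. -/
theorem eLpNorm_density_sub_le {N N' : ℕ} {x x' : ℤ → ℝ → ℝ}
    (hx : IsParticles K φ L ρ₀ T N x) (hx' : IsParticles K φ L ρ₀ T N' x')
    (hxm : ∀ k, Measurable (x k)) (hxm' : ∀ k, Measurable (x' k)) (hφ : IsDiffusion W φ)
    (hL : 0 < L) (hT : 0 ≤ T) (hc : 0 < mass L ρ₀)
    (hR : ∀ t ∈ Set.Icc 0 T, ∀ k, cellDensity (mass L ρ₀) N (fun l => x l t) k ≤ R)
    (hR' : ∀ t ∈ Set.Icc 0 T, ∀ k, cellDensity (mass L ρ₀) N' (fun l => x' l t) k ≤ R)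
    (hC : ∫ t in (0 : ℝ)..T, dissipation φ (mass L ρ₀) N (fun k => x k t) ≤ C)
    (hC' : ∫ t in (0 : ℝ)..T, dissipation φ (mass L ρ₀) N' (fun k => x' k t) ≤ C)
    {δ κ g : ℝ} (hκ : 0 < κ) (hg0 : 0 ≤ g)
    (hδκ : ∀ a ∈ Set.Icc 0 R, ∀ b ∈ Set.Icc 0 R, |a - b| ≤ δ + κ * ((φ a - φ b) * (a - b)))
    (hg : ∀ t ∈ Set.Icc 0 T, ∀ z ∈ Set.Icc (-(L / 2)) (L / 2),
      |(∫ w in (-(L / 2))..z, density L (mass L ρ₀) N (fun k => x k t) w)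
        - ∫ w in (-(L / 2))..z, density L (mass L ρ₀) N' (fun k => x' k t) w| ≤ g) :
    eLpNorm ((fun p : ℝ × ℝ => density L (mass L ρ₀) N (fun k => x k p.1) p.2)
      - fun p : ℝ × ℝ => density L (mass L ρ₀) N' (fun k => x' k p.1) p.2) 1
      (volume.restrict (Set.Icc 0 T ×ˢ Set.Ico (-(L / 2)) (L / 2)))
      ≤ ENNReal.ofReal ((δ * L + κ * g) * T + κ * g * C) := by
  set c := mass L ρ₀ with hcdef
  have hm : Measurable fun p : ℝ × ℝ => density L c N (fun k => x k p.1) p.2 :=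
    measurable_density L c N hxm
  have hm' : Measurable fun p : ℝ × ℝ => density L c N' (fun k => x' k p.1) p.2 :=
    measurable_density L c N' hxm'
  rw [eLpNorm_one_eq_lintegral_enorm, Measure.volume_eq_prod, ← Measure.prod_restrict,
    lintegral_prod _ (hm.sub hm').enorm.aemeasurable]
  have hslice : ∀ t ∈ Set.Icc 0 T,
      ∫⁻ z in Set.Ico (-(L / 2)) (L / 2),
        ‖((fun p : ℝ × ℝ => density L c N (fun k => x k p.1) p.2)
          - fun p : ℝ × ℝ => density L c N' (fun k => x' k p.1) p.2) (t, z)‖ₑ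
      ≤ ENNReal.ofReal ((δ * L + κ * g) + κ * g / 2 * (dissipation φ c N (fun k => x k t)
          + dissipation φ c N' (fun k => x' k t))) := by
    intro t ht
    have hy := hx.config ht
    have hy' := hx'.config ht
    have hi := hy.intervalIntegrable_density hL hc (hR t ht)
    have hi' := hy'.intervalIntegrable_density hL hc (hR' t ht)
    have hint := (hi (-(L / 2)) (L / 2)).sub (hi' (-(L / 2)) (L / 2))
    rw [intervalIntegrable_iff_integrableOn_Ico_of_le (by linarith)] at hint
    have h₁ := integral_abs_density_sub_le hφ hy hy' hL hc (hR t ht) (hR' t ht) hκ hδκ (hg t ht)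
    rw [intervalIntegral.integral_of_le (by linarith), ← integral_Ico_eq_integral_Ioc] at h₁
    simp only [Pi.sub_apply]
    have h₂ := ofReal_integral_norm_eq_lintegral_enorm hint
    simp only [Real.norm_eq_abs] at h₂
    rw [← h₂]
    refine ENNReal.ofReal_le_ofReal (h₁.trans ?_)
    have h₃ := sqrt_le_one_add_half (dissipation_nonneg φ c N (fun k => x k t))
    have h₄ := sqrt_le_one_add_half (dissipation_nonneg φ c N' (fun k => x' k t))
    have h₅ := mul_le_mul_of_nonneg_left (add_le_add h₃ h₄) (mul_nonneg hκ.le hg0)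
    linarith
  refine (setLIntegral_mono' measurableSet_Icc hslice).trans ?_
  have hd : IntervalIntegrable (fun t => dissipation φ c N (fun k => x k t)) volume 0 T :=
    ContinuousOn.intervalIntegrable (by
      rw [Set.uIcc_of_le hT]; exact hx.continuousOn_dissipation hφ hL hT hc)
  have hd' : IntervalIntegrable (fun t => dissipation φ c N' (fun k => x' k t)) volume 0 T :=
    ContinuousOn.intervalIntegrable (by
      rw [Set.uIcc_of_le hT]; exact hx'.continuousOn_dissipation hφ hL hT hc)
  have hR0 : 0 ≤ R := ((hx.config (Set.left_mem_Icc.2 hT)).cellDensity_pos hL hc 0).le.trans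
    (hR 0 (Set.left_mem_Icc.2 hT) 0)
  have hδ0 : 0 ≤ δ := by simpa using hδκ 0 ⟨le_rfl, hR0⟩ 0 ⟨le_rfl, hR0⟩
  have hii : IntervalIntegrable (fun t => (δ * L + κ * g) + κ * g / 2 *
      (dissipation φ c N (fun k => x k t) + dissipation φ c N' (fun k => x' k t))) volume 0 T :=
    intervalIntegrable_const.add ((hd.add hd').const_mul _)
  rw [← ofReal_integral_eq_lintegral_ofReal
    ((intervalIntegrable_iff_integrableOn_Icc_of_le hT).1 hii)
    (Eventually.of_forall fun t => by
      have := dissipation_nonneg φ c N (fun k => x k t)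
      have := dissipation_nonneg φ c N' (fun k => x' k t)
      positivity)]
  refine ENNReal.ofReal_le_ofReal ?_
  rw [integral_Icc_eq_integral_Ioc, ← intervalIntegral.integral_of_le hT,
    intervalIntegral.integral_add intervalIntegrable_const ((hd.add hd').const_mul _),
    intervalIntegral.integral_const_mul, intervalIntegral.integral_add hd hd',
    intervalIntegral.integral_const, smul_eq_mul]
  have := mul_le_mul_of_nonneg_left (add_le_add hC hC') (by positivity : 0 ≤ κ * g / 2)
  linarith

end Compactness

/-- An `L¹`-Cauchy sequence of uniformly bounded functions has a subsequence converging almost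
everywhere and in `L¹`, to a limit that inherits the bounds and the periodicity. -/
theorem exists_limit_of_cauchy {u : ℕ → ℝ × ℝ → ℝ} {R L : ℝ} {μ : Measure (ℝ × ℝ)}
    (hu : ∀ i, Measurable (u i)) (hu0 : ∀ i p, 0 ≤ u i p) (huR : ∀ i p, u i p ≤ R)
    (hper : ∀ i t, Function.Periodic (fun z => u i (t, z)) L)
    (hcau : ∀ ε : ℝ≥0∞, 0 < ε → ∃ i₀, ∀ i ≥ i₀, ∀ j ≥ i₀, eLpNorm (u i - u j) 1 μ < ε) :
    ∃ n : ℕ → ℕ, StrictMono n ∧ ∃ ρ : ℝ → ℝ → ℝ, Measurable (Function.uncurry ρ) ∧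
      (∀ t, Function.Periodic (ρ t) L) ∧ (∀ t z, 0 ≤ ρ t z ∧ ρ t z ≤ R) ∧
      Tendsto (fun i => eLpNorm (u (n i) - Function.uncurry ρ) 1 μ) atTop (𝓝 0) ∧
      ∀ᵐ p ∂μ, Tendsto (fun i => u (n i) p) atTop (𝓝 (Function.uncurry ρ p)) := by
  -- Distances summable along the subsequence give convergence almost everywhere, not only in L¹.
  obtain ⟨n, hn, hfast⟩ := extraction_forall_of_eventually'
    (P := fun k i => ∀ j ≥ i, ∀ j' ≥ i, eLpNorm (u j - u j') 1 μ < 2⁻¹ ^ k) (fun k => by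
      obtain ⟨i₀, hi₀⟩ := hcau (2⁻¹ ^ k) (ENNReal.pow_pos (by simp) k)
      exact ⟨i₀, fun i hi j hj j' hj' => hi₀ j (hi.le.trans hj) j' (hi.le.trans hj')⟩)
  have hsum : ∑' k : ℕ, (2⁻¹ : ℝ≥0∞) ^ k ≠ ⊤ := by
    rw [ENNReal.tsum_geometric, ENNReal.one_sub_inv_two, inv_inv]
    simp
  have hc' : ∀ k i j : ℕ, k ≤ i → k ≤ j → eLpNorm (u (n i) - u (n j)) 1 μ < 2⁻¹ ^ k :=
    fun k i j hi hj => hfast k _ (hn.monotone hi) _ (hn.monotone hj)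
  have hsm : ∀ i, AEStronglyMeasurable (u (n i)) μ := fun i => (hu _).aestronglyMeasurable
  have hbdd : ∀ p, BddAbove (Set.range fun i => u (n i) p) := fun p =>
    ⟨R, by rintro _ ⟨i, rfl⟩; exact huR _ p⟩
  have hbdd' : ∀ p, BddBelow (Set.range fun i => u (n i) p) := fun p =>
    ⟨0, by rintro _ ⟨i, rfl⟩; exact hu0 _ p⟩
  -- The upper limit is defined at every point, so measurability, bounds and periodicity hold
  -- everywhere and not just almost everywhere.
  set ρ : ℝ → ℝ → ℝ := fun t z => limsup (fun i => u (n i) (t, z)) atTop with hρ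
  have hae : ∀ᵐ p ∂μ, Tendsto (fun i => u (n i) p) atTop (𝓝 (Function.uncurry ρ p)) := by
    filter_upwards [Lp.ae_tendsto_of_cauchy_eLpNorm hsm le_rfl hsum hc'] with p hp
    obtain ⟨l, hl⟩ := hp
    have : Function.uncurry ρ p = l := hl.limsup_eq
    rwa [this]
  refine ⟨n, hn, ρ, ?_, ?_, ?_, Lp.cauchy_tendsto_of_tendsto hsm _ hsum hc' hae, hae⟩
  · exact Measurable.limsup fun i => hu (n i)
  · intro t z
    simp only [hρ]
    congr 1
    funext i
    exact hper (n i) t z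
  · intro t z
    constructor
    · exact le_limsup_of_frequently_le (Frequently.of_forall fun i => hu0 _ _)
        (hbdd (t, z)).isBoundedUnder_of_range
    · exact limsup_le_of_le (hbdd' (t, z)).isBoundedUnder_of_range.isCoboundedUnder_le
        (Eventually.of_forall fun i => huR _ _)

/-! ### Passage to the limit -/

theorem measurable_conv (K : ℝ → ℝ) (L : ℝ) {u : ℝ → ℝ → ℝ} (hu : Measurable (Function.uncurry u)) :
    Measurable fun p : ℝ × ℝ => conv K L (u p.1) p.2 := by
  have hf : Measurable fun q : (ℝ × ℝ) × ℝ => deriv K (rep L (q.1.2 - q.2)) * u q.1.1 q.2 := by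
    refine Measurable.mul ?_ (hu.comp ((measurable_fst.comp measurable_fst).prodMk measurable_snd))
    exact (measurable_deriv K).comp ((measurable_rep L).comp
      ((measurable_snd.comp measurable_fst).sub measurable_snd))
  simp only [conv, intervalIntegral]
  exact (hf.stronglyMeasurable.integral_prod_right'.measurable).sub
    hf.stronglyMeasurable.integral_prod_right'.measurable

section Limit

variable {K W φ : ℝ → ℝ} {L T M R B : ℝ} {ψ ψt ψx ψxx : ℝ → ℝ → ℝ}

theorem measurable_weakIntegrand (hφ : IsDiffusion W φ) (hψ : TestBound L T ψ ψt ψx ψxx B)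
    {u : ℝ → ℝ → ℝ} (hu : Measurable (Function.uncurry u)) (hu0 : ∀ t z, 0 ≤ u t z) :
    Measurable fun p : ℝ × ℝ =>
      weakIntegrand K φ L (ψt p.1) (ψx p.1) (ψxx p.1) (u p.1) p.2 := by
  unfold weakIntegrand
  exact ((hu.mul hψ.continuous_t.measurable).sub
    ((hu.mul (measurable_conv K L hu)).mul hψ.continuous_x.measurable)).add
    ((hφ.measurable_comp hu fun p => hu0 p.1 p.2).mul hψ.continuous_xx.measurable)

theorem abs_weakIntegrand_le (hM : KernelBound K M) (hφ : IsDiffusion W φ) (hL : 0 < L)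
    {a b b' r : ℝ → ℝ} (hr0 : ∀ z, 0 ≤ r z) (hrR : ∀ z, r z ≤ R) {z : ℝ} (ha : |a z| ≤ B)
    (hb : |b z| ≤ B) (hb' : |b' z| ≤ B) :
    |weakIntegrand K φ L a b b' r z| ≤ R * B + R * (M * R * L) * B + φ R * B := by
  have hrabs : ∀ z, |r z| ≤ R := fun z => by rw [abs_of_nonneg (hr0 z)]; exact hrR z
  have hR0 : 0 ≤ R := (hr0 0).trans (hrR 0)
  have hMp := hM.pos
  have hcv := hM.abs_conv_le hL hrabs z
  have hφr := hφ.abs_map_le (hr0 z) (hrR z)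
  unfold weakIntegrand
  refine (abs_add_le _ _).trans (add_le_add ((abs_sub _ _).trans (add_le_add ?_ ?_)) ?_)
  · rw [abs_mul]
    exact mul_le_mul (hrabs z) ha (abs_nonneg _) hR0
  · rw [abs_mul, abs_mul]
    exact mul_le_mul (mul_le_mul (hrabs z) hcv (abs_nonneg _) hR0) hb (abs_nonneg _) (by positivity)
  · rw [abs_mul]
    exact mul_le_mul hφr hb' (abs_nonneg _) ((abs_nonneg _).trans hφr)

theorem measurable_integral_weakIntegrand (hφ : IsDiffusion W φ)
    (hψ : TestBound L T ψ ψt ψx ψxx B)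
    {u : ℝ → ℝ → ℝ} (hu : Measurable (Function.uncurry u)) (hu0 : ∀ t z, 0 ≤ u t z) :
    Measurable fun t => ∫ z in (-(L / 2))..(L / 2),
      weakIntegrand K φ L (ψt t) (ψx t) (ψxx t) (u t) z := by
  have hf := (measurable_weakIntegrand (K := K) hφ hψ hu hu0).stronglyMeasurable
  simp only [intervalIntegral]
  exact hf.integral_prod_right'.measurable.sub hf.integral_prod_right'.measurable

theorem abs_integral_weakIntegrand_le (hM : KernelBound K M) (hφ : IsDiffusion W φ) (hL : 0 < L)
    (hψ : TestBound L T ψ ψt ψx ψxx B) {r : ℝ → ℝ} (hr0 : ∀ z, 0 ≤ r z) (hrR : ∀ z, r z ≤ R)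
    {t : ℝ} (ht : t ∈ Set.Icc 0 T) :
    |∫ z in (-(L / 2))..(L / 2), weakIntegrand K φ L (ψt t) (ψx t) (ψxx t) r z|
      ≤ (R * B + R * (M * R * L) * B + φ R * B) * L := by
  have := abs_integral_le_of_abs_le (by linarith : -(L / 2) ≤ L / 2) fun z _ =>
    abs_weakIntegrand_le hM hφ hL hr0 hrR (hψ.abs_t_le t ht z) (hψ.abs_x_le t ht z)
      (hψ.abs_xx_le t ht z)
  rwa [show L / 2 - -(L / 2) = L by ring] at this

theorem intervalIntegrable_integral_weakIntegrand (hM : KernelBound K M) (hφ : IsDiffusion W φ)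
    (hL : 0 < L) (hT : 0 ≤ T) (hψ : TestBound L T ψ ψt ψx ψxx B)
    {u : ℝ → ℝ → ℝ} (hu : Measurable (Function.uncurry u)) (hu0 : ∀ t z, 0 ≤ u t z)
    (huR : ∀ t z, u t z ≤ R) :
    IntervalIntegrable (fun t => ∫ z in (-(L / 2))..(L / 2),
      weakIntegrand K φ L (ψt t) (ψx t) (ψxx t) (u t) z) volume 0 T := by
  refine (intervalIntegrable_const
    (c := (R * B + R * (M * R * L) * B + φ R * B) * L)).mono_fun
    (measurable_integral_weakIntegrand hφ hψ hu hu0).aestronglyMeasurable ?_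
  rw [Set.uIoc_of_le hT]
  filter_upwards [ae_restrict_mem measurableSet_Ioc] with t ht
  exact (abs_integral_weakIntegrand_le hM hφ hL hψ (hu0 t) (huR t)
    (Set.Ioc_subset_Icc_self ht)).trans (le_abs_self _)

theorem tendsto_integral_of_abs_le {f : ℕ → ℝ → ℝ} {g : ℝ → ℝ} {a b A : ℝ} (hab : a ≤ b)
    (hf : ∀ i, Measurable (f i)) (hA : ∀ i, ∀ z ∈ Set.Ioc a b, |f i z| ≤ A)
    (hlim : ∀ᵐ z, z ∈ Set.Ioc a b → Tendsto (fun i => f i z) atTop (𝓝 (g z))) :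
    Tendsto (fun i => ∫ z in a..b, f i z) atTop (𝓝 (∫ z in a..b, g z)) := by
  refine intervalIntegral.tendsto_integral_filter_of_dominated_convergence (fun _ => A)
    (Eventually.of_forall fun i => (hf i).aestronglyMeasurable)
    (Eventually.of_forall fun i => Eventually.of_forall fun z hz => ?_) intervalIntegrable_const ?_
  · rw [Set.uIoc_of_le hab] at hz
    exact hA i z hz
  · rw [Set.uIoc_of_le hab]
    exact hlim

theorem tendsto_conv (hM : KernelBound K M) (hL : 0 < L) {u : ℕ → ℝ → ℝ} {r : ℝ → ℝ}
    (hu : ∀ i, Measurable (u i)) (huR : ∀ i z, |u i z| ≤ R)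
    (hlim : ∀ᵐ z, z ∈ Set.Ioc (-(L / 2)) (L / 2) → Tendsto (fun i => u i z) atTop (𝓝 (r z)))
    (x : ℝ) : Tendsto (fun i => conv K L (u i) x) atTop (𝓝 (conv K L r x)) := by
  refine tendsto_integral_of_abs_le (by linarith)
    (fun i => (measurable_kernel_comp K L x).mul (hu i)) (fun i z _ => hM.abs_mul_le (huR i) x z) ?_
  filter_upwards [hlim] with z hz hmem
  exact (hz hmem).const_mul _

theorem IsDiffusion.tendsto_map (hφ : IsDiffusion W φ) {u : ℕ → ℝ} {r : ℝ} (hu : ∀ i, 0 ≤ u i)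
    (hr : 0 ≤ r) (h : Tendsto u atTop (𝓝 r)) : Tendsto (fun i => φ (u i)) atTop (𝓝 (φ r)) :=
  (hφ.contDiffOn.continuousOn r hr).tendsto.comp
    (tendsto_nhdsWithin_iff.2 ⟨h, Eventually.of_forall hu⟩)

theorem tendsto_integral_weakIntegrand (hM : KernelBound K M) (hφ : IsDiffusion W φ) (hL : 0 < L)
    (hT : 0 ≤ T) (hψ : TestBound L T ψ ψt ψx ψxx B) {u : ℕ → ℝ → ℝ → ℝ} {ρ : ℝ → ℝ → ℝ}
    (hu : ∀ i, Measurable (Function.uncurry (u i))) (hu0 : ∀ i t z, 0 ≤ u i t z)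
    (huR : ∀ i t z, u i t z ≤ R) (hρ0 : ∀ t z, 0 ≤ ρ t z)
    (hlim : ∀ᵐ t, t ∈ Set.Ioc 0 T → ∀ᵐ z, z ∈ Set.Ioc (-(L / 2)) (L / 2) →
      Tendsto (fun i => u i t z) atTop (𝓝 (ρ t z))) :
    Tendsto (fun i => ∫ t in (0 : ℝ)..T, ∫ z in (-(L / 2))..(L / 2),
        weakIntegrand K φ L (ψt t) (ψx t) (ψxx t) (u i t) z) atTop
      (𝓝 (∫ t in (0 : ℝ)..T, ∫ z in (-(L / 2))..(L / 2),
        weakIntegrand K φ L (ψt t) (ψx t) (ψxx t) (ρ t) z)) := by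
  refine tendsto_integral_of_abs_le hT
    (fun i => measurable_integral_weakIntegrand hφ hψ (hu i) (hu0 i))
    (fun i t ht => abs_integral_weakIntegrand_le hM hφ hL hψ (hu0 i t) (huR i t)
      (Set.Ioc_subset_Icc_self ht)) ?_
  filter_upwards [hlim] with t ht hmem
  have hmem' := Set.Ioc_subset_Icc_self hmem
  have hmt : ∀ i, Measurable (u i t) := fun i => (hu i).comp measurable_prodMk_left
  refine tendsto_integral_of_abs_le (by linarith)
    (fun i => (measurable_weakIntegrand hφ hψ (hu i) (hu0 i)).comp measurable_prodMk_left)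
    (fun i z _ => abs_weakIntegrand_le hM hφ hL (hu0 i t) (huR i t) (hψ.abs_t_le t hmem' z)
      (hψ.abs_x_le t hmem' z) (hψ.abs_xx_le t hmem' z)) ?_
  filter_upwards [ht hmem] with z hz hzmem
  have hconv := tendsto_conv hM hL hmt
    (fun i z => by rw [abs_of_nonneg (hu0 i t z)]; exact huR i t z) (ht hmem) z
  have h₁ := hz hzmem
  exact ((h₁.mul_const _).sub ((h₁.mul hconv).mul_const _)).add
    ((hφ.tendsto_map (fun i => hu0 i t z) (hρ0 t z) h₁).mul_const _)

end Limit

/-- Compactness and consistency of the particle scheme, for particles that are extended to all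
times. -/
theorem exists_subseq_tendsto_weakSolution {K W φ ρ₀ : ℝ → ℝ} {L T M R C : ℝ} {N : ℕ → ℕ}
    {x : ℕ → ℤ → ℝ → ℝ}
    (hx : ∀ i, IsParticles K φ L ρ₀ T (N i) (x i)) (hxc : ∀ i k, Continuous (x i k))
    (hxt : ∀ i t, ∃ s ∈ Set.Icc 0 T, ∀ k, x i k t = x i k s)
    (hM : KernelBound K M) (hφ : IsDiffusion W φ)
    (hL : 0 < L) (hT : 0 ≤ T) (hc : 0 < mass L ρ₀) (hR0 : 0 < R) (hC0 : 0 ≤ C)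
    (hR : ∀ i, ∀ t ∈ Set.Icc 0 T, ∀ k,
      cellDensity (mass L ρ₀) (N i) (fun l => x i l t) k ≤ R)
    (hC : ∀ i, ∫ t in (0 : ℝ)..T, dissipation φ (mass L ρ₀) (N i) (fun k => x i k t) ≤ C)
    (hN : Tendsto N atTop atTop) :
    ∃ n : ℕ → ℕ, StrictMono n ∧ ∃ ρ : ℝ → ℝ → ℝ, Measurable (Function.uncurry ρ) ∧
      (∀ t, Function.Periodic (ρ t) L) ∧ (∀ t z, 0 ≤ ρ t z ∧ ρ t z ≤ R) ∧
      (∀ᵐ t, t ∈ Set.Icc 0 T → mass L (ρ t) = mass L ρ₀) ∧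
      Tendsto (fun i => eLpNorm ((fun p : ℝ × ℝ =>
          density L (mass L ρ₀) (N (n i)) (fun k => x (n i) k p.1) p.2) - Function.uncurry ρ) 1
          (volume.restrict (Set.Icc 0 T ×ˢ Set.Ico (-(L / 2)) (L / 2)))) atTop (𝓝 0) ∧
      IsWeakSolution K φ L T ρ := by
  set c := mass L ρ₀ with hcdef
  obtain ⟨n₁, hn₁, hcau⟩ := exists_subseq_distribution_cauchy hx hM hφ hL hc hR0 hC0 hR hC hN
  set u : ℕ → ℝ → ℝ → ℝ := fun i t z =>
    density L c (N (n₁ i)) (fun k => x (n₁ i) k t) z with hu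
  have hum : ∀ i, Measurable (Function.uncurry (u i)) := fun i =>
    measurable_density L c (N (n₁ i)) fun k => (hxc (n₁ i) k).measurable
  have hconf : ∀ i t, IsConfig L (N i) (fun k => x i k t) ∧
      ∀ k, cellDensity c (N i) (fun l => x i l t) k ≤ R := by
    intro i t
    obtain ⟨s, hs, hst⟩ := hxt i t
    rw [show (fun k => x i k t) = fun k => x i k s from funext hst]
    exact ⟨(hx i).config hs, hR i s hs⟩
  have hu0 : ∀ i t z, 0 ≤ u i t z := fun i t z => (hconf _ t).1.density_nonneg hL hc z
  have huR : ∀ i t z, u i t z ≤ R := fun i t z => (hconf _ t).1.density_le hL (hconf _ t).2 z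
  obtain ⟨n₂, hn₂, ρ, hρm, hρper, hρR, hnorm, hae⟩ := exists_limit_of_cauchy
    (u := fun i => Function.uncurry (u i)) (R := R) (L := L)
    (μ := volume.restrict (Set.Icc 0 T ×ˢ Set.Ico (-(L / 2)) (L / 2))) hum
    (fun i p => hu0 i p.1 p.2) (fun i p => huR i p.1 p.2)
    (fun i t => (hconf (n₁ i) t).1.density_periodic hL)
    (fun ε hε => by
      obtain ⟨e, he0, heε⟩ : ∃ e : ℝ, 0 < e ∧ ENNReal.ofReal e < ε := by
        obtain ⟨e, he0, he⟩ := ENNReal.lt_iff_exists_nnreal_btwn.1 hε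
        exact ⟨e, by exact_mod_cast he0, by simpa using he⟩
      -- δ is fixed first, with cost at most e/2. It determines κ, and only then is the required
      -- closeness of the distribution functions chosen, again with cost at most e/2.
      obtain ⟨κ, hκ, hδκ⟩ := hφ.exists_abs_sub_le (δ := e / (2 * L * (T + 1))) hR0 (by positivity)
      obtain ⟨i₀, hi₀⟩ := hcau (e / (2 * κ * (T + C + 1))) (by positivity)
      refine ⟨i₀, fun i hi j hj => lt_of_le_of_lt ?_ heε⟩
      refine (eLpNorm_density_sub_le (hx (n₁ i)) (hx (n₁ j)) (fun k => (hxc _ k).measurable)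
        (fun k => (hxc _ k).measurable) hφ hL hT hc (hR _) (hR _) (hC _) (hC _) hκ
        (g := e / (2 * κ * (T + C + 1))) (by positivity) hδκ
        (fun t ht z hz => hi₀ i hi j hj t ht z hz)).trans ?_
      refine ENNReal.ofReal_le_ofReal ?_
      have h₁ : e / (2 * L * (T + 1)) * L * T ≤ e / 2 := by
        have : e / (2 * L * (T + 1)) * L * T = e / 2 * (T / (T + 1)) := by field_simp
        rw [this]
        exact mul_le_of_le_one_right (by positivity)
          ((div_le_one (by positivity)).2 (by linarith))
      have h₂ : κ * (e / (2 * κ * (T + C + 1))) * (T + C) ≤ e / 2 := by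
        have : κ * (e / (2 * κ * (T + C + 1))) * (T + C) = e / 2 * ((T + C) / (T + C + 1)) := by
          field_simp
        rw [this]
        exact mul_le_of_le_one_right (by positivity)
          ((div_le_one (by positivity)).2 (by linarith))
      linarith)
  have hlim : ∀ᵐ t, t ∈ Set.Icc 0 T → ∀ᵐ z, z ∈ Set.Ioc (-(L / 2)) (L / 2) →
      Tendsto (fun i => u (n₂ i) t z) atTop (𝓝 (ρ t z)) := by
    rw [Measure.volume_eq_prod, ← Measure.prod_restrict] at hae
    have := Measure.ae_ae_of_ae_prod hae
    rw [ae_restrict_iff' measurableSet_Icc] at this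
    filter_upwards [this] with t ht hmem
    have h₂ := ht hmem
    rwa [Measure.restrict_congr_set Ico_ae_eq_Ioc, ae_restrict_iff' measurableSet_Ioc] at h₂
  refine ⟨n₁ ∘ n₂, hn₁.comp hn₂, ρ, hρm, hρper, hρR, ?_, hnorm, ?_⟩
  · filter_upwards [hlim] with t ht hmem
    have h₁ := tendsto_integral_of_abs_le (a := -(L / 2)) (b := L / 2) (A := R)
      (f := fun i => u (n₂ i) t) (by linarith)
      (fun i => (hum (n₂ i)).comp measurable_prodMk_left)
      (fun i z _ => by rw [abs_of_nonneg (hu0 _ t z)]; exact huR _ t z) (ht hmem)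
    refine tendsto_nhds_unique h₁ ?_
    have h₂ : ∀ i, ∫ z in (-(L / 2))..(L / 2), u (n₂ i) t z = c := fun i =>
      (hconf _ t).1.mass_density hL hc (hconf _ t).2
    simp only [h₂]
    exact tendsto_const_nhds
  · intro ψ hψ
    obtain ⟨B, hB⟩ := hψ.exists_bound hL
    have h₁ := tendsto_integral_weakIntegrand hM hφ hL hT hB (fun i => hum (n₂ i))
      (fun i => hu0 (n₂ i)) (fun i => huR (n₂ i)) (fun t z => (hρR t z).1)
      (hlim.mono fun t ht hmem => ht (Set.Ioc_subset_Icc_self hmem))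
    -- The same integrals are O(1/N) by consistency, so their limit vanishes.
    refine tendsto_nhds_unique h₁ ?_
    set Q := B * L + c * B * (M * L + 5 * M) + (M * R * (L + 4) * B + M * R * L * B) * L with hQ
    refine squeeze_zero_norm (a := fun i => c / N (n₁ (n₂ i)) * Q * T) (fun i => ?_) ?_
    · exact (hx (n₁ (n₂ i))).abs_weak_le hM hφ hL hT hc (hR _) hB
        (intervalIntegrable_integral_weakIntegrand hM hφ hL hT hB (hum (n₂ i)) (hu0 (n₂ i))
          (huR (n₂ i)))
    · have h₂ : Tendsto (fun i => c / (N (n₁ (n₂ i)) : ℝ)) atTop (𝓝 0) :=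
        tendsto_const_nhds.div_atTop (tendsto_natCast_atTop_atTop.comp
          (hN.comp (hn₁.tendsto_atTop.comp hn₂.tendsto_atTop)))
      simpa using (h₂.mul_const Q).mul_const T

end ParticleScheme

/-! ### The main theorem. -/

theorem theorem2 (K W φ : ℝ → ℝ) (hK : ParticleScheme.IsKernel K)
    (hφ : ParticleScheme.IsDiffusion W φ) (L : ℝ) (hL : 0 < L) (ρ₀ : ℝ → ℝ)
    (hper : Function.Periodic ρ₀ L) (hbdd : MemLp ρ₀ ∞ volume)
    (hmass : ParticleScheme.mass L ρ₀ ≤ 1)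
    (ε : ℝ) (hε : 0 < ε) (hpos : ∀ᵐ x, ε ≤ ρ₀ x) (T : ℝ) (hT : 0 < T) :
    ∃ N₀ : ℕ,
      (∀ N ≥ N₀, ∃ x, ParticleScheme.IsParticles K φ L ρ₀ T N x) ∧
      ∀ x : ℕ → ℤ → ℝ → ℝ, (∀ N ≥ N₀, ParticleScheme.IsParticles K φ L ρ₀ T N (x N)) →
        ∀ m : ℕ → ℕ, StrictMono m →
          ∃ n : ℕ → ℕ, StrictMono n ∧ ∃ ρ : ℝ → ℝ → ℝ,
            Measurable (Function.uncurry ρ) ∧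
            (∀ t, Function.Periodic (ρ t) L) ∧
            (∃ M, ∀ t x, 0 ≤ ρ t x ∧ ρ t x ≤ M) ∧
            (∀ᵐ t, t ∈ Set.Icc 0 T →
              ParticleScheme.mass L (ρ t) = ParticleScheme.mass L ρ₀) ∧
            Tendsto (fun i => eLpNorm (fun p : ℝ × ℝ =>
                ParticleScheme.density L (ParticleScheme.mass L ρ₀) (m (n i))
                  (fun k => x (m (n i)) k p.1) p.2 - ρ p.1 p.2) 1
                (volume.restrict (Set.Icc 0 T ×ˢ Set.Ico (-(L / 2)) (L / 2))))
              atTop (𝓝 0) ∧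
            ParticleScheme.IsWeakSolution K φ L T ρ := by
  obtain ⟨M, hM⟩ := hK.exists_bound
  obtain ⟨M₀, hD⟩ := ParticleScheme.exists_dataBound hbdd hε hpos
  have hc := hD.mass_pos hL
  refine ⟨2, fun N hN => ParticleScheme.exists_particles hM hφ hL hD hT.le hN,
    fun x hx m hm => ?_⟩
  obtain ⟨R, C, hR0, _, hC0, hbound⟩ :=
    ParticleScheme.exists_apriori_bounds hM hφ hL hD hT.le
  -- A strictly increasing m satisfies i ≤ m i. Shifting the index by two therefore ensures that at
  -- least two particles are present, and the final subsequence carries the same shift.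
  have hm2 : ∀ i, 2 ≤ m (i + 2) := fun i => (Nat.le_add_left 2 i).trans (hm.id_le (i + 2))
  choose y hy hyc hyt hyx using fun i =>
    (hx (m (i + 2)) (hm2 i)).exists_extension hM hφ hL hT.le hc
  have hTT : T ∈ Set.Icc 0 T := Set.right_mem_Icc.2 hT.le
  obtain ⟨n, hn, ρ, hρm, hρper, hρR, hρmass, hnorm, hweak⟩ :=
    ParticleScheme.exists_subseq_tendsto_weakSolution hy hyc hyt hM hφ hL hT.le hc hR0 hC0
      (fun i => (hbound _ (hm2 i) T hTT _ (hy i)).1) (fun i => (hbound _ (hm2 i) T hTT _ (hy i)).2)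
      (hm.tendsto_atTop.comp (tendsto_add_atTop_nat 2))
  refine ⟨fun i => n i + 2, fun i j hij => Nat.add_lt_add_right (hn hij) 2, ρ, hρm, hρper,
    ⟨R, hρR⟩, hρmass, hnorm.congr fun i => eLpNorm_congr_ae ?_, hweak⟩
  filter_upwards [ae_restrict_mem (measurableSet_Icc.prod measurableSet_Ico)] with p hp
  have : (fun k => y (n i) k p.1) = fun k => x (m (n i + 2)) k p.1 :=
    funext fun k => hyx (n i) p.1 hp.1 k
  simp only [Pi.sub_apply, this]
  rfl
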